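/- **Model.** There are $n$ processes in an asynchronous network with reliable authenticated links. An adaptive adversary chooses the inputs, the schedule and, in the course of the run, up to $f=(\frac13-\epsilon)n$ processes to corrupt. It sees all messages, the outputs, and the memory of corrupted processes. Every message that was sent by a process while it was correct, to a process that is never corrupted, is eventually delivered, and every process that is never corrupted eventually proposes a value; a process is *correct* if it is never corrupted. Signatures and proofs of election are unforgeable, and a process that has already signed its message for a committee while it was correct cannot be made to sign another one for that committee after its corruption (the key is erased after use). There are two committees, INIT and CONVERGE; each process is sampled to each of them independently with probability $\min(1,\lambda/n)$, $\lambda=8\ln n$, and this remains secret until the process shows its proof of election or is corrupted. A *word* holds a signature, a proof of election, a flag or a value of a finite domain. *With high probability (WHP)* means with probability tending to $1$ as $n\to\infty$, uniformly over all adversaries. **Problems.** In BA every correct process proposes a value and decides on a value such that WHP: no two correct processes decide differently (agreement); every correct process decides (termination); and a validity condition holds. *Strong unanimity:* if all correct processes propose $v$, any correct process that decides, decides $v$. *Weak unanimity:* if all processes are correct and propose $v$, any process that decides, decides $v$. *Binary strong BA* has values in $\{\text{true},\text{false}\}$ and strong unanimity; *multivalued weak BA* has proposals in an arbitrary finite domain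 $\mathcal V$ (which may depend on $n$), decisions in $\mathcal V\cup\{\bot\}$, and weak unanimity. **Algorithm.** Let $W=\lceil(\frac23+3d)\lambda\rceil$ and $B=\lfloor(\frac13-d)\lambda\rfloor$, and let $\mathcal B$ be a black-box protocol for binary BA. Process $p_i$ with input $v_i$: (1) if sampled to INIT, it sends the signed message $\langle \mathrm{INIT},v_i\rangle_i$ to all. (2) If sampled to CONVERGE, then when it has INIT messages from $W$ sampled processes for the first time it sends to all $\langle\mathrm{CONVERGE},\text{true},QC_{v_i}\rangle_i$ if all values received so far equal $v_i$, where the quorum certificate $QC_{v_i}$ is the batch of the $W$ signed INIT messages on $v_i$, and $\langle\mathrm{CONVERGE},\text{false},\bot\rangle_i$ otherwise. (3) When it has valid CONVERGE messages from $W$ sampled processes for the first time (counting one message per sender), it calls $\mathcal B$ with input true if fewer than $B+1$ of them are of the form $\langle\mathrm{CONVERGE},\text{true},QC\rangle$, and with input false otherwise. (4) If $\mathcal B$ returns true it decides $\bot$; if $\mathcal B$ returns false it decides the value $v$ of the first valid $\langle\mathrm{CONVERGE},\text{true},QC_v\rangle_j$ from a sampled $p_j$, waiting for one if necessary. **Theorem.**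 Let $\epsilon,d$ be constants with $0<d<\frac{\epsilon}{3}$ and $\epsilon<\frac13$. There is a constant $C$, depending only on $\epsilon$ and $d$, such that for all finite domains $\mathcal V=\mathcal V_n$ and all binary protocols $\mathcal B=\mathcal B_n$: 1. if $\mathcal B$ solves binary strong BA WHP, then the algorithm solves multivalued weak BA WHP (weak unanimity, agreement and termination); 2. for $n\ge2$, the expected number of words in INIT and CONVERGE messages sent by correct processes is at most $Cn\ln^2 n$ against every adversary (and for all inputs); 3. for $n\ge2$, the expected word complexity of the algorithm (the supremum over all adversaries and inputs of the expected number of words sent by correct processes) is at most $Cn\ln^2n$ plus that of $\mathcal B$; 4. hence if the expected word complexity of $\mathcal B$ is $\widetilde O(n)$ (that is, $O(n\log^kn)$ for some $k$), then so is that of the algorithm. -/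

import Mathlib

open MeasureTheory ProbabilityTheory Filter Topology
open scoped ENNReal

/-! ## Asynchronous message-passing protocols with an adaptive Byzantine adversary -/

/-- The code run by `n` processes `Fin n`, each of which proposes one value of type `In` and decides
on a value of type `Out`.

* `Setup`, `setupLaw`: the trusted set-up (keys, VRF outputs, ...) drawn before the run;
  `Coin`, `coinLaw`: the fresh local randomness available in one local step.
* `init i ω`: the local memory that the set-up gives to process `i`.
* `start`, `recv`: the local step of a process when it proposes a value, and when it receives a
  message from a given sender (possibly before it has proposed). A step returns the new local state
  and the messages to be sent, each with its recipient.
* `Token`: the unforgeable items (signatures together with proofs of election). `tokens m` are those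
  contained in the message `m`. `canSign i s t` says that somebody who holds the local memory `s` of
  process `i` is able to produce the token `t`. Since this depends on the *current* memory, a
  process may erase a key once it has been used. A message that would contain an invalid signature
  or proof is ignored by its recipient, so such messages are not modelled.
* `words m`: the length of `m` in words. -/
structure Protocol (n : ℕ) (In Out : Type) where
  Setup : Type
  Coin : Type
  State : Type
  Msg : Type
  Token : Type
  [setupMeasurableSpace : MeasurableSpace Setup]
  [setupCountable : Countable Setup]
  [setupSingleton : MeasurableSingletonClass Setup]
  [coinMeasurableSpace : MeasurableSpace Coin]
  [coinCountable : Countable Coin]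
  [coinSingleton : MeasurableSingletonClass Coin]
  setupLaw : Measure Setup
  [setupProb : IsProbabilityMeasure setupLaw]
  coinLaw : Measure Coin
  [coinProb : IsProbabilityMeasure coinLaw]
  init : Fin n → Setup → State
  start : Fin n → State → In → Coin → State × List (Fin n × Msg)
  recv : Fin n → State → Fin n → Msg → Coin → State × List (Fin n × Msg)
  decision : State → Option Out
  tokens : Msg → Set Token
  canSign : Fin n → State → Token → Prop
  words : Msg → ℕ

namespace Protocol

attribute [instance] setupMeasurableSpace setupCountable setupSingleton coinMeasurableSpace
  coinCountable coinSingleton setupProb coinProb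

variable {n : ℕ} {In Out : Type}

/-- A message sent by a process while it was correct. -/
structure Packet (P : Protocol n In Out) where
  src : Fin n
  dst : Fin n
  msg : P.Msg

/-- A global configuration: local states, values proposed so far, processes corrupted so far, the
log of all messages sent by correct processes, and the positions in the log of the messages that
have been delivered. -/
structure Config (P : Protocol n In Out) where
  loc : Fin n → P.State
  proposal : Fin n → Option In
  corrupted : Finset (Fin n)
  log : List P.Packet
  delivered : Finset ℕ

/-- What the adversary sees of a configuration: all messages that were sent (with their contents),
what was delivered and proposed, the outputs of all processes, and the complete local memory of the
corrupted processes. -/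
structure View (P : Protocol n In Out) where
  proposal : Fin n → Option In
  corrupted : Finset (Fin n)
  log : List P.Packet
  delivered : Finset ℕ
  output : Fin n → Option Out
  memory : Fin n → Option P.State

/-- The moves of the adversary: let a correct process propose a value; deliver a message from the
log; corrupt a process; deliver a message of its choice in the name of a corrupted process; or do
nothing. -/
inductive Action (P : Protocol n In Out)
  | start (i : Fin n) (v : In)
  | deliver (k : ℕ)
  | corrupt (i : Fin n)
  | inject (src dst : Fin n) (m : P.Msg)
  | idle

/-- An adaptive adversary, which controls the inputs, the schedule and the corrupted processes:
it picks its next move as a function of everything it has seen so far. -/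
abbrev Adversary (P : Protocol n In Out) : Type := List P.View → P.Action

/-- The random choices of a run: the trusted set-up, and the coin of each step. -/
abbrev Outcome (P : Protocol n In Out) : Type := P.Setup × (ℕ → P.Coin)

/-- The law of the random choices of a run. -/
noncomputable def law (P : Protocol n In Out) : Measure P.Outcome :=
  P.setupLaw.prod (Measure.infinitePi fun _ : ℕ => P.coinLaw)

variable (P : Protocol n In Out)

open Classical in
/-- The view of a configuration. -/
noncomputable def view (c : P.Config) : P.View where
  proposal := c.proposal
  corrupted := c.corrupted
  log := c.log
  delivered := c.delivered
  output := fun i => P.decision (c.loc i)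
  memory := fun i => if i ∈ c.corrupted then some (c.loc i) else none

/-- The adversary can form the message `m`: each of its tokens occurs in a message that was sent, or
can be produced from the memory of a corrupted process. -/
def Feasible (c : P.Config) (m : P.Msg) : Prop :=
  ∀ t ∈ P.tokens m, (∃ p ∈ c.log, t ∈ P.tokens p.msg) ∨
    ∃ j ∈ c.corrupted, P.canSign j (c.loc j) t

/-- Process `i` has performed a local step with the result `r`; its messages are sent. -/
def afterLocal (c : P.Config) (i : Fin n) (r : P.State × List (Fin n × P.Msg)) : P.Config :=
  { c with
    loc := Function.update c.loc i r.1
    log := c.log ++ r.2.map fun q => ⟨i, q.1, q.2⟩ }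

open Classical in
/-- One step of the system when at most `f` processes may be corrupted. Moves that are not allowed
have no effect. -/
noncomputable def step (f : ℕ) (c : P.Config) (coin : P.Coin) : P.Action → P.Config
  | .start i v =>
      if i ∉ c.corrupted ∧ c.proposal i = none then
        { P.afterLocal c i (P.start i (c.loc i) v coin) with
          proposal := Function.update c.proposal i (some v) }
      else c
  | .deliver k =>
      match c.log[k]? with
      | none => c
      | some p =>
          if k ∉ c.delivered ∧ p.dst ∉ c.corrupted then
            { P.afterLocal c p.dst (P.recv p.dst (c.loc p.dst) p.src p.msg coin) with
              delivered := insert k c.delivered }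
          else c
  | .corrupt i =>
      if c.corrupted.card < f then { c with corrupted := insert i c.corrupted } else c
  | .inject src dst m =>
      if src ∈ c.corrupted ∧ dst ∉ c.corrupted ∧ P.Feasible c m then
        P.afterLocal c dst (P.recv dst (c.loc dst) src m coin)
      else c
  | .idle => c

/-- The configuration in which a run starts. -/
def initial (s : P.Setup) : P.Config where
  loc := fun i => P.init i s
  proposal := fun _ => none
  corrupted := ∅
  log := []
  delivered := ∅

/-- The configuration at time `t`, and the views of the adversary at the times before `t`. -/
noncomputable def runAux (f : ℕ) (adv : P.Adversary) (ω : P.Outcome) : ℕ → P.Config × List P.View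
  | 0 => (P.initial ω.1, [])
  | t + 1 =>
      let r := runAux f adv ω t
      let h := r.2 ++ [P.view r.1]
      (P.step f r.1 (ω.2 t) (adv h), h)

/-- The run of the protocol against the adversary `adv`. -/
noncomputable def run (f : ℕ) (adv : P.Adversary) (ω : P.Outcome) (t : ℕ) : P.Config :=
  (P.runAux f adv ω t).1

variable {P}

/-- `i` is never corrupted. -/
def Correct (e : ℕ → P.Config) (i : Fin n) : Prop := ∀ t, i ∉ (e t).corrupted

/-- `i` proposes `v`. -/
def Proposes (e : ℕ → P.Config) (i : Fin n) (v : In) : Prop := ∃ t, (e t).proposal i = some v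

/-- `i` decides `x` (after having proposed). -/
def Decides (e : ℕ → P.Config) (i : Fin n) (x : Out) : Prop :=
  ∃ t, (e t).proposal i ≠ none ∧ P.decision ((e t).loc i) = some x

/-- Every correct process proposes a value, and links are reliable: each message that was sent (by a
process that was correct when it sent it) to a correct process is eventually delivered. There is no
bound on the delays. -/
def Fair (e : ℕ → P.Config) : Prop :=
  (∀ i, Correct e i → ∃ v, Proposes e i v) ∧
  (∀ t k p, (e t).log[k]? = some p → Correct e p.dst → ∃ t', k ∈ (e t').delivered)

/-- No two correct processes decide differently. -/
def Agreement (e : ℕ → P.Config) : Prop :=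
  ∀ i j x y, Correct e i → Correct e j → Decides e i x → Decides e j y → x = y

/-- Every correct process eventually decides. -/
def Termination (e : ℕ → P.Config) : Prop := ∀ i, Correct e i → ∃ x, Decides e i x

/-- If all correct processes propose `v`, then any correct process that decides, decides `v`. -/
def StrongUnanimity {P : Protocol n Bool Bool} (e : ℕ → P.Config) : Prop :=
  ∀ v, (∀ i, Correct e i → Proposes e i v) → ∀ i x, Correct e i → Decides e i x → x = v

/-- If all processes are correct and propose `v`, then any process that decides, decides `v`.
Here `none : Option V` is the default value `⊥`. -/
def WeakUnanimity {V : Type} {P : Protocol n V (Option V)} (e : ℕ → P.Config) : Prop :=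
  ∀ v, (∀ i, Correct e i ∧ Proposes e i v) → ∀ i x, Decides e i x → x = some v

variable (P)

/-- The expected total length, with lengths measured by `w`, of the messages sent by correct
processes, maximized over all adversaries (hence also over all inputs). -/
noncomputable def expectedLength (f : ℕ) (w : P.Msg → ℕ) : ℝ≥0∞ :=
  ⨆ adv : P.Adversary,
    ∫⁻ ω, ⨆ t, ((((P.run f adv ω t).log.map fun p => w p.msg).sum : ℕ) : ℝ≥0∞) ∂P.law

/-- The expected word complexity. -/
noncomputable def wordComplexity (f : ℕ) : ℝ≥0∞ := P.expectedLength f P.words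

end Protocol

open Protocol

/-- With high probability, i.e. with probability tending to `1` as `n → ∞`, uniformly over all
adversaries that corrupt at most `f n` processes, the run has the property `A` if it is fair. -/
def WHP {In Out : ℕ → Type} (f : ℕ → ℕ) (P : ∀ n, Protocol n (In n) (Out n))
    (A : ∀ n, (ℕ → (P n).Config) → Prop) : Prop :=
  Tendsto (fun n => ⨆ adv : (P n).Adversary,
    (P n).law {ω | Fair ((P n).run (f n) adv ω) ∧ ¬ A n ((P n).run (f n) adv ω)}) atTop (𝓝 0)

/-- Binary strong Byzantine Agreement WHP. -/
def SolvesBinaryStrongBA (f : ℕ → ℕ) (P : ∀ n, Protocol n Bool Bool) : Prop :=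
  WHP f P fun _ e => StrongUnanimity e ∧ Agreement e ∧ Termination e

/-- Multivalued weak Byzantine Agreement WHP. -/
def SolvesMultivaluedWeakBA {V : ℕ → Type} (f : ℕ → ℕ)
    (P : ∀ n, Protocol n (V n) (Option (V n))) : Prop :=
  WHP f P fun _ e => WeakUnanimity e ∧ Agreement e ∧ Termination e

/-- `g = Õ(n)`, that is, `g = O(n log^k n)` for some `k`. -/
def IsSoftLinear (g : ℕ → ℝ≥0∞) : Prop :=
  ∃ (k : ℕ) (C : ℝ), ∀ᶠ n : ℕ in atTop, g n ≤ ENNReal.ofReal (C * n * Real.log n ^ k)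

/-! ## The parameters -/

/-- The greatest integer `≤ (1/3 - ε) n`. -/
noncomputable def maxCorrupt (ε : ℝ) (n : ℕ) : ℕ := ⌊(1 / 3 - ε) * n⌋₊

/-- The committee threshold `λ = 8 ln n`. -/
noncomputable def committeeSize (n : ℕ) : ℝ := 8 * Real.log n

/-- The quorum size `W = ⌈(2/3 + 3d) λ⌉`. -/
noncomputable def quorum (d : ℝ) (n : ℕ) : ℕ := ⌈(2 / 3 + 3 * d) * committeeSize n⌉₊

/-- The bound `B = ⌊(1/3 - d) λ⌋`. -/
noncomputable def byzBound (d : ℝ) (n : ℕ) : ℕ := ⌊(1 / 3 - d) * committeeSize n⌋₊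

/-! ## The multivalued algorithm -/

namespace MultivaluedBA

/-- The two strings for which committees are sampled. -/
inductive Role
  | init
  | converge
  deriving DecidableEq

instance : Fintype Role := ⟨{.init, .converge}, fun r => by cases r <;> simp⟩

/-- The committees: whether process `i` is sampled for the string `r`. -/
abbrev Committees (n : ℕ) : Type := Fin n × Role → Bool

/-- The probability `λ / n` of being sampled, truncated to `[0, 1]`. -/
noncomputable def sampleProb (n : ℕ) : unitInterval :=
  Set.projIcc 0 1 zero_le_one (committeeSize n / n)

/-- Each process is sampled to each committee independently with probability `λ / n`. -/
noncomputable def committeeLaw (n : ℕ) : Measure (Committees n) :=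
  Measure.pi fun _ => bernoulliMeasure true false (sampleProb n)

instance (n : ℕ) : IsProbabilityMeasure (committeeLaw n) := by
  unfold committeeLaw; infer_instance

/-- A quorum certificate on `value`: the batch of the `INIT` messages on `value` signed by the
members of `signers`. -/
structure QC (n : ℕ) (V : Type) where
  value : V
  signers : Finset (Fin n)

/-- `init j v` is the signed message `⟨INIT, v⟩_j`; `converge j (some qc)` is
`⟨CONVERGE, true, qc⟩_j` and `converge j none` is `⟨CONVERGE, false, ⊥⟩_j`; all of them come with
a proof that `j` is sampled. `binary m` is a message of the binary BA. -/
inductive Msg (n : ℕ) (V M : Type)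
  | init (j : Fin n) (v : V)
  | converge (j : Fin n) (body : Option (QC n V))
  | binary (m : M)

/-- The signatures (with proofs of election) of `INIT` and `CONVERGE` messages, and the tokens of
the binary BA. -/
inductive Token (n : ℕ) (V T : Type)
  | init (j : Fin n) (v : V)
  | converge (j : Fin n) (body : Option (QC n V))
  | binary (t : T)

/-- The tokens of a message. A `CONVERGE` message also contains the signed `INIT` messages of its
quorum certificate. -/
def msgTokens {n : ℕ} {V M T : Type} (tok : M → Set T) : Msg n V M → Set (Token n V T)
  | .init j v => {.init j v}
  | .converge j none => {.converge j none}
  | .converge j (some qc) =>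
      {.converge j (some qc)} ∪ (fun k => Token.init k qc.value) '' (qc.signers : Set (Fin n))
  | .binary m => Token.binary '' tok m

/-- The words of the messages that do not belong to the binary BA: a value, a signature, a flag and
a proof of election take one word each. -/
def ownWords {n : ℕ} {V M : Type} : Msg n V M → ℕ
  | .init _ _ => 3
  | .converge _ none => 3
  | .converge _ (some qc) => 4 + 2 * qc.signers.card
  | .binary _ => 0

/-- The length of a message in words. -/
def msgWords {n : ℕ} {V M : Type} (w : M → ℕ) : Msg n V M → ℕ
  | .binary m => w m
  | m => ownWords m

/-- The local variables of a process. `input` is `v_i`, and `none` as long as nothing has been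
proposed; `qcValue` is the value of the first valid quorum certificate received in a `CONVERGE`
message; `binary` is the state of the process in the binary BA. -/
structure State (n : ℕ) (V S : Type) where
  sampled : Role → Bool
  input : Option V
  initSent : Bool
  initSet : Finset (Fin n)
  initValues : Finset V
  convergeSent : Bool
  convergeSet : Finset (Fin n)
  count : ℕ
  qcValue : Option V
  binaryCalled : Bool
  binaryDecision : Option Bool
  binary : S

section Code

variable {n : ℕ} {V : Type} (BBA : Protocol n Bool Bool) (W B : ℕ)

/-- A local step: the new state and the messages to be sent. -/
abbrev Result (V : Type) (BBA : Protocol n Bool Bool) : Type :=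
  State n V BBA.State × List (Fin n × Msg n V BBA.Msg)

/-- Send `m` to all processes. -/
def broadcast {M : Type} (m : M) : List (Fin n × M) := (List.finRange n).map fun k => (k, m)

/-- Perform one more instruction after some others. -/
def Result.andThen (r : Result V BBA) (g : State n V BBA.State → Result V BBA) : Result V BBA :=
  ((g r.1).1, r.2 ++ (g r.1).2)

open Classical in
/-- A member of the `CONVERGE` committee sends its `CONVERGE` message when `|init-set| = W` for the
first time; it is content if all values received are its own initial value. -/
noncomputable def sendConverge (i : Fin n) (s : State n V BBA.State) : Result V BBA :=
  match s.input with
  | none => (s, [])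
  | some v =>
      if s.sampled .converge = true ∧ s.convergeSent = false ∧ s.initSet.card = W then
        ({ s with convergeSent := true },
          broadcast (.converge i (if s.initValues = {v} then some ⟨v, s.initSet⟩ else none)))
      else (s, [])

/-- When `|converge-set| = W` for the first time, the binary BA is called with the input
`alert = (count < B + 1)`. -/
def callBinary (i : Fin n) (coin : BBA.Coin) (s : State n V BBA.State) : Result V BBA :=
  if s.input.isSome = true ∧ s.binaryCalled = false ∧ s.convergeSet.card = W then
    let r := BBA.start i s.binary (decide (s.count < B + 1)) coin
    ({ s with binaryCalled := true, binary := r.1, binaryDecision := BBA.decision r.1 },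
      r.2.map fun q => (q.1, .binary q.2))
  else (s, [])

/-- The process proposes `v`: a member of the `INIT` committee broadcasts `⟨INIT, v⟩`. -/
noncomputable def onStart (i : Fin n) (s : State n V BBA.State) (v : V) (coin : BBA.Coin) :
    Result V BBA :=
  let r : Result V BBA :=
    if s.sampled .init = true then
      ({ s with input := some v, initSent := true }, broadcast (.init i v))
    else ({ s with input := some v }, [])
  Result.andThen BBA (Result.andThen BBA r (sendConverge BBA W i)) (callBinary BBA W B i coin)

open Classical in
/-- Record `⟨INIT, v⟩_j`. Only the messages up to the moment when `|init-set| = W` matter. -/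
noncomputable def recordInit (s : State n V BBA.State) (j : Fin n) (v : V) :
    State n V BBA.State :=
  if s.initSet.card < W then
    { s with initSet := insert j s.initSet, initValues := insert v s.initValues }
  else s

/-- Record a `CONVERGE` message of `j`. Each sender is counted once, and only the messages up to the
moment when `|converge-set| = W` are counted; the value of the first quorum certificate is kept. -/
def recordConverge (s : State n V BBA.State) (j : Fin n) (body : Option (QC n V)) :
    State n V BBA.State :=
  let s' : State n V BBA.State :=
    if j ∉ s.convergeSet ∧ s.convergeSet.card < W then
      { s with
        convergeSet := insert j s.convergeSet
        count := s.count + if body.isSome then 1 else 0 }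
    else s
  { s' with qcValue := s.qcValue <|> body.map QC.value }

/-- A quorum certificate is valid if it has `W` signers. (That they are sampled and have signed is
ensured by the unforgeability of tokens.) -/
def ValidBody (body : Option (QC n V)) : Prop := ∀ qc ∈ body, qc.signers.card = W

open Classical in
/-- Process `i` receives a message from `src`. -/
noncomputable def onReceive (i : Fin n) (s : State n V BBA.State) (src : Fin n)
    (m : Msg n V BBA.Msg) (coin : BBA.Coin) : Result V BBA :=
  match m with
  | .init j v =>
      if j = src then sendConverge BBA W i (recordInit BBA W s j v) else (s, [])
  | .converge j body =>
      if j = src ∧ ValidBody W body then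
        callBinary BBA W B i coin (recordConverge BBA W s j body)
      else (s, [])
  | .binary m =>
      let r := BBA.recv i s.binary src m coin
      ({ s with
          binary := r.1
          binaryDecision :=
            if s.binaryCalled = true then s.binaryDecision <|> BBA.decision r.1
            else s.binaryDecision },
        r.2.map fun q => (q.1, .binary q.2))

/-- The decision: `⊥` if the binary decision is `true`; if it is `false`, the value of a quorum
certificate, as soon as one has been received. -/
def decide? {S : Type} (s : State n V S) : Option (Option V) :=
  match s.binaryDecision with
  | none => none
  | some true => some none
  | some false => s.qcValue.map some

/-- What can be signed with the memory `s` of process `i`. The key for each of the two messages is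
erased once the message has been sent. A proof of election exists only for sampled processes. -/
def mayMint (i : Fin n) (s : State n V BBA.State) : Token n V BBA.Token → Prop
  | .init j _ => j = i ∧ s.sampled .init = true ∧ s.initSent = false
  | .converge j _ => j = i ∧ s.sampled .converge = true ∧ s.convergeSent = false
  | .binary t => BBA.canSign i s.binary t

end Code

end MultivaluedBA

open MultivaluedBA in
/-- The multivalued algorithm with values in `V`, built on the binary protocol `BBA`. -/
noncomputable def multivaluedBA {n : ℕ} (d : ℝ) (V : Type) (BBA : Protocol n Bool Bool) :
    Protocol n V (Option V) where
  Setup := Committees n × BBA.Setup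
  Coin := BBA.Coin
  State := MultivaluedBA.State n V BBA.State
  Msg := MultivaluedBA.Msg n V BBA.Msg
  Token := MultivaluedBA.Token n V BBA.Token
  setupLaw := (committeeLaw n).prod BBA.setupLaw
  coinLaw := BBA.coinLaw
  init := fun i ω =>
    { sampled := fun r => ω.1 (i, r)
      input := none
      initSent := false
      initSet := ∅
      initValues := ∅
      convergeSent := false
      convergeSet := ∅
      count := 0
      qcValue := none
      binaryCalled := false
      binaryDecision := none
      binary := BBA.init i ω.2 }
  start := onStart BBA (quorum d n) (byzBound d n)
  recv := onReceive BBA (quorum d n) (byzBound d n)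
  decision := decide?
  tokens := msgTokens BBA.tokens
  canSign := mayMint BBA
  words := msgWords BBA.words

/-!
# Multivalued weak Byzantine Agreement from binary strong Byzantine Agreement

**Simulation.** The multivalued algorithm uses the binary protocol as a black box, and for fixed
committees its messages, its deliveries and the corruptions induce a run of that protocol (`proj`,
`proj_step`). All that the outer algorithm contributes to a run is determined by the committees and
by what an adversary against the binary protocol sees, because a local step of the outer algorithm
reads the binary state only through its decision and its messages (`SameShell.step`). Hence there is
one adversary, `simulator`, against which the binary protocol has exactly these induced runs
(`run_simulator`). The committees are independent of all other random choices
(`lintegral_law_multivaluedBA`), so whatever holds for the binary protocol against every adversary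
can be integrated over the committees.

**Secrecy of the committees.** A membership is revealed when the process proposes (`INIT`), or when
it has proposed and has `W` messages `INIT` (`CONVERGE`); from then on the key is erased or was
never there. Until the process is revealed or corrupted, the run does not depend on its membership
(`differsAt_fixedRun`). For the adversary, corrupting processes early is therefore a fair game in
which one unknown independent bit after another is uncovered: the product of the exponentially
tilted bits seen so far has expectation `1` (`sum_bitWeight_mul_prod_tilt`), as if the set of
corrupted processes had been fixed in advance. Markov's inequality gives a Chernoff bound
(`sum_bitWeight_le_exp`), so with high probability each committee has at most `B` early corrupted
members and at least `W` others, and the `INIT` committee has fewer than `2W - B` members (`Good`,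
`tendsto_iSup_law_not_good`).

**Correctness.** The invariant `Inv` provides each signature with evidence: the process was sampled,
and it has either sent that message to everybody or was corrupted early. In good committees two
quorum certificates share a signer that was not corrupted early, so they have the same value
(`Good.value_eq`); this gives agreement. Every committee has a quorum of members that send their
message (`exists_quorum`), so that every correct process calls the binary protocol and the induced
run is fair (`fair_proj`). If the binary decision is `false`, some correct process has proposed
`false`, hence has seen `B + 1` certificates, one of them from a member that was not corrupted early
and has sent it to everybody; therefore every correct process can decide (`termination_of_binary`).
If all processes are correct and propose `v`, only `v` is certified and no message
`⟨CONVERGE, false, ⊥⟩` exists, so all call the binary protocol with `false`, and decide `v`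
(`weakUnanimity_of_binary`).

**Words.** A member of the `INIT` committee sends `n` messages of `3` words, and a member of the
`CONVERGE` committee sends `n` messages of at most `4 + 2W` words. The expected size of a committee
is at most `λ = 8 ln n`, and `W = O(ln n)`. All other words belong to the induced run of the binary
protocol (`words_eq`).
-/

open MultivaluedBA

/-! ### Runs and their law -/

namespace Protocol

variable {n : ℕ} {In Out : Type}

/-- A run up to time `t` uses only the coins of the steps before `t`. -/
theorem runAux_congr (P : Protocol n In Out) (f : ℕ) (adv : P.Adversary) {ω ω' : P.Outcome}
    (h1 : ω.1 = ω'.1) (t : ℕ) (h2 : ∀ s < t, ω.2 s = ω'.2 s) :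
    P.runAux f adv ω t = P.runAux f adv ω' t := by
  induction t with
  | zero => simp [runAux, h1]
  | succ t ih =>
    simp only [runAux, ih fun s hs => h2 s (by omega), h2 t (by omega)]

/-- The run up to time `t` depends on finitely many countable random choices only. -/
theorem measurable_run_comp (P : Protocol n In Out) (f : ℕ) (adv : P.Adversary) (t : ℕ)
    {α : Type*} [MeasurableSpace α] (G : P.Config → α) :
    Measurable fun ω => G (P.run f adv ω t) := by
  rcases isEmpty_or_nonempty P.Coin with h | ⟨⟨x⟩⟩
  · have : IsEmpty P.Outcome := ⟨fun ω => h.elim (ω.2 0)⟩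
    exact measurable_of_empty _
  · let π : P.Outcome → P.Setup × (Fin t → P.Coin) := fun ω => (ω.1, fun i => ω.2 i)
    let ι : P.Setup × (Fin t → P.Coin) → P.Outcome :=
      fun p => (p.1, fun s => if h : s < t then p.2 ⟨s, h⟩ else x)
    have hπ : Measurable π := by fun_prop
    have : (fun ω => G (P.run f adv ω t)) = (fun p => G (P.run f adv (ι p) t)) ∘ π := by
      funext ω
      simp only [Function.comp, run]
      rw [runAux_congr P f adv (ω := ω) (ω' := ι (π ω)) rfl t]
      intro s hs
      simp [ι, π, hs]
    rw [this]
    exact (measurable_of_countable _).comp hπ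

theorem run_succ (P : Protocol n In Out) (f : ℕ) (adv : P.Adversary) (ω : P.Outcome) (t : ℕ) :
    P.run f adv ω (t + 1) = P.step f (P.run f adv ω t) (ω.2 t)
      (adv ((P.runAux f adv ω t).2 ++ [P.view (P.run f adv ω t)])) := rfl

end Protocol

section Law

variable {n : ℕ} {d : ℝ} {V : Type} {BBA : Protocol n Bool Bool}

/-- The outcomes of the multivalued algorithm consist of the committees and an outcome of the binary
protocol. -/
noncomputable def joinEquiv (d : ℝ) (V : Type) (BBA : Protocol n Bool Bool) :
    Committees n × BBA.Outcome ≃ᵐ (multivaluedBA d V BBA).Outcome :=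
  (MeasurableEquiv.prodAssoc (α := Committees n) (β := BBA.Setup) (γ := ℕ → BBA.Coin)).symm

/-- The outcome of the multivalued algorithm made of committees and an outcome of the binary
protocol. -/
noncomputable def joinOutcome (d : ℝ) (V : Type) (b : Committees n) (ω : BBA.Outcome) :
    (multivaluedBA d V BBA).Outcome :=
  joinEquiv d V BBA (b, ω)

/-- The committees are independent of the random choices of the binary protocol. -/
theorem law_multivaluedBA :
    (multivaluedBA d V BBA).law = ((committeeLaw n).prod BBA.law).map (joinEquiv d V BBA) := by
  have h := Measure.prodAssoc_prod (μ := committeeLaw n) (ν := BBA.setupLaw)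
    (τ := Measure.infinitePi fun _ : ℕ => BBA.coinLaw)
  have key : ((committeeLaw n).prod BBA.setupLaw).prod
      (Measure.infinitePi fun _ : ℕ => BBA.coinLaw) =
      ((committeeLaw n).prod (BBA.setupLaw.prod (Measure.infinitePi fun _ : ℕ => BBA.coinLaw))).map
        (MeasurableEquiv.prodAssoc).symm := by
    rw [← h, Measure.map_map (MeasurableEquiv.measurable _) (MeasurableEquiv.measurable _)]
    simp
  exact key

instance : IsProbabilityMeasure BBA.law := by unfold Protocol.law; infer_instance

theorem lintegral_law_multivaluedBA {F : (multivaluedBA d V BBA).Outcome → ℝ≥0∞}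
    (hF : Measurable F) :
    ∫⁻ ω, F ω ∂(multivaluedBA d V BBA).law =
      ∫⁻ b, ∫⁻ ω, F (joinOutcome d V b ω) ∂BBA.law ∂(committeeLaw n) := by
  rw [law_multivaluedBA, lintegral_map_equiv, lintegral_prod]
  · rfl
  · exact (hF.comp (MeasurableEquiv.measurable _)).aemeasurable

theorem lintegral_law_multivaluedBA_symm {F : (multivaluedBA d V BBA).Outcome → ℝ≥0∞}
    (hF : Measurable F) :
    ∫⁻ ω, F ω ∂(multivaluedBA d V BBA).law =
      ∫⁻ ω, ∫⁻ b, F (joinOutcome d V b ω) ∂(committeeLaw n) ∂BBA.law := by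
  rw [law_multivaluedBA, lintegral_map_equiv, lintegral_prod_symm]
  · rfl
  · exact (hF.comp (MeasurableEquiv.measurable _)).aemeasurable

/-- An arbitrary event is at most as likely as its sections for the possible committees. -/
theorem law_multivaluedBA_le {S : Set (multivaluedBA d V BBA).Outcome} {x : ℝ≥0∞}
    (hS : ∀ b, BBA.law {ω | joinOutcome d V b ω ∈ S} ≤ x) :
    (multivaluedBA d V BBA).law S ≤ x := by
  have hcov : joinEquiv d V BBA ⁻¹' S ⊆
      ⋃ b : Committees n, ({b} ×ˢ {ω : BBA.Outcome | joinOutcome d V b ω ∈ S}) := by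
    rintro ⟨b, ω⟩ h
    exact Set.mem_iUnion.2 ⟨b, rfl, h⟩
  rw [law_multivaluedBA, MeasurableEquiv.map_apply]
  calc _ ≤ ((committeeLaw n).prod BBA.law) _ := measure_mono hcov
    _ ≤ ∑ b : Committees n, ((committeeLaw n).prod BBA.law)
          ({b} ×ˢ {ω : BBA.Outcome | joinOutcome d V b ω ∈ S}) := measure_iUnion_fintype_le _ _
    _ ≤ ∑ b : Committees n, committeeLaw n {b} * x := by
        gcongr with b
        rw [Measure.prod_prod]
        gcongr
        exact hS b
    _ = x := by
        rw [← Finset.sum_mul, sum_measure_singleton]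
        simp

end Law

/-! ### Exploring independent bits -/

section Bits

variable {ι : Type*} [Fintype ι]

/-- The probability of the vector `b` of independent bits that are `true` with probability `q`. -/
noncomputable def bitWeight (q : ℝ) (b : ι → Bool) : ℝ := ∏ i, if b i = true then q else 1 - q

/-- The density, with respect to the law of a bit that is `true` with probability `q`, of its
exponential tilt by `θ`. -/
noncomputable def tilt (q θ : ℝ) (x : Bool) : ℝ :=
  (if x = true then Real.exp θ else 1) / (1 + q * (Real.exp θ - 1))

theorem bitWeight_nonneg {q : ℝ} (h0 : 0 ≤ q) (h1 : q ≤ 1) (b : ι → Bool) : 0 ≤ bitWeight q b :=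
  Finset.prod_nonneg fun i _ => by split_ifs <;> linarith

variable [DecidableEq ι]

theorem sum_bitWeight (q : ℝ) : ∑ b : ι → Bool, bitWeight q b = 1 := by
  have := Finset.prod_univ_sum (fun _ : ι => (Finset.univ : Finset Bool))
    (fun _ x => if x = true then q else 1 - q)
  rw [Fintype.piFinset_univ] at this
  unfold bitWeight
  rw [← this]
  simp

theorem tilt_denom_pos {q : ℝ} (h0 : 0 ≤ q) (h1 : q ≤ 1) (θ : ℝ) :
    0 < 1 + q * (Real.exp θ - 1) := by
  rcases h1.lt_or_eq with h | rfl
  · nlinarith [Real.exp_pos θ, mul_nonneg h0 (Real.exp_pos θ).le]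
  · simpa using Real.exp_pos θ

/-- A tilted bit has total mass `1`, whatever is known about the other bits. -/
theorem sum_bitWeight_mul_tilt_sub_one {q : ℝ} (h0 : 0 ≤ q) (h1 : q ≤ 1) (θ : ℝ) (i : ι)
    (F : (ι → Bool) → ℝ) (hF : ∀ b x, F (Function.update b i x) = F b) :
    ∑ b, bitWeight q b * (F b * (tilt q θ (b i) - 1)) = 0 := by
  have hpos := tilt_denom_pos h0 h1 θ
  refine Finset.sum_involution (fun b _ => Function.update b i (!b i)) ?_ ?_ ?_ ?_
  · intro b _
    have hw : ∀ x, bitWeight q (Function.update b i x) = (if x = true then q else 1 - q) *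
        ∏ j ∈ Finset.univ.erase i, if b j = true then q else 1 - q := by
      intro x
      unfold bitWeight
      rw [← Finset.mul_prod_erase _ _ (Finset.mem_univ i), Function.update_self]
      congr 1
      refine Finset.prod_congr rfl fun j hj => ?_
      rw [Function.update_of_ne (Finset.ne_of_mem_erase hj)]
    have hb := hw (b i)
    rw [Function.update_eq_self] at hb
    rw [hb, hw, hF, Function.update_self]
    generalize ∏ j ∈ Finset.univ.erase i, (if b j = true then q else 1 - q) = R
    unfold tilt
    cases b i <;> simp only [Bool.not_true, Bool.not_false, if_true, Bool.false_eq_true, if_false]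
      <;> field_simp <;> ring
  · intro b _ _ h
    have := congrFun h i
    simp at this
  · simp
  · intro b _
    simp

/-- Exploring the bits one by one, where the choice of the next bit may depend on those seen so
far, is a fair game: `K t b` is the set of the bits seen at time `t`, and whether the bit `i` is
explored at time `t` does not depend on its value. -/
theorem sum_bitWeight_mul_prod_tilt {q : ℝ} (h0 : 0 ≤ q) (h1 : q ≤ 1) (θ : ℝ)
    (K : ℕ → (ι → Bool) → Finset ι) (hK0 : ∀ b, K 0 b = ∅)
    (hstep : ∀ t b, K (t + 1) b = K t b ∨ ∃ i ∉ K t b, K (t + 1) b = insert i (K t b))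
    (hflip : ∀ t b i x, i ∈ K (t + 1) b → i ∉ K t b →
      K t (Function.update b i x) = K t b ∧ K (t + 1) (Function.update b i x) = K (t + 1) b)
    (t : ℕ) : ∑ b, bitWeight q b * ∏ i ∈ K t b, tilt q θ (b i) = 1 := by
  induction t with
  | zero => simp [hK0, sum_bitWeight]
  | succ t ih =>
    rw [← ih, ← sub_eq_zero, ← Finset.sum_sub_distrib]
    -- The increment is a sum over the bits `i` that could be explored at time `t`. Each summand
    -- vanishes in the mean, since its first factor does not depend on the bit `i`.
    have hD : ∀ b, bitWeight q b * ∏ i ∈ K (t + 1) b, tilt q θ (b i) -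
        bitWeight q b * ∏ i ∈ K t b, tilt q θ (b i) =
        ∑ i, bitWeight q b * ((if i ∈ K (t + 1) b ∧ i ∉ K t b then
          ∏ i ∈ K t b, tilt q θ (b i) else 0) * (tilt q θ (b i) - 1)) := by
      intro b
      rcases hstep t b with h | ⟨i, hi, h⟩
      · rw [h, sub_self]
        refine (Finset.sum_eq_zero fun i _ => ?_).symm
        rw [if_neg (by tauto)]
        ring
      · rw [h, Finset.sum_eq_single i]
        · rw [Finset.prod_insert hi, if_pos ⟨Finset.mem_insert_self _ _, hi⟩]
          ring
        · intro j _ hj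
          rw [if_neg (by simp [hj])]
          ring
        · simp
    simp_rw [hD]
    rw [Finset.sum_comm]
    refine Finset.sum_eq_zero fun i _ => ?_
    refine sum_bitWeight_mul_tilt_sub_one h0 h1 θ i
      (fun b => if i ∈ K (t + 1) b ∧ i ∉ K t b then ∏ i ∈ K t b, tilt q θ (b i) else 0) ?_
    intro b x
    by_cases hb : i ∈ K (t + 1) b ∧ i ∉ K t b
    · obtain ⟨e1, e2⟩ := hflip t b i x hb.1 hb.2
      rw [if_pos (by rw [e1, e2]; exact hb), if_pos hb, e1]
      refine Finset.prod_congr rfl fun j hj => ?_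
      rw [Function.update_of_ne]
      rintro rfl
      exact hb.2 hj
    · rw [if_neg hb, if_neg]
      intro hb'
      obtain ⟨e1, e2⟩ := hflip t _ i (b i) hb'.1 hb'.2
      simp only [Function.update_idem, Function.update_eq_self] at e1 e2
      rw [← e1, ← e2] at hb'
      exact hb hb'

/-- The case of a set `S` of bits that is fixed in advance. -/
theorem sum_bitWeight_mul_prod_tilt_const {q : ℝ} (h0 : 0 ≤ q) (h1 : q ≤ 1) (θ : ℝ)
    (S : Finset ι) : ∑ b, bitWeight q b * ∏ i ∈ S, tilt q θ (b i) = 1 := by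
  induction S using Finset.induction_on with
  | empty => simp [sum_bitWeight]
  | insert i S hi ih =>
    rw [← ih, ← sub_eq_zero, ← Finset.sum_sub_distrib]
    rw [← sum_bitWeight_mul_tilt_sub_one h0 h1 θ i (fun b => ∏ i ∈ S, tilt q θ (b i)) ?_]
    · refine Finset.sum_congr rfl fun b _ => ?_
      rw [Finset.prod_insert hi]
      ring
    · intro b x
      refine Finset.prod_congr rfl fun j hj => ?_
      rw [Function.update_of_ne]
      rintro rfl
      exact hi hj

/-- Markov's inequality for the tilted weight. -/
theorem sum_bitWeight_le_exp {q : ℝ} (h0 : 0 ≤ q) (h1 : q ≤ 1) {θ : ℝ} (hθ : |θ| ≤ 1) {y : ℝ}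
    (K : (ι → Bool) → Finset ι) (hK : ∑ b, bitWeight q b * ∏ i ∈ K b, tilt q θ (b i) = 1)
    (A : Finset (ι → Bool))
    (hA : ∀ b ∈ A, y ≤ θ * ((K b).filter fun i => b i = true).card -
      (K b).card * (q * (θ + θ ^ 2))) :
    ∑ b ∈ A, bitWeight q b ≤ Real.exp (-y) := by
  have hpos := tilt_denom_pos h0 h1 θ
  have hden : 1 + q * (Real.exp θ - 1) ≤ Real.exp (q * (θ + θ ^ 2)) := by
    have e1 := Real.abs_exp_sub_one_sub_id_le hθ
    have e2 : Real.exp θ - 1 ≤ θ + θ ^ 2 := by linarith [(abs_le.1 e1).2]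
    calc _ ≤ q * (θ + θ ^ 2) + 1 := by linarith [mul_le_mul_of_nonneg_left e2 h0]
      _ ≤ _ := Real.add_one_le_exp _
  have hprod : ∀ b, Real.exp (θ * ((K b).filter fun i => b i = true).card -
      (K b).card * (q * (θ + θ ^ 2))) ≤ ∏ i ∈ K b, tilt q θ (b i) := by
    intro b
    unfold tilt
    rw [Finset.prod_div_distrib, Finset.prod_ite, Finset.prod_const, Finset.prod_const_one,
      Finset.prod_const, mul_one, Real.exp_sub, mul_comm θ, Real.exp_nat_mul, Real.exp_nat_mul]
    gcongr
  have hle : ∑ b ∈ A, bitWeight q b * Real.exp y ≤ 1 := by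
    rw [← hK]
    calc _ ≤ ∑ b ∈ A, bitWeight q b * ∏ i ∈ K b, tilt q θ (b i) := by
          refine Finset.sum_le_sum fun b hb => mul_le_mul_of_nonneg_left ?_ (bitWeight_nonneg h0 h1 b)
          exact (Real.exp_le_exp.2 (hA b hb)).trans (hprod b)
      _ ≤ _ := by
          refine Finset.sum_le_sum_of_subset_of_nonneg (Finset.subset_univ _) fun b _ _ => ?_
          exact mul_nonneg (bitWeight_nonneg h0 h1 b) ((Real.exp_pos _).le.trans (hprod b))
  rw [← Finset.sum_mul] at hle
  rw [Real.exp_neg]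
  exact (le_div_iff₀ (Real.exp_pos y)).2 hle |>.trans_eq (one_div _)

end Bits

section CommitteeLaw

variable {n : ℕ}

theorem committeeLaw_singleton (b : Committees n) :
    committeeLaw n {b} = ENNReal.ofReal (bitWeight (sampleProb n : ℝ) b) := by
  unfold committeeLaw bitWeight
  rw [Measure.pi_singleton, ENNReal.ofReal_prod_of_nonneg]
  · refine Finset.prod_congr rfl fun i _ => ?_
    rw [bernoulliMeasure_apply _ (MeasurableSet.singleton _)]
    have h1 := (sampleProb n).2.1
    have h2 := (sampleProb n).2.2
    cases b i
    · simp [ENNReal.ofReal]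
      rw [Real.toNNReal_of_nonneg (by linarith)]
      rfl
    · simp [ENNReal.ofReal]
      rw [Real.toNNReal_of_nonneg h1]
      rfl
  · intro i _
    have h1 := (sampleProb n).2.1
    have h2 := (sampleProb n).2.2
    split_ifs <;> linarith

theorem committeeLaw_le_of_sum_le {A : Set (Committees n)} {x : ℝ}
    (h : ∀ A' : Finset (Committees n), (A' : Set (Committees n)) = A →
      ∑ b ∈ A', bitWeight (sampleProb n : ℝ) b ≤ x) :
    committeeLaw n A ≤ ENNReal.ofReal x := by
  classical
  have hA : ((A.toFinset : Finset _) : Set (Committees n)) = A := Set.coe_toFinset A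
  rw [← hA, ← sum_measure_singleton]
  simp_rw [committeeLaw_singleton]
  rw [← ENNReal.ofReal_sum_of_nonneg fun b _ =>
    bitWeight_nonneg (sampleProb n).2.1 (sampleProb n).2.2 b]
  exact ENNReal.ofReal_le_ofReal (h _ hA)

end CommitteeLaw

/-! ### The memory of a process -/

namespace MultivaluedBA

section Local

variable {n : ℕ} {V : Type} {BBA : Protocol n Bool Bool} {W B : ℕ}

/-- The reveal point of the `CONVERGE` committee: the process has proposed and has `W` messages
`INIT`. From then on, all the `INIT` messages it takes into account are fixed. -/
def InitDone {S : Type} (W : ℕ) (s : State n V S) : Prop := s.input.isSome = true ∧ s.initSet.card = W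

/-- Invariants of the memory of a single process. -/
structure LocalInv (BBA : Protocol n Bool Bool) (W : ℕ) (s : State n V BBA.State) : Prop where
  initSent : s.initSent = true ↔ s.sampled .init = true ∧ s.input.isSome = true
  convergeSent : s.convergeSent = true ↔ s.sampled .converge = true ∧ InitDone W s
  binaryCalled : s.binaryCalled = true ↔ s.input.isSome = true ∧ s.convergeSet.card = W
  initSet_le : s.initSet.card ≤ W
  convergeSet_le : s.convergeSet.card ≤ W
  called_of_decision : s.binaryDecision.isSome = true → s.binaryCalled = true
  decision_of_called : s.binaryCalled = true → (BBA.decision s.binary).isSome = true →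
    s.binaryDecision.isSome = true
  initValues : s.initSet.Nonempty → s.initValues.Nonempty

/-- The memory of a process grows: `s'` is a possible memory after `s`. -/
structure Grows {S : Type} (W : ℕ) (s s' : State n V S) : Prop where
  sampled : s'.sampled = s.sampled
  input : ∀ v, s.input = some v → s'.input = some v
  initSet : s.initSet ⊆ s'.initSet
  convergeSet : s.convergeSet ⊆ s'.convergeSet
  convergeSent : s.convergeSent = true → s'.convergeSent = true
  initFull : s.initSet.card = W → s'.initSet = s.initSet ∧ s'.initValues = s.initValues
  convergeFull : s.convergeSet.card = W → s'.convergeSet = s.convergeSet ∧ s'.count = s.count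
  qcValue : ∀ v, s.qcValue = some v → s'.qcValue = some v
  binaryCalled : s.binaryCalled = true → s'.binaryCalled = true

theorem Grows.refl {S : Type} (s : State n V S) : Grows W s s := by
  constructor <;> simp

theorem Grows.trans {S : Type} {s s' s'' : State n V S} (h : Grows W s s') (h' : Grows W s' s'') :
    Grows W s s'' where
  sampled := h'.sampled.trans h.sampled
  input v hv := h'.input v (h.input v hv)
  initSet := h.initSet.trans h'.initSet
  convergeSet := h.convergeSet.trans h'.convergeSet
  convergeSent hs := h'.convergeSent (h.convergeSent hs)
  initFull hs := by
    obtain ⟨h1, h2⟩ := h.initFull hs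
    obtain ⟨h3, h4⟩ := h'.initFull (by rw [h1, hs])
    exact ⟨h3.trans h1, h4.trans h2⟩
  convergeFull hs := by
    obtain ⟨h1, h2⟩ := h.convergeFull hs
    obtain ⟨h3, h4⟩ := h'.convergeFull (by rw [h1, hs])
    exact ⟨h3.trans h1, h4.trans h2⟩
  qcValue v hv := h'.qcValue v (h.qcValue v hv)
  binaryCalled hs := h'.binaryCalled (h.binaryCalled hs)

theorem Grows.initDone {S : Type} {s s' : State n V S} (h : Grows W s s') (hs : InitDone W s) :
    InitDone W s' := by
  obtain ⟨v, hv⟩ := Option.isSome_iff_exists.1 hs.1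
  exact ⟨by rw [h.input v hv]; rfl, by rw [(h.initFull hs.2).1, hs.2]⟩

/-! ### The instructions, field by field -/

/-- The condition under which `sendConverge` sends a message. -/
def SendsConverge {S : Type} (W : ℕ) (s : State n V S) : Prop :=
  s.sampled .converge = true ∧ s.convergeSent = false ∧ InitDone W s

open Classical in
/-- The content of the `CONVERGE` message of a process. -/
noncomputable def convergeBody {S : Type} (s : State n V S) : Option (QC n V) :=
  s.input.bind fun v => if s.initValues = {v} then some ⟨v, s.initSet⟩ else none

open Classical in
theorem sendConverge_eq (i : Fin n) (s : State n V BBA.State) :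
    sendConverge BBA W i s =
      if SendsConverge W s then
        ({ s with convergeSent := true }, broadcast (.converge i (convergeBody s)))
      else (s, []) := by
  unfold sendConverge SendsConverge InitDone convergeBody
  cases h : s.input with
  | none => simp
  | some v => by_cases h2 : s.initValues = {v} <;> simp [h2]

/-- The condition under which `callBinary` calls the binary protocol. -/
def CallsBinary {S : Type} (W : ℕ) (s : State n V S) : Prop :=
  s.input.isSome = true ∧ s.binaryCalled = false ∧ s.convergeSet.card = W

/-- The input for the binary protocol. -/
def alert {S : Type} (B : ℕ) (s : State n V S) : Bool := decide (s.count < B + 1)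

/-- The message of the multivalued algorithm that carries a message of the binary protocol. -/
def wrap (V : Type) {M : Type} (q : Fin n × M) : Fin n × Msg n V M := (q.1, .binary q.2)

open Classical in
theorem callBinary_eq (i : Fin n) (coin : BBA.Coin) (s : State n V BBA.State) :
    callBinary BBA W B i coin s =
      if CallsBinary W s then
        ({ s with
            binaryCalled := true
            binary := (BBA.start i s.binary (alert B s) coin).1
            binaryDecision := BBA.decision (BBA.start i s.binary (alert B s) coin).1 },
          (BBA.start i s.binary (alert B s) coin).2.map (wrap V))
      else (s, []) := by
  unfold callBinary CallsBinary alert wrap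
  congr

/-- The state of a process that has just proposed `v`, and the `INIT` messages that it sends. -/
def propose (i : Fin n) (s : State n V BBA.State) (v : V) : Result V BBA :=
  if s.sampled .init = true then
    ({ s with input := some v, initSent := true }, broadcast (.init i v))
  else ({ s with input := some v }, [])

theorem onStart_eq (i : Fin n) (s : State n V BBA.State) (v : V) (coin : BBA.Coin) :
    onStart BBA W B i s v coin =
      ((callBinary BBA W B i coin (sendConverge BBA W i (propose i s v).1).1).1,
        (propose i s v).2 ++ (sendConverge BBA W i (propose i s v).1).2 ++
          (callBinary BBA W B i coin (sendConverge BBA W i (propose i s v).1).1).2) := rfl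

theorem grows_sendConverge (i : Fin n) (s : State n V BBA.State) :
    Grows W s (sendConverge BBA W i s).1 := by
  classical
  rw [sendConverge_eq]
  split_ifs
  · constructor <;> simp
  · exact .refl _

theorem grows_callBinary (i : Fin n) (coin : BBA.Coin) (s : State n V BBA.State) :
    Grows W s (callBinary BBA W B i coin s).1 := by
  classical
  rw [callBinary_eq]
  split_ifs
  · constructor <;> simp
  · exact .refl _

theorem grows_propose (i : Fin n) (s : State n V BBA.State) (hs : s.input = none) (v : V) :
    Grows W s (propose i s v).1 := by
  unfold propose
  split_ifs <;> constructor <;> simp [hs]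

theorem grows_recordInit (s : State n V BBA.State) (j : Fin n) (v : V) :
    Grows W s (recordInit BBA W s j v) := by
  unfold recordInit
  split_ifs with h
  · constructor <;> simp [h.ne, Finset.subset_insert]
  · exact .refl _

theorem grows_recordConverge (s : State n V BBA.State) (j : Fin n) (body : Option (QC n V)) :
    Grows W s (recordConverge BBA W s j body) := by
  unfold recordConverge
  by_cases h : j ∉ s.convergeSet ∧ s.convergeSet.card < W
  · rw [if_pos h]
    constructor <;> simp +contextual [h.2.ne, Finset.subset_insert]
  · rw [if_neg h]
    constructor <;> simp +contextual

theorem grows_onStart (i : Fin n) (s : State n V BBA.State) (hs : s.input = none) (v : V)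
    (coin : BBA.Coin) : Grows W s (onStart BBA W B i s v coin).1 := by
  rw [onStart_eq]
  exact (grows_propose i s hs v).trans ((grows_sendConverge _ _).trans (grows_callBinary _ _ _))

theorem grows_onReceive (i : Fin n) (s : State n V BBA.State) (src : Fin n)
    (m : Msg n V BBA.Msg) (coin : BBA.Coin) :
    Grows W s (onReceive BBA W B i s src m coin).1 := by
  unfold onReceive
  cases m with
  | init j v =>
    dsimp only
    split_ifs
    · exact (grows_recordInit _ _ _).trans (grows_sendConverge _ _)
    · exact .refl _
  | converge j body =>
    dsimp only
    split_ifs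
    · exact (grows_recordConverge _ _ _).trans (grows_callBinary _ _ _)
    · exact .refl _
  | binary m => constructor <;> simp

/-! ### The local invariants -/

/-- `LocalInv`, except that the `CONVERGE` message has possibly still to be sent and the binary
protocol has possibly still to be called. -/
structure LocalPre (BBA : Protocol n Bool Bool) (W : ℕ) (s : State n V BBA.State) : Prop where
  initSent : s.initSent = true ↔ s.sampled .init = true ∧ s.input.isSome = true
  convergeSent : s.convergeSent = true → s.sampled .converge = true ∧ InitDone W s
  binaryCalled : s.binaryCalled = true → s.input.isSome = true ∧ s.convergeSet.card = W
  initSet_le : s.initSet.card ≤ W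
  convergeSet_le : s.convergeSet.card ≤ W
  called_of_decision : s.binaryDecision.isSome = true → s.binaryCalled = true
  decision_of_called : s.binaryCalled = true → (BBA.decision s.binary).isSome = true →
    s.binaryDecision.isSome = true
  initValues : s.initSet.Nonempty → s.initValues.Nonempty

theorem LocalInv.pre {s : State n V BBA.State} (h : LocalInv BBA W s) : LocalPre BBA W s :=
  ⟨h.1, h.2.1, h.3.1, h.4, h.5, h.6, h.7, h.8⟩

theorem LocalPre.sendConverge {s : State n V BBA.State} (h : LocalPre BBA W s) (i : Fin n) :
    LocalPre BBA W (sendConverge BBA W i s).1 ∧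
      ((sendConverge BBA W i s).1.convergeSent = true ↔
        (sendConverge BBA W i s).1.sampled .converge = true ∧
          InitDone W (sendConverge BBA W i s).1) := by
  classical
  rw [sendConverge_eq]
  split_ifs with hc
  · obtain ⟨h1, h2, h3⟩ := hc
    exact ⟨⟨h.1, fun _ => ⟨h1, h3⟩, h.3, h.4, h.5, h.6, h.7, h.8⟩, by
      simp only [true_iff]; exact ⟨h1, h3⟩⟩
  · refine ⟨h, h.2, fun h' => ?_⟩
    by_contra h''
    exact hc ⟨h'.1, by simpa using h'', h'.2⟩

theorem LocalPre.callBinary {s : State n V BBA.State} (h : LocalPre BBA W s)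
    (hs : s.convergeSent = true ↔ s.sampled .converge = true ∧ InitDone W s)
    (i : Fin n) (coin : BBA.Coin) : LocalInv BBA W (callBinary BBA W B i coin s).1 := by
  classical
  rw [callBinary_eq]
  split_ifs with hc
  · obtain ⟨h1, h2, h3⟩ := hc
    exact ⟨h.1, hs, by simp [h1, h3], h.4, h.5, by simp, by simp, h.8⟩
  · refine ⟨h.1, hs, ⟨h.3, fun h' => ?_⟩, h.4, h.5, h.6, h.7, h.8⟩
    by_contra h''
    exact hc ⟨h'.1, by simpa using h'', h'.2⟩

theorem LocalInv.onStart {s : State n V BBA.State} (h : LocalInv BBA W s) (hs : s.input = none)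
    (i : Fin n) (v : V) (coin : BBA.Coin) : LocalInv BBA W (onStart BBA W B i s v coin).1 := by
  have hpre : LocalPre BBA W (propose i s v).1 := by
    have h1 := h.initSent
    have h2 := h.convergeSent
    have h3 := h.binaryCalled
    simp only [hs, InitDone] at h1 h2 h3
    simp at h1 h2 h3
    have h7 := h.called_of_decision
    rw [h3] at h7
    unfold propose
    split_ifs with hi
    · exact ⟨by simp [hi], by simp [h2], by simp [h3], h.4, h.5, h.6, h.7, h.8⟩
    · exact ⟨by simp [hi, h1], by simp [h2], by simp [h3], h.4, h.5, h.6, h.7, h.8⟩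
  rw [onStart_eq]
  obtain ⟨a, b⟩ := hpre.sendConverge i
  exact a.callBinary b i coin

theorem LocalInv.onReceive {s : State n V BBA.State} (h : LocalInv BBA W s)
    (i : Fin n) (src : Fin n) (m : Msg n V BBA.Msg) (coin : BBA.Coin) :
    LocalInv BBA W (onReceive BBA W B i s src m coin).1 := by
  classical
  unfold MultivaluedBA.onReceive
  cases m with
  | init j v =>
    dsimp only
    split_ifs
    · have hpre : LocalPre BBA W (recordInit BBA W s j v) := by
        unfold recordInit
        split_ifs with hc
        · have h2 : s.convergeSent = false := by
            by_contra h'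
            exact hc.ne (h.convergeSent.1 (by simpa using h')).2.2
          refine ⟨h.1, by simp [h2], h.3.1, ?_, h.5, h.6, h.7, by simp⟩
          exact (Finset.card_insert_le _ _).trans hc
        · exact h.pre
      have hcall : (sendConverge BBA W i (recordInit BBA W s j v)).1.binaryCalled = s.binaryCalled ∧
          (sendConverge BBA W i (recordInit BBA W s j v)).1.input = s.input ∧
          (sendConverge BBA W i (recordInit BBA W s j v)).1.convergeSet = s.convergeSet := by
        rw [sendConverge_eq]
        unfold recordInit
        split_ifs <;> simp
      obtain ⟨a, b⟩ := hpre.sendConverge i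
      exact ⟨a.1, b, by rw [hcall.1, hcall.2.1, hcall.2.2]; exact h.3, a.4, a.5, a.6, a.7, a.8⟩
    · exact h
  | converge j body =>
    dsimp only
    split_ifs
    · have hpre : LocalPre BBA W (recordConverge BBA W s j body) ∧
          ((recordConverge BBA W s j body).convergeSent = true ↔
            (recordConverge BBA W s j body).sampled .converge = true ∧
              InitDone W (recordConverge BBA W s j body)) := by
        unfold recordConverge
        by_cases hc : j ∉ s.convergeSet ∧ s.convergeSet.card < W
        · rw [if_pos hc]
          have h2 : s.binaryCalled = false := by
            by_contra h'
            exact hc.2.ne (h.binaryCalled.1 (by simpa using h')).2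
          refine ⟨⟨h.1, h.2.1, by simp [h2], h.4, ?_, h.6, h.7, h.8⟩, h.2⟩
          exact (Finset.card_insert_le _ _).trans hc.2
        · rw [if_neg hc]
          exact ⟨⟨h.1, h.2.1, h.3.1, h.4, h.5, h.6, h.7, h.8⟩, h.2⟩
      exact hpre.1.callBinary hpre.2 i coin
    · exact h
  | binary m =>
    refine ⟨h.1, h.2, h.3, h.4, h.5, ?_, ?_, h.8⟩
    · dsimp only
      split_ifs with hc
      · simp [hc]
      · exact h.6
    · dsimp only
      intro h1 h2
      rw [if_pos h1]
      cases s.binaryDecision <;> simp [h2]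

end Local

/-! ### The fields changed by an instruction -/

section Fields

variable {n : ℕ} {V : Type} {BBA : Protocol n Bool Bool} {W B : ℕ}

theorem sendConverge_fst (i : Fin n) (s : State n V BBA.State) :
    ∃ x, (sendConverge BBA W i s).1 = { s with convergeSent := x } := by
  classical
  rw [sendConverge_eq]
  split_ifs
  · exact ⟨true, rfl⟩
  · exact ⟨_, rfl⟩

theorem callBinary_fst (i : Fin n) (coin : BBA.Coin) (s : State n V BBA.State) :
    ∃ a b x, (callBinary BBA W B i coin s).1 =
      { s with binaryCalled := a, binaryDecision := b, binary := x } := by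
  classical
  rw [callBinary_eq]
  split_ifs
  · exact ⟨_, _, _, rfl⟩
  · exact ⟨_, _, _, rfl⟩

theorem onStart_fst (i : Fin n) (s : State n V BBA.State) (v : V) (coin : BBA.Coin) :
    ∃ y x a b z, (onStart BBA W B i s v coin).1 =
      { s with
        input := some v, initSent := y, convergeSent := x
        binaryCalled := a, binaryDecision := b, binary := z } := by
  rw [onStart_eq]
  obtain ⟨a, b, z, h⟩ :=
    callBinary_fst (W := W) (B := B) i coin (sendConverge BBA W i (propose i s v).1).1
  obtain ⟨x, h'⟩ := sendConverge_fst (W := W) i (propose i s v).1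
  rw [h, h']
  unfold propose
  split_ifs
  · exact ⟨_, _, _, _, _, rfl⟩
  · exact ⟨_, _, _, _, _, rfl⟩

theorem onReceive_init_fst (i : Fin n) (s : State n V BBA.State) (j : Fin n) (v : V)
    (coin : BBA.Coin) : ∃ x, (onReceive BBA W B i s j (.init j v) coin).1 =
      { recordInit BBA W s j v with convergeSent := x } := by
  obtain ⟨x, h⟩ := sendConverge_fst (W := W) i (recordInit BBA W s j v)
  refine ⟨x, ?_⟩
  simpa [onReceive] using h

theorem onReceive_converge_fst (i : Fin n) (s : State n V BBA.State) (j : Fin n)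
    (body : Option (QC n V)) (hb : ValidBody W body) (coin : BBA.Coin) :
    ∃ a b z, (onReceive BBA W B i s j (.converge j body) coin).1 =
      { recordConverge BBA W s j body with
        binaryCalled := a, binaryDecision := b, binary := z } := by
  obtain ⟨a, b, z, h⟩ := callBinary_fst (W := W) (B := B) i coin (recordConverge BBA W s j body)
  refine ⟨a, b, z, ?_⟩
  simpa [onReceive, hb] using h

/-- Messages signed by another process than their sender, and invalid certificates, are ignored. -/
theorem onReceive_ignored (i : Fin n) (s : State n V BBA.State) (src : Fin n)
    (coin : BBA.Coin) :
    (∀ j v, j ≠ src → onReceive BBA W B i s src (.init j v) coin = (s, [])) ∧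
    (∀ j body, ¬ (j = src ∧ ValidBody W body) →
      onReceive BBA W B i s src (.converge j body) coin = (s, [])) := by
  constructor
  · intro j v h
    simp [onReceive, h]
  · intro j body h
    simp only [onReceive, if_neg h]

theorem input_onReceive (i : Fin n) (s : State n V BBA.State) (src : Fin n)
    (m : Msg n V BBA.Msg) (coin : BBA.Coin) :
    (onReceive BBA W B i s src m coin).1.input = s.input := by
  cases m with
  | init j v =>
    by_cases hj : j = src
    · subst hj
      obtain ⟨x, hx⟩ := onReceive_init_fst (W := W) (B := B) i s j v coin
      rw [hx]
      unfold recordInit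
      split_ifs <;> rfl
    · rw [(onReceive_ignored i s src coin).1 j v hj]
  | converge j body =>
    by_cases hj : j = src ∧ ValidBody W body
    · obtain ⟨rfl, hb⟩ := hj
      obtain ⟨a, b, z, hx⟩ := onReceive_converge_fst (B := B) i s j body hb coin
      rw [hx]
      unfold recordConverge
      by_cases h : j ∉ s.convergeSet ∧ s.convergeSet.card < W
      · rw [if_pos h]
      · rw [if_neg h]
    · rw [(onReceive_ignored i s src coin).2 j body hj]
  | binary m => rfl

/-! ### The messages sent in a step -/

/-- What a local step with result `r` of process `i` in the state `s` sends. -/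
structure StepOut (i : Fin n) (s : State n V BBA.State) (r : Result V BBA) : Prop where
  out : ∀ q ∈ r.2, (∃ v, q.2 = .init i v ∧ r.1.input = some v ∧ r.1.sampled .init = true) ∨
    (q.2 = .converge i (convergeBody r.1) ∧ r.1.convergeSent = true ∧
      ∀ k, (k, Msg.converge i (convergeBody r.1)) ∈ r.2) ∨ ∃ m, q.2 = .binary m
  initOut : ∀ v, r.1.input = some v → r.1.sampled .init = true →
    s.input = some v ∨ ∀ k, (k, Msg.init i v) ∈ r.2
  convergeOut : r.1.convergeSent = true →
    s.convergeSent = true ∨ ∀ k, (k, Msg.converge i (convergeBody r.1)) ∈ r.2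

theorem mem_broadcast {M : Type} {m : M} {q : Fin n × M} : q ∈ broadcast m ↔ q.2 = m := by
  unfold broadcast
  simp only [List.mem_map, List.mem_finRange, true_and]
  constructor
  · rintro ⟨k, rfl⟩; rfl
  · rintro rfl; exact ⟨q.1, rfl⟩

theorem StepOut.nil (i : Fin n) (s s' : State n V BBA.State) (h1 : s'.input = s.input)
    (h2 : s'.convergeSent = s.convergeSent) : StepOut i s (s', []) :=
  ⟨by simp, fun v h _ => .inl (h1 ▸ h), fun h => .inl (h2 ▸ h)⟩

theorem stepOut_sendConverge (i : Fin n) (s : State n V BBA.State) :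
    StepOut i s (sendConverge BBA W i s) := by
  classical
  rw [sendConverge_eq]
  split_ifs with hc
  · refine ⟨?_, ?_, ?_⟩
    · intro q hq
      rw [mem_broadcast] at hq
      exact .inr (.inl ⟨hq, rfl, fun k => mem_broadcast.2 rfl⟩)
    · intro v hv _
      exact .inl hv
    · intro _
      exact .inr fun k => mem_broadcast.2 rfl
  · exact .nil i s s rfl rfl

theorem StepOut.append_binary {i : Fin n} {s : State n V BBA.State} {r : Result V BBA}
    (h : StepOut i s r) {r' : Result V BBA} (hr : ∃ a b z, r'.1 =
      { r.1 with binaryCalled := a, binaryDecision := b, binary := z })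
    (hb : ∀ q ∈ r'.2, ∃ m, q.2 = .binary m) : StepOut i s (r'.1, r.2 ++ r'.2) := by
  obtain ⟨a, b, z, hr⟩ := hr
  rw [hr]
  refine ⟨?_, ?_, ?_⟩
  · intro q hq
    rcases List.mem_append.1 hq with hq | hq
    · rcases h.out q hq with h' | h' | h'
      · exact .inl h'
      · exact .inr (.inl ⟨h'.1, h'.2.1, fun k => List.mem_append_left _ (h'.2.2 k)⟩)
      · exact .inr (.inr h')
    · exact .inr (.inr (hb q hq))
  · intro v hv hs
    exact (h.initOut v hv hs).imp_right fun h' k => List.mem_append_left _ (h' k)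
  · intro hs
    exact (h.convergeOut hs).imp_right fun h' k => List.mem_append_left _ (h' k)

theorem callBinary_snd (i : Fin n) (coin : BBA.Coin) (s : State n V BBA.State) :
    ∀ q ∈ (callBinary BBA W B i coin s).2, ∃ m, q.2 = .binary m := by
  classical
  rw [callBinary_eq]
  split_ifs
  · intro q hq
    obtain ⟨x, _, rfl⟩ := List.mem_map.1 hq
    exact ⟨_, rfl⟩
  · simp

theorem stepOut_onStart (i : Fin n) (s : State n V BBA.State) (v : V)
    (coin : BBA.Coin) : StepOut i s (onStart BBA W B i s v coin) := by
  rw [onStart_eq]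
  refine StepOut.append_binary (r := ((sendConverge BBA W i (propose i s v).1).1,
    (propose i s v).2 ++ (sendConverge BBA W i (propose i s v).1).2)) ?_ (callBinary_fst _ _ _)
    (callBinary_snd _ _ _)
  have h := stepOut_sendConverge (W := W) i (propose i s v).1
  obtain ⟨x, hx⟩ := sendConverge_fst (W := W) i (propose i s v).1
  have hp : (propose i s v).1.input = some v ∧ (propose i s v).1.convergeSent = s.convergeSent ∧
      (propose i s v).1.sampled = s.sampled ∧
      (propose i s v).2 = if s.sampled .init = true then broadcast (.init i v) else [] := by
    unfold propose
    split_ifs <;> simp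
  obtain ⟨p1, p2, p3, p4⟩ := hp
  refine ⟨?_, ?_, ?_⟩
  · intro q hq
    rcases List.mem_append.1 hq with hq | hq
    · rw [p4] at hq
      split_ifs at hq with hi
      · rw [mem_broadcast] at hq
        refine .inl ⟨v, hq, ?_, ?_⟩
        · rw [hx]; exact p1
        · rw [hx]; simpa [p3] using hi
      · simp at hq
    · rcases h.out q hq with h' | h' | h'
      · exact .inl h'
      · exact .inr (.inl ⟨h'.1, h'.2.1, fun k => List.mem_append_right _ (h'.2.2 k)⟩)
      · exact .inr (.inr h')
  · intro w hw hs
    refine .inr fun k => List.mem_append_left _ ?_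
    have hw' : w = v := by
      rw [hx] at hw
      simpa [p1] using hw.symm
    have hs' : s.sampled .init = true := by
      rw [hx] at hs
      simpa [p3] using hs
    rw [p4, if_pos hs', mem_broadcast, hw']
  · intro hs
    rw [← p2]
    exact (h.convergeOut hs).imp_right fun h' k => List.mem_append_right _ (h' k)

theorem stepOut_onReceive (i : Fin n) (s : State n V BBA.State) (src : Fin n)
    (m : Msg n V BBA.Msg) (coin : BBA.Coin) : StepOut i s (onReceive BBA W B i s src m coin) := by
  cases m with
  | init j v =>
    by_cases hj : j = src
    · have h := stepOut_sendConverge (W := W) i (recordInit BBA W s j v)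
      have h1 : (recordInit BBA W s j v).input = s.input ∧
          (recordInit BBA W s j v).convergeSent = s.convergeSent := by
        unfold recordInit
        split_ifs <;> simp
      have h2 : onReceive BBA W B i s src (.init j v) coin =
        sendConverge BBA W i (recordInit BBA W s j v) := by simp [onReceive, hj]
      rw [h2]
      exact ⟨h.out, h1.1 ▸ h.initOut, h1.2 ▸ h.convergeOut⟩
    · rw [(onReceive_ignored i s src coin).1 j v hj]
      exact .nil i s s rfl rfl
  | converge j body =>
    by_cases hj : j = src ∧ ValidBody W body
    · have h2 : onReceive BBA W B i s src (.converge j body) coin =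
        callBinary BBA W B i coin (recordConverge BBA W s j body) := by
        simp only [onReceive, if_pos hj]
      rw [h2]
      have h1 : (recordConverge BBA W s j body).input = s.input ∧
          (recordConverge BBA W s j body).convergeSent = s.convergeSent := by
        unfold recordConverge
        by_cases hc : j ∉ s.convergeSet ∧ s.convergeSet.card < W
        · rw [if_pos hc]; exact ⟨rfl, rfl⟩
        · rw [if_neg hc]; exact ⟨rfl, rfl⟩
      exact StepOut.append_binary (r := (recordConverge BBA W s j body, []))
        (.nil i s _ h1.1 h1.2) (callBinary_fst i coin _) (callBinary_snd i coin _)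
    · rw [(onReceive_ignored i s src coin).2 j body hj]
      exact .nil i s s rfl rfl
  | binary m =>
    have h := StepOut.append_binary (r := (s, [])) (r' := onReceive BBA W B i s src (.binary m) coin)
      (.nil i s s rfl rfl) ⟨_, _, _, rfl⟩ (by
        intro q hq
        obtain ⟨x, _, rfl⟩ := List.mem_map.1 hq
        exact ⟨_, rfl⟩)
    exact h

end Fields

section Global

variable {n : ℕ} {d : ℝ} {V : Type} {BBA : Protocol n Bool Bool}

/-- The memory of process `i`. -/
def mem (c : (multivaluedBA d V BBA).Config) (i : Fin n) : State n V BBA.State := c.loc i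

/-- A packet of the multivalued algorithm. -/
def packet (d : ℝ) {V : Type} {BBA : Protocol n Bool Bool} (i k : Fin n) (m : Msg n V BBA.Msg) :
    (multivaluedBA d V BBA).Packet := ⟨i, k, m⟩

/-- The content of a packet. -/
def content (p : (multivaluedBA d V BBA).Packet) : Msg n V BBA.Msg := p.msg

/-- The packets sent in a local step of process `i`. -/
def packets (d : ℝ) {V : Type} {BBA : Protocol n Bool Bool} (i : Fin n)
    (l : List (Fin n × Msg n V BBA.Msg)) : List (multivaluedBA d V BBA).Packet :=
  l.map fun q => packet d i q.1 q.2

theorem mem_packets {i : Fin n} {l : List (Fin n × Msg n V BBA.Msg)}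
    {p : (multivaluedBA d V BBA).Packet} :
    p ∈ packets d i l ↔ p.src = i ∧ (p.dst, content p) ∈ l := by
  unfold packets
  simp only [List.mem_map]
  constructor
  · rintro ⟨q, hq, rfl⟩
    exact ⟨rfl, hq⟩
  · rintro ⟨h1, h2⟩
    exact ⟨_, h2, by subst h1; rfl⟩

/-- `c'` is obtained from `c` by a local step of process `i` with the result `r`, up to the
proposals and the record of delivered messages. -/
structure LocalStep (c c' : (multivaluedBA d V BBA).Config) (i : Fin n) (r : Result V BBA) :
    Prop where
  notMem : i ∉ c.corrupted
  self : mem c' i = r.1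
  other : ∀ j, j ≠ i → mem c' j = mem c j
  log : c'.log = c.log ++ packets d i r.2
  corrupted : c'.corrupted = c.corrupted

variable (f : ℕ) (c : (multivaluedBA d V BBA).Config) (coin : BBA.Coin)

theorem step_start_pos {i : Fin n} (v : V) (h : i ∉ c.corrupted ∧ c.proposal i = none) :
    LocalStep c ((multivaluedBA d V BBA).step f c coin (.start i v)) i
        (onStart BBA (quorum d n) (byzBound d n) i (mem c i) v coin) ∧
      ((multivaluedBA d V BBA).step f c coin (.start i v)).proposal =
        Function.update c.proposal i (some v) ∧
      ((multivaluedBA d V BBA).step f c coin (.start i v)).delivered = c.delivered := by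
  classical
  simp only [Protocol.step]
  rw [if_pos h]
  exact ⟨⟨h.1, Function.update_self .., fun j hj => Function.update_of_ne hj .., rfl, rfl⟩, rfl, rfl⟩

theorem step_start_neg {i : Fin n} (v : V) (h : ¬ (i ∉ c.corrupted ∧ c.proposal i = none)) :
    (multivaluedBA d V BBA).step f c coin (.start i v) = c := by
  classical
  simp only [Protocol.step]
  rw [if_neg h]

theorem step_deliver_pos {k : ℕ} {p : (multivaluedBA d V BBA).Packet} (hk : c.log[k]? = some p)
    (h : k ∉ c.delivered ∧ p.dst ∉ c.corrupted) :
    LocalStep c ((multivaluedBA d V BBA).step f c coin (.deliver k)) p.dst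
        (onReceive BBA (quorum d n) (byzBound d n) p.dst (mem c p.dst) p.src (content p) coin) ∧
      ((multivaluedBA d V BBA).step f c coin (.deliver k)).proposal = c.proposal ∧
      ((multivaluedBA d V BBA).step f c coin (.deliver k)).delivered = insert k c.delivered := by
  classical
  simp only [Protocol.step, hk]
  rw [if_pos h]
  exact ⟨⟨h.2, Function.update_self .., fun j hj => Function.update_of_ne hj .., rfl, rfl⟩, rfl, rfl⟩

theorem step_deliver_neg {k : ℕ}
    (h : ∀ p, c.log[k]? = some p → ¬ (k ∉ c.delivered ∧ p.dst ∉ c.corrupted)) :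
    (multivaluedBA d V BBA).step f c coin (.deliver k) = c := by
  classical
  simp only [Protocol.step]
  cases hk : c.log[k]? with
  | none => rfl
  | some p =>
    dsimp only
    rw [if_neg (h p hk)]

theorem step_inject_pos {src dst : Fin n} {m : Msg n V BBA.Msg}
    (h : src ∈ c.corrupted ∧ dst ∉ c.corrupted ∧ (multivaluedBA d V BBA).Feasible c m) :
    LocalStep c ((multivaluedBA d V BBA).step f c coin (.inject src dst m)) dst
        (onReceive BBA (quorum d n) (byzBound d n) dst (mem c dst) src m coin) ∧
      ((multivaluedBA d V BBA).step f c coin (.inject src dst m)).proposal = c.proposal ∧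
      ((multivaluedBA d V BBA).step f c coin (.inject src dst m)).delivered = c.delivered := by
  classical
  simp only [Protocol.step]
  rw [if_pos h]
  exact ⟨⟨h.2.1, Function.update_self .., fun j hj => Function.update_of_ne hj .., rfl, rfl⟩, rfl,
    rfl⟩

theorem step_inject_neg {src dst : Fin n} {m : Msg n V BBA.Msg}
    (h : ¬ (src ∈ c.corrupted ∧ dst ∉ c.corrupted ∧ (multivaluedBA d V BBA).Feasible c m)) :
    (multivaluedBA d V BBA).step f c coin (.inject src dst m) = c := by
  classical
  simp only [Protocol.step]
  rw [if_neg h]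

/-- The possible effects of a step. -/
theorem step_cases (a : (multivaluedBA d V BBA).Action) (c' : (multivaluedBA d V BBA).Config)
    (hc' : (multivaluedBA d V BBA).step f c coin a = c') :
    c' = c ∨
    (∃ i, a = .corrupt i ∧ c.corrupted.card < f ∧
      c' = { c with corrupted := insert i c.corrupted }) ∨
    (∃ i v, a = .start i v ∧ c.proposal i = none ∧
      LocalStep c c' i (onStart BBA (quorum d n) (byzBound d n) i (mem c i) v coin) ∧
      c'.proposal = Function.update c.proposal i (some v) ∧ c'.delivered = c.delivered) ∨
    (∃ k p, a = .deliver k ∧ c.log[k]? = some p ∧ k ∉ c.delivered ∧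
      LocalStep c c' p.dst
        (onReceive BBA (quorum d n) (byzBound d n) p.dst (mem c p.dst) p.src (content p) coin) ∧
      c'.proposal = c.proposal ∧ c'.delivered = insert k c.delivered) ∨
    (∃ src dst m, a = .inject src dst m ∧ src ∈ c.corrupted ∧
      (multivaluedBA d V BBA).Feasible c m ∧
      LocalStep c c' dst
        (onReceive BBA (quorum d n) (byzBound d n) dst (mem c dst) src m coin) ∧
      c'.proposal = c.proposal ∧ c'.delivered = c.delivered) := by
  classical
  subst hc'
  cases a with
  | start i v =>
    by_cases h : i ∉ c.corrupted ∧ c.proposal i = none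
    · exact .inr (.inr (.inl ⟨i, v, rfl, h.2, step_start_pos f c coin v h⟩))
    · exact .inl (step_start_neg f c coin v h)
  | deliver k =>
    by_cases h : ∃ p, c.log[k]? = some p ∧ k ∉ c.delivered ∧ p.dst ∉ c.corrupted
    · obtain ⟨p, hk, h⟩ := h
      exact .inr (.inr (.inr (.inl ⟨k, p, rfl, hk, h.1, step_deliver_pos f c coin hk h⟩)))
    · exact .inl (step_deliver_neg f c coin fun p hk hp => h ⟨p, hk, hp⟩)
  | corrupt i =>
    simp only [Protocol.step]
    split_ifs with h
    · exact .inr (.inl ⟨i, rfl, h, rfl⟩)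
    · exact .inl rfl
  | inject src dst m =>
    by_cases h : src ∈ c.corrupted ∧ dst ∉ c.corrupted ∧ (multivaluedBA d V BBA).Feasible c m
    · exact .inr (.inr (.inr (.inr ⟨src, dst, m, rfl, h.1, h.2.2, step_inject_pos f c coin h⟩)))
    · exact .inl (step_inject_neg f c coin h)
  | idle => exact .inl rfl

end Global

/-! ### The evidence behind signatures -/

section Global

variable {n : ℕ} {d : ℝ} {V : Type} {BBA : Protocol n Bool Bool}

/-- The system evolves: every memory grows, corrupted memories are frozen, and nothing that has been
sent, delivered or proposed is forgotten. -/
structure Evolves (c c' : (multivaluedBA d V BBA).Config) : Prop where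
  mem : ∀ i, Grows (quorum d n) (mem c i) (mem c' i)
  corrupted : c.corrupted ⊆ c'.corrupted
  frozen : ∀ i ∈ c.corrupted, MultivaluedBA.mem c' i = MultivaluedBA.mem c i
  log : c.log <+: c'.log
  delivered : c.delivered ⊆ c'.delivered
  proposal : ∀ i v, c.proposal i = some v → c'.proposal i = some v

theorem Evolves.refl (c : (multivaluedBA d V BBA).Config) : Evolves c c :=
  ⟨fun _ => .refl _, subset_rfl, fun _ _ => rfl, List.prefix_rfl, subset_rfl, fun _ _ h => h⟩

theorem Evolves.trans {c c' c'' : (multivaluedBA d V BBA).Config} (h : Evolves c c')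
    (h' : Evolves c' c'') : Evolves c c'' where
  mem i := (h.mem i).trans (h'.mem i)
  corrupted := h.corrupted.trans h'.corrupted
  frozen i hi := (h'.frozen i (h.corrupted hi)).trans (h.frozen i hi)
  log := h.log.trans h'.log
  delivered := h.delivered.trans h'.delivered
  proposal i v hv := h'.proposal i v (h.proposal i v hv)

/-- Evidence that process `j` may have signed `⟨INIT, v⟩`: it is sampled, and it has either proposed
`v` or been corrupted before it could propose. -/
def InitCert (c : (multivaluedBA d V BBA).Config) (j : Fin n) (v : V) : Prop :=
  (mem c j).sampled .init = true ∧
    ((mem c j).input = some v ∨ j ∈ c.corrupted ∧ (mem c j).input = none)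

/-- Evidence that process `j` may have signed a `CONVERGE` message with the given body: it is
sampled, and it has either sent it to everybody, or been corrupted before it could send any. -/
def ConvergeCert (c : (multivaluedBA d V BBA).Config) (j : Fin n) (body : Option (QC n V)) : Prop :=
  (mem c j).sampled .converge = true ∧
    ((InitDone (quorum d n) (mem c j) ∧ (∀ k, packet d j k (.converge j body) ∈ c.log) ∧
        (body = none → ∀ v, (mem c j).input = some v → (mem c j).initValues ≠ {v})) ∨
      j ∈ c.corrupted ∧ ¬ InitDone (quorum d n) (mem c j))

/-- Evidence for a token. -/
def TokenCert (c : (multivaluedBA d V BBA).Config) : Token n V BBA.Token → Prop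
  | .init j v => InitCert c j v
  | .converge j body => ConvergeCert c j body
  | .binary _ => True

/-- The effect that the delivery of a packet has had on the memory of its recipient. -/
def Processed {S : Type} (W : ℕ) (s : State n V S) (src : Fin n) {M : Type} : Msg n V M → Prop
  | .init j _ => j = src → j ∈ s.initSet ∨ s.initSet.card = W
  | .converge j body => j = src → ValidBody W body →
      (j ∈ s.convergeSet ∨ s.convergeSet.card = W) ∧ (body.isSome = true → s.qcValue.isSome = true)
  | .binary _ => True

theorem InitCert.mono {c c' : (multivaluedBA d V BBA).Config} (h : Evolves c c') {j : Fin n} {v : V}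
    (hc : InitCert c j v) : InitCert c' j v := by
  obtain ⟨h1, h2⟩ := hc
  refine ⟨by rw [(h.mem j).sampled, h1], ?_⟩
  rcases h2 with h2 | ⟨h2, h3⟩
  · exact .inl ((h.mem j).input v h2)
  · exact .inr ⟨h.corrupted h2, by rw [h.frozen j h2, h3]⟩

theorem ConvergeCert.mono {c c' : (multivaluedBA d V BBA).Config} (h : Evolves c c') {j : Fin n}
    {body : Option (QC n V)} (hc : ConvergeCert c j body) : ConvergeCert c' j body := by
  obtain ⟨h1, h2⟩ := hc
  refine ⟨by rw [(h.mem j).sampled, h1], ?_⟩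
  rcases h2 with ⟨h2, h3, h4⟩ | ⟨h2, h3⟩
  · refine .inl ⟨(h.mem j).initDone h2, fun k => h.log.subset (h3 k), fun hb v hv => ?_⟩
    obtain ⟨w, hw⟩ := Option.isSome_iff_exists.1 h2.1
    have := (h.mem j).input w hw
    rw [this] at hv
    cases hv
    rw [((h.mem j).initFull h2.2).2]
    exact h4 hb v hw
  · exact .inr ⟨h.corrupted h2, by rw [h.frozen j h2]; exact h3⟩

theorem TokenCert.mono {c c' : (multivaluedBA d V BBA).Config} (h : Evolves c c')
    {t : Token n V BBA.Token} (hc : TokenCert c t) : TokenCert c' t := by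
  cases t with
  | init j v => exact InitCert.mono h hc
  | converge j v => exact ConvergeCert.mono h hc
  | binary t => trivial

theorem Processed.mono {S : Type} {W : ℕ} {s s' : State n V S} (h : Grows W s s') {src : Fin n}
    {M : Type} {m : Msg n V M} (hp : Processed W s src m) : Processed W s' src m := by
  cases m with
  | init j v =>
    intro hj
    rcases hp hj with h1 | h1
    · exact .inl (h.initSet h1)
    · exact .inr (by rw [(h.initFull h1).1, h1])
  | converge j body =>
    intro hj hb
    obtain ⟨h1, h2⟩ := hp hj hb
    refine ⟨?_, fun h3 => ?_⟩
    · rcases h1 with h1 | h1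
      · exact .inl (h.convergeSet h1)
      · exact .inr (by rw [(h.convergeFull h1).1, h1])
    · obtain ⟨v, hv⟩ := Option.isSome_iff_exists.1 (h2 h3)
      rw [h.qcValue v hv]
      rfl
  | binary m => trivial

/-- The values in the local record of `INIT` messages come with evidence. -/
def InitRecord (c : (multivaluedBA d V BBA).Config) (s : State n V BBA.State) : Prop :=
  (∀ j ∈ s.initSet, ∃ w ∈ s.initValues, InitCert c j w) ∧
    ∀ w ∈ s.initValues, ∃ j ∈ s.initSet, InitCert c j w

/-- The local record of `CONVERGE` messages, of which `count` carry a quorum certificate, comes with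
evidence. -/
def ConvergeRecord (c : (multivaluedBA d V BBA).Config) (s : State n V BBA.State) : Prop :=
  ∃ T ⊆ s.convergeSet, T.card = s.count ∧ (∀ j ∈ T, ∃ qc, ConvergeCert c j (some qc)) ∧
    ∀ j ∈ s.convergeSet, j ∉ T → ConvergeCert c j none

/-- The recorded certified value comes with evidence from a quorum. -/
def QCRecord (c : (multivaluedBA d V BBA).Config) (s : State n V BBA.State) : Prop :=
  ∀ v, s.qcValue = some v → ∃ S : Finset (Fin n), S.card = quorum d n ∧ ∀ j ∈ S, InitCert c j v

theorem InitRecord.mono {c c' : (multivaluedBA d V BBA).Config} (h : Evolves c c')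
    {s : State n V BBA.State} (hs : InitRecord c s) : InitRecord c' s := by
  refine ⟨fun j hj => ?_, fun w hw => ?_⟩
  · obtain ⟨w, hw, hc⟩ := hs.1 j hj
    exact ⟨w, hw, hc.mono h⟩
  · obtain ⟨j, hj, hc⟩ := hs.2 w hw
    exact ⟨j, hj, hc.mono h⟩

theorem ConvergeRecord.mono {c c' : (multivaluedBA d V BBA).Config} (h : Evolves c c')
    {s : State n V BBA.State} (hs : ConvergeRecord c s) : ConvergeRecord c' s := by
  obtain ⟨T, h1, h2, h3, h4⟩ := hs
  refine ⟨T, h1, h2, fun j hj => ?_, fun j hj hT => (h4 j hj hT).mono h⟩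
  obtain ⟨qc, hq⟩ := h3 j hj
  exact ⟨qc, hq.mono h⟩

theorem QCRecord.mono {c c' : (multivaluedBA d V BBA).Config} (h : Evolves c c')
    {s : State n V BBA.State} (hs : QCRecord c s) : QCRecord c' s := by
  intro v hv
  obtain ⟨S, h1, h2⟩ := hs v hv
  exact ⟨S, h1, fun j hj => (h2 j hj).mono h⟩

/-- A message sent by a correct process names its sender and has a valid certificate. -/
def WellFormed (W : ℕ) (src : Fin n) {M : Type} : Msg n V M → Prop
  | .init j _ => j = src
  | .converge j body => j = src ∧ ValidBody W body
  | .binary _ => True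

/-- The invariants of the multivalued algorithm. -/
structure Inv (c : (multivaluedBA d V BBA).Config) : Prop where
  proposal : ∀ i, c.proposal i = (mem c i).input
  localInv : ∀ i, LocalInv BBA (quorum d n) (mem c i)
  cert : ∀ p ∈ c.log, ∀ t ∈ msgTokens BBA.tokens (content p), TokenCert c t
  wellFormed : ∀ p ∈ c.log, WellFormed (quorum d n) p.src (content p)
  initSent : ∀ i v, (mem c i).input = some v → (mem c i).sampled .init = true →
    ∀ k, packet d i k (.init i v) ∈ c.log
  convergeSent : ∀ i, (mem c i).convergeSent = true →
    ∃ body, ∀ k, packet d i k (.converge i body) ∈ c.log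
  initRecord : ∀ i, InitRecord c (mem c i)
  convergeRecord : ∀ i, ConvergeRecord c (mem c i)
  qcRecord : ∀ i, QCRecord c (mem c i)
  delivered_lt : ∀ k ∈ c.delivered, k < c.log.length
  processed : ∀ k ∈ c.delivered, ∀ p, c.log[k]? = some p →
    Processed (quorum d n) (mem c p.dst) p.src (content p)

theorem Inv.initial (s : (multivaluedBA d V BBA).Setup) :
    Inv ((multivaluedBA d V BBA).initial s) := by
  refine ⟨fun i => rfl, fun i => ?_, fun p hp => absurd hp List.not_mem_nil,
    fun p hp => absurd hp List.not_mem_nil, ?_, ?_, ?_, ?_, ?_, ?_, ?_⟩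
  · constructor <;> simp [Protocol.initial, mem, multivaluedBA, InitDone]
  all_goals simp [Protocol.initial, mem, multivaluedBA, InitRecord, ConvergeRecord, QCRecord]

/-- A token that the adversary can form has evidence: either it occurs in a message that was sent, or
the key of a corrupted process has not been erased, and then the process was corrupted early. -/
theorem Inv.tokenCert_of_feasible {c : (multivaluedBA d V BBA).Config} (hc : Inv c)
    {m : Msg n V BBA.Msg} (hm : (multivaluedBA d V BBA).Feasible c m) :
    ∀ t ∈ msgTokens BBA.tokens m, TokenCert c t := by
  intro t ht
  rcases hm t ht with ⟨p, hp, htp⟩ | ⟨j, hj, hs⟩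
  · exact hc.cert p hp t htp
  · have hs' : mayMint BBA j (mem c j) t := hs
    have hl := hc.localInv j
    cases t with
    | init i v =>
      obtain ⟨rfl, h1, h2⟩ := hs'
      refine ⟨h1, .inr ⟨hj, ?_⟩⟩
      by_contra h
      have := hl.initSent.2 ⟨h1, by simpa [Option.isSome_iff_ne_none] using h⟩
      simp [this] at h2
    | converge i v =>
      obtain ⟨rfl, h1, h2⟩ := hs'
      refine ⟨h1, .inr ⟨hj, fun h => ?_⟩⟩
      have := hl.convergeSent.2 ⟨h1, h⟩
      simp [this] at h2
    | binary t => trivial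

theorem LocalStep.evolves {c c' : (multivaluedBA d V BBA).Config} {i : Fin n} {r : Result V BBA}
    (h : LocalStep c c' i r) (hg : Grows (quorum d n) (mem c i) r.1)
    (hd : c.delivered ⊆ c'.delivered)
    (hp : ∀ i v, c.proposal i = some v → c'.proposal i = some v) : Evolves c c' where
  mem j := by
    by_cases hj : j = i
    · subst hj; rw [h.self]; exact hg
    · rw [h.other j hj]; exact .refl _
  corrupted := by rw [h.corrupted]
  frozen j hj := h.other j (by rintro rfl; exact h.notMem hj)
  log := by rw [h.log]; exact List.prefix_append _ _
  delivered := hd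
  proposal := hp

theorem Inv.evolves {f : ℕ} {c : (multivaluedBA d V BBA).Config} (hc : Inv c) (coin : BBA.Coin)
    (a : (multivaluedBA d V BBA).Action) :
    Evolves c ((multivaluedBA d V BBA).step f c coin a) := by
  generalize hc' : (multivaluedBA d V BBA).step f c coin a = c'
  rcases step_cases f c coin a c' hc' with h | ⟨i, -, -, h⟩ | ⟨i, v, -, hp, h, hp', hd⟩ |
    ⟨k, p, -, hk, hkd, h, hp, hd⟩ | ⟨src, dst, m, -, hs, hm, h, hp, hd⟩
  · rw [h]; exact .refl c
  · rw [h]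
    exact ⟨fun _ => .refl _, Finset.subset_insert _ _, fun _ _ => rfl, List.prefix_rfl, subset_rfl,
      fun _ _ h => h⟩
  · refine h.evolves (grows_onStart i _ (by rw [← hc.proposal, hp]) v coin) hd.ge ?_
    intro j w hw
    rw [hp', Function.update_of_ne]
    · exact hw
    · rintro rfl
      simp [hp] at hw
  · refine h.evolves (grows_onReceive _ _ _ _ coin) (by rw [hd]; exact Finset.subset_insert _ _) ?_
    rw [hp]
    exact fun _ _ h => h
  · refine h.evolves (grows_onReceive _ _ _ _ coin) hd.ge ?_
    rw [hp]
    exact fun _ _ h => h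

/-- A local step preserves the invariants if it preserves the local ones and its records and
messages come with evidence. -/
theorem Inv.localStep {c c' : (multivaluedBA d V BBA).Config} (hc : Inv c) (he : Evolves c c')
    {i : Fin n} {r : Result V BBA} (h : LocalStep c c' i r)
    (hl : LocalInv BBA (quorum d n) r.1) (ho : StepOut i (mem c i) r)
    (hp : ∀ j, c'.proposal j = (mem c' j).input)
    (h1 : InitRecord c r.1) (h2 : ConvergeRecord c r.1) (h3 : QCRecord c r.1)
    (hd : ∀ k ∈ c'.delivered, k < c.log.length ∧ ∀ p, c.log[k]? = some p →
      Processed (quorum d n) (mem c' p.dst) p.src (content p)) : Inv c' := by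
  have hsub : ∀ p ∈ c.log, p ∈ c'.log := fun p hp => he.log.subset hp
  have hmem : ∀ {k m}, (k, m) ∈ r.2 → packet d i k m ∈ c'.log := by
    intro k m hm
    rw [h.log]
    exact List.mem_append_right _ (mem_packets.2 ⟨rfl, hm⟩)
  have hnew : ∀ p ∈ c'.log, p ∈ c.log ∨ p.src = i ∧ (p.dst, content p) ∈ r.2 := by
    intro p hp
    rw [h.log, List.mem_append, mem_packets] at hp
    exact hp
  have hbody : ∀ v, r.1.input = some v → (r.1.initValues = {v} ∧
      convergeBody r.1 = some ⟨v, r.1.initSet⟩ ∨ r.1.initValues ≠ {v} ∧ convergeBody r.1 = none) := by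
    intro v hv
    unfold convergeBody
    by_cases hx : r.1.initValues = {v} <;> simp [hv, hx]
  refine ⟨hp, ?_, ?_, ?_, ?_, ?_, ?_, ?_, ?_, ?_, ?_⟩
  · intro j
    by_cases hj : j = i
    · subst hj; rw [h.self]; exact hl
    · rw [h.other j hj]; exact hc.localInv j
  · intro p hp t ht
    rcases hnew p hp with hp | ⟨-, hp⟩
    · exact (hc.cert p hp t ht).mono he
    · rcases ho.out _ hp with ⟨v, hm, hv, hs⟩ | ⟨hm, hs, hall⟩ | ⟨m, hm⟩
      · dsimp only at hm
        rw [hm] at ht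
        cases ht
        exact ⟨by rw [h.self]; exact hs, .inl (by rw [h.self]; exact hv)⟩
      · dsimp only at hm
        obtain ⟨hs1, hs2⟩ := hl.convergeSent.1 hs
        have hcert : ConvergeCert c' i (convergeBody r.1) := by
          refine ⟨by rw [h.self]; exact hs1, .inl ⟨by rw [h.self]; exact hs2,
            fun k => hmem (hall k), fun hb v hv => ?_⟩⟩
          rw [h.self] at hv ⊢
          rcases hbody v hv with ⟨-, e2⟩ | ⟨e1, -⟩
          · rw [hb] at e2; simp at e2
          · exact e1
        rw [hm] at ht
        obtain ⟨v, hv⟩ := Option.isSome_iff_exists.1 hs2.1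
        rcases hbody v hv with ⟨e1, e2⟩ | ⟨e1, e2⟩
        · rw [e2] at ht hcert
          rcases ht with ht | ⟨k, hk, rfl⟩
          · cases ht
            exact hcert
          · obtain ⟨w, hw, hcw⟩ := h1.1 k hk
            rw [e1, Finset.mem_singleton] at hw
            subst hw
            exact hcw.mono he
        · rw [e2] at ht hcert
          cases ht
          exact hcert
      · dsimp only at hm
        rw [hm] at ht
        obtain ⟨t, -, rfl⟩ := ht
        trivial
  · intro p hp
    rcases hnew p hp with hp | ⟨hsrc, hp⟩
    · exact hc.wellFormed p hp
    · rcases ho.out _ hp with ⟨v, hm, hv, hs⟩ | ⟨hm, hs, hall⟩ | ⟨m, hm⟩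
      · dsimp only at hm
        rw [hm]
        exact hsrc.symm
      · dsimp only at hm
        rw [hm]
        refine ⟨hsrc.symm, fun qc hqc => ?_⟩
        obtain ⟨hs1, hs2⟩ := hl.convergeSent.1 hs
        obtain ⟨v, hv⟩ := Option.isSome_iff_exists.1 hs2.1
        rcases hbody v hv with ⟨-, e2⟩ | ⟨-, e2⟩
        · rw [e2] at hqc
          cases hqc
          exact hs2.2
        · rw [e2] at hqc
          cases hqc
      · dsimp only at hm
        rw [hm]
        trivial
  · intro j v hv hs k
    by_cases hj : j = i
    · subst hj
      rw [h.self] at hv hs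
      rcases ho.initOut v hv hs with h' | h'
      · exact hsub _ (hc.initSent j v h' (by rw [← (he.mem j).sampled, h.self]; exact hs) k)
      · exact hmem (h' k)
    · rw [h.other j hj] at hv hs
      exact hsub _ (hc.initSent j v hv hs k)
  · intro j hs
    by_cases hj : j = i
    · subst hj
      rw [h.self] at hs
      rcases ho.convergeOut hs with h' | h'
      · obtain ⟨body, hb⟩ := hc.convergeSent j h'
        exact ⟨body, fun k => hsub _ (hb k)⟩
      · exact ⟨_, fun k => hmem (h' k)⟩
    · rw [h.other j hj] at hs
      obtain ⟨body, hb⟩ := hc.convergeSent j hs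
      exact ⟨body, fun k => hsub _ (hb k)⟩
  · intro j
    by_cases hj : j = i
    · subst hj; rw [h.self]; exact h1.mono he
    · rw [h.other j hj]; exact (hc.initRecord j).mono he
  · intro j
    by_cases hj : j = i
    · subst hj; rw [h.self]; exact h2.mono he
    · rw [h.other j hj]; exact (hc.convergeRecord j).mono he
  · intro j
    by_cases hj : j = i
    · subst hj; rw [h.self]; exact h3.mono he
    · rw [h.other j hj]; exact (hc.qcRecord j).mono he
  · intro k hk
    exact (hd k hk).1.trans_le he.log.length_le
  · intro k hk p hkp
    refine (hd k hk).2 p ?_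
    obtain ⟨l, hl'⟩ := he.log
    rw [← hl', List.getElem?_append_left (hd k hk).1] at hkp
    exact hkp

theorem recordInit_initRecord {c : (multivaluedBA d V BBA).Config} {s : State n V BBA.State}
    (hs : InitRecord c s) {j : Fin n} {v : V} (hc : InitCert c j v) :
    InitRecord c (recordInit BBA (quorum d n) s j v) := by
  classical
  unfold recordInit
  split_ifs
  · constructor
    · intro k hk
      rcases Finset.mem_insert.1 hk with rfl | hk
      · exact ⟨v, Finset.mem_insert_self _ _, hc⟩
      · obtain ⟨w, hw, hcw⟩ := hs.1 k hk
        exact ⟨w, Finset.mem_insert_of_mem hw, hcw⟩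
    · intro w hw
      rcases Finset.mem_insert.1 hw with rfl | hw
      · exact ⟨j, Finset.mem_insert_self _ _, hc⟩
      · obtain ⟨k, hk, hck⟩ := hs.2 w hw
        exact ⟨k, Finset.mem_insert_of_mem hk, hck⟩
  · exact hs

theorem recordConverge_convergeRecord {c : (multivaluedBA d V BBA).Config}
    {s : State n V BBA.State} (hs : ConvergeRecord c s) {j : Fin n} {body : Option (QC n V)}
    (hc : ConvergeCert c j body) :
    ConvergeRecord c (recordConverge BBA (quorum d n) s j body) := by
  unfold recordConverge
  by_cases h : j ∉ s.convergeSet ∧ s.convergeSet.card < quorum d n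
  · rw [if_pos h]
    obtain ⟨T, h1, h2, h3, h4⟩ := hs
    cases body with
    | none =>
      refine ⟨T, h1.trans (Finset.subset_insert _ _), by simpa using h2, h3, ?_⟩
      intro k hk hkT
      rcases Finset.mem_insert.1 hk with rfl | hk
      · exact hc
      · exact h4 k hk hkT
    | some qc =>
      refine ⟨insert j T, Finset.insert_subset_insert _ h1, ?_, ?_, ?_⟩
      · rw [Finset.card_insert_of_notMem fun hj => h.1 (h1 hj), h2]
        rfl
      · intro k hk
        rcases Finset.mem_insert.1 hk with rfl | hk
        · exact ⟨qc, hc⟩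
        · exact h3 k hk
      · intro k hk hkT
        rw [Finset.mem_insert, not_or] at hkT
        rcases Finset.mem_insert.1 hk with rfl | hk
        · exact absurd rfl hkT.1
        · exact h4 k hk hkT.2
  · rw [if_neg h]
    exact hs

theorem recordConverge_qcRecord {c : (multivaluedBA d V BBA).Config}
    {s : State n V BBA.State} (hs : QCRecord c s) {j : Fin n} {body : Option (QC n V)}
    (hb : ValidBody (quorum d n) body)
    (hc : ∀ qc, body = some qc → ∀ k ∈ qc.signers, InitCert c k qc.value) :
    QCRecord c (recordConverge BBA (quorum d n) s j body) := by
  intro v hv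
  have hq : (recordConverge BBA (quorum d n) s j body).qcValue =
      (s.qcValue <|> body.map QC.value) := rfl
  rw [hq] at hv
  cases h : s.qcValue with
  | some w =>
    rw [h] at hv
    cases hv
    exact hs _ h
  | none =>
    rw [h] at hv
    cases body with
    | none => cases hv
    | some qc =>
      cases hv
      exact ⟨qc.signers, hb qc rfl, hc qc rfl⟩

theorem records_onReceive {c : (multivaluedBA d V BBA).Config} {s : State n V BBA.State}
    (h1 : InitRecord c s) (h2 : ConvergeRecord c s) (h3 : QCRecord c s) {m : Msg n V BBA.Msg}
    (hm : ∀ t ∈ msgTokens BBA.tokens m, TokenCert c t) (i src : Fin n) (coin : BBA.Coin) :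
    InitRecord c (onReceive BBA (quorum d n) (byzBound d n) i s src m coin).1 ∧
      ConvergeRecord c (onReceive BBA (quorum d n) (byzBound d n) i s src m coin).1 ∧
      QCRecord c (onReceive BBA (quorum d n) (byzBound d n) i s src m coin).1 := by
  cases m with
  | init j v =>
    by_cases hj : j = src
    · subst hj
      obtain ⟨x, hx⟩ :=
        onReceive_init_fst (W := quorum d n) (B := byzBound d n) i s j v coin
      rw [hx]
      have hcv : InitCert c j v := hm (.init j v) rfl
      refine ⟨recordInit_initRecord h1 hcv, ?_, ?_⟩
      · unfold recordInit
        split_ifs <;> exact h2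
      · unfold recordInit
        split_ifs <;> exact h3
    · rw [(onReceive_ignored i s src coin).1 j v hj]
      exact ⟨h1, h2, h3⟩
  | converge j body =>
    by_cases hj : j = src ∧ ValidBody (quorum d n) body
    · obtain ⟨rfl, hb⟩ := hj
      obtain ⟨a, b, z, hx⟩ := onReceive_converge_fst (B := byzBound d n) i s j body hb coin
      rw [hx]
      refine ⟨?_, recordConverge_convergeRecord h2 ?_, recordConverge_qcRecord (j := j) h3 hb ?_⟩
      · unfold recordConverge
        by_cases h : j ∉ s.convergeSet ∧ s.convergeSet.card < quorum d n
        · rw [if_pos h]; exact h1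
        · rw [if_neg h]; exact h1
      · cases body with
        | none => exact hm (.converge j none) rfl
        | some qc => exact hm (.converge j (some qc)) (.inl rfl)
      · rintro qc rfl k hk
        exact hm (.init k qc.value) (.inr ⟨k, hk, rfl⟩)
    · rw [(onReceive_ignored i s src coin).2 j body hj]
      exact ⟨h1, h2, h3⟩
  | binary m => exact ⟨h1, h2, h3⟩

theorem processed_onReceive {W B : ℕ} (i : Fin n) (s : State n V BBA.State) (hs : LocalInv BBA W s)
    (src : Fin n) (m : Msg n V BBA.Msg) (coin : BBA.Coin) :
    Processed W (onReceive BBA W B i s src m coin).1 src m := by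
  cases m with
  | init j v =>
    intro hj
    subst hj
    obtain ⟨x, hx⟩ := onReceive_init_fst (W := W) (B := B) i s j v coin
    rw [hx]
    unfold recordInit
    split_ifs with h
    · exact .inl (Finset.mem_insert_self _ _)
    · exact .inr (le_antisymm hs.initSet_le (not_lt.1 h))
  | converge j body =>
    intro hj hb
    subst hj
    obtain ⟨a, b, z, hx⟩ := onReceive_converge_fst (B := B) i s j body hb coin
    rw [hx]
    constructor
    · unfold recordConverge
      by_cases h : j ∉ s.convergeSet ∧ s.convergeSet.card < W
      · rw [if_pos h]
        exact .inl (Finset.mem_insert_self _ _)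
      · rw [if_neg h]
        rw [not_and_or, not_not, not_lt] at h
        exact h.imp_right fun h => le_antisymm hs.convergeSet_le h
    · intro hsome
      change (s.qcValue <|> body.map QC.value).isSome = true
      cases s.qcValue <;> simp [hsome]
  | binary m => trivial

theorem Inv.step {f : ℕ} {c : (multivaluedBA d V BBA).Config} (hc : Inv c) (coin : BBA.Coin)
    (a : (multivaluedBA d V BBA).Action) :
    Inv ((multivaluedBA d V BBA).step f c coin a) := by
  have he := hc.evolves (f := f) coin a
  generalize hc' : (multivaluedBA d V BBA).step f c coin a = c' at he
  have hold : ∀ k ∈ c.delivered, k < c.log.length ∧ ∀ p, c.log[k]? = some p →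
      Processed (quorum d n) (mem c' p.dst) p.src (content p) := fun k hk =>
    ⟨hc.delivered_lt k hk, fun p hp => (hc.processed k hk p hp).mono (he.mem _)⟩
  rcases step_cases f c coin a c' hc' with h | ⟨i, -, -, h⟩ | ⟨i, v, -, hp, h, hp', hd⟩ |
    ⟨k, p, -, hk, hkd, h, hp, hd⟩ | ⟨src, dst, m, -, hs, hm, h, hp, hd⟩
  · rw [h]; exact hc
  · subst h
    exact ⟨hc.proposal, hc.localInv, fun p hp t ht => (hc.cert p hp t ht).mono he, hc.wellFormed,
      hc.initSent, hc.convergeSent, fun i => (hc.initRecord i).mono he,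
      fun i => (hc.convergeRecord i).mono he, fun i => (hc.qcRecord i).mono he, hc.delivered_lt,
      hc.processed⟩
  · have hin : (mem c i).input = none := by rw [← hc.proposal, hp]
    obtain ⟨y, x, a', b, z, hr⟩ := onStart_fst (W := quorum d n) (B := byzBound d n) i (mem c i) v coin
    refine hc.localStep he h ((hc.localInv i).onStart hin i v coin) (stepOut_onStart _ _ _ _) ?_ ?_ ?_ ?_
      (by rw [hd]; exact hold)
    · intro j
      rw [hp']
      by_cases hj : j = i
      · subst hj
        rw [h.self, hr, Function.update_self]
      · rw [h.other j hj, Function.update_of_ne hj, hc.proposal]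
    · rw [hr]; exact hc.initRecord i
    · rw [hr]; exact hc.convergeRecord i
    · rw [hr]; exact hc.qcRecord i
  · obtain ⟨h1, h2, h3⟩ := records_onReceive (hc.initRecord p.dst) (hc.convergeRecord p.dst)
      (hc.qcRecord p.dst) (hc.cert p (List.mem_of_getElem? hk)) p.dst p.src coin
    refine hc.localStep he h ((hc.localInv _).onReceive _ _ _ coin) (stepOut_onReceive _ _ _ _ _) ?_
      h1 h2 h3 ?_
    · intro j
      rw [hp, hc.proposal]
      by_cases hj : j = p.dst
      · subst hj
        rw [h.self]
        exact (input_onReceive _ _ _ _ _).symm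
      · rw [h.other j hj]
    · intro k' hk'
      rw [hd, Finset.mem_insert] at hk'
      rcases hk' with rfl | hk'
      · refine ⟨(List.getElem?_eq_some_iff.1 hk).1, fun p' hp' => ?_⟩
        rw [hk] at hp'
        cases hp'
        rw [h.self]
        exact processed_onReceive _ _ (hc.localInv _) _ _ _
      · exact hold k' hk'
  · obtain ⟨h1, h2, h3⟩ := records_onReceive (hc.initRecord dst) (hc.convergeRecord dst)
      (hc.qcRecord dst) (hc.tokenCert_of_feasible hm) dst src coin
    refine hc.localStep he h ((hc.localInv _).onReceive _ _ _ coin) (stepOut_onReceive _ _ _ _ _) ?_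
      h1 h2 h3 (by rw [hd]; exact hold)
    intro j
    rw [hp, hc.proposal]
    by_cases hj : j = dst
    · subst hj
      rw [h.self]
      exact (input_onReceive _ _ _ _ _).symm
    · rw [h.other j hj]

variable (f : ℕ) (adv : (multivaluedBA d V BBA).Adversary) (ω : (multivaluedBA d V BBA).Outcome)

theorem inv_run (t : ℕ) : Inv ((multivaluedBA d V BBA).run f adv ω t) := by
  induction t with
  | zero => exact .initial _
  | succ t ih =>
    rw [run_succ]
    exact ih.step _ _

theorem evolves_run {s t : ℕ} (h : s ≤ t) : Evolves ((multivaluedBA d V BBA).run f adv ω s)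
    ((multivaluedBA d V BBA).run f adv ω t) := by
  induction h with
  | refl => exact .refl _
  | step _ ih =>
    refine ih.trans ?_
    rw [Nat.succ_eq_add_one, run_succ]
    exact (inv_run f adv ω _).evolves _ _

end Global

end MultivaluedBA

/-! ### Positions in a filtered list -/

section Position

variable {α β : Type*} (g : α → Option β)

/-- The position that the entry number `k` of the list `l` has in `l.filterMap g`. -/
def filteredPos (l : List α) (k : ℕ) : ℕ := ((l.take k).filterMap g).length

theorem filteredPos_append {l : List α} (l' : List α) {k : ℕ} (hk : k ≤ l.length) :
    filteredPos g (l ++ l') k = filteredPos g l k := by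
  unfold filteredPos
  rw [List.take_append_of_le_length hk]

variable {g}

theorem filteredPos_lt {l : List α} {j k : ℕ} {x : α} {y : β} (hj : l[j]? = some x)
    (hx : g x = some y) (hjk : j < k) : filteredPos g l j < filteredPos g l k := by
  unfold filteredPos
  obtain ⟨h, rfl⟩ := List.getElem?_eq_some_iff.1 hj
  have : (l.take (j + 1)).filterMap g = (l.take j).filterMap g ++ [y] := by
    rw [List.take_succ_eq_append_getElem h, List.filterMap_append]
    simp [hx]
  have h2 : ((l.take (j + 1)).filterMap g).length ≤ ((l.take k).filterMap g).length :=
    ((List.take_sublist_take_left (Nat.succ_le_of_lt hjk)).filterMap g).length_le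
  rw [this, List.length_append] at h2
  simpa using h2

theorem filteredPos_inj {l : List α} {j k : ℕ} {x x' : α} {y y' : β} (hj : l[j]? = some x)
    (hx : g x = some y) (hk : l[k]? = some x') (hx' : g x' = some y')
    (h : filteredPos g l j = filteredPos g l k) : j = k := by
  rcases lt_trichotomy j k with h' | h' | h'
  · exact absurd h (filteredPos_lt hj hx h').ne
  · exact h'
  · exact absurd h (filteredPos_lt hk hx' h').ne'

theorem getElem?_filteredPos {l : List α} {k : ℕ} {x : α} {y : β} (hk : l[k]? = some x)
    (hx : g x = some y) : (l.filterMap g)[filteredPos g l k]? = some y := by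
  obtain ⟨h, rfl⟩ := List.getElem?_eq_some_iff.1 hk
  unfold filteredPos
  conv_lhs => rw [← List.take_append_drop k l, List.filterMap_append]
  rw [List.drop_eq_getElem_cons h, List.filterMap_cons_some hx]
  simp

theorem exists_filteredPos {l : List α} {k : ℕ} {y : β} (hk : (l.filterMap g)[k]? = some y) :
    ∃ j x, l[j]? = some x ∧ g x = some y ∧ filteredPos g l j = k := by
  induction l generalizing k with
  | nil => simp at hk
  | cons a l ih =>
    cases ha : g a with
    | none =>
      rw [List.filterMap_cons_none ha] at hk
      obtain ⟨j, x, h1, h2, h3⟩ := ih hk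
      refine ⟨j + 1, x, by simpa using h1, h2, ?_⟩
      unfold filteredPos at h3 ⊢
      rw [List.take_succ_cons, List.filterMap_cons_none ha, h3]
    | some b =>
      rw [List.filterMap_cons_some ha] at hk
      cases k with
      | zero =>
        refine ⟨0, a, rfl, ?_, rfl⟩
        simpa [ha] using hk
      | succ k =>
        obtain ⟨j, x, h1, h2, h3⟩ := ih (k := k) (by simpa using hk)
        refine ⟨j + 1, x, by simpa using h1, h2, ?_⟩
        unfold filteredPos at h3 ⊢
        rw [List.take_succ_cons, List.filterMap_cons_some ha, List.length_cons, h3]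

end Position

namespace MultivaluedBA

/-! ### The embedded run of the binary protocol -/

section Projection

variable {n : ℕ} {d : ℝ} {V : Type} {BBA : Protocol n Bool Bool}

/-- The message of the binary protocol that a message carries, if any. -/
def unwrapMsg {M : Type} : Msg n V M → Option M
  | .binary m => some m
  | _ => none

/-- The messages of the binary protocol in a list of outgoing messages. -/
def unwrapOut {M : Type} (l : List (Fin n × Msg n V M)) : List (Fin n × M) :=
  l.filterMap fun q => (unwrapMsg q.2).map fun m => (q.1, m)

/-- The packet of the binary protocol that a packet carries, if any. -/
def unwrap (p : (multivaluedBA d V BBA).Packet) : Option BBA.Packet :=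
  (unwrapMsg (content p)).map fun m => ⟨p.src, p.dst, m⟩

theorem unwrapOut_append {M : Type} (l l' : List (Fin n × Msg n V M)) :
    unwrapOut (l ++ l') = unwrapOut l ++ unwrapOut l' := List.filterMap_append

theorem unwrapOut_map_wrap {M : Type} (l : List (Fin n × M)) :
    unwrapOut (l.map (wrap V)) = l := by
  unfold unwrapOut
  rw [List.filterMap_map]
  exact (List.filterMap_congr (fun _ _ => rfl)).trans List.filterMap_some

theorem unwrapOut_broadcast {M : Type} {m : Msg n V M} (hm : unwrapMsg m = none) :
    unwrapOut (broadcast m) = [] := by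
  unfold unwrapOut
  rw [List.filterMap_eq_nil_iff]
  intro q hq
  rw [mem_broadcast.1 hq, hm]
  rfl

theorem filterMap_unwrap_packets (i : Fin n) (l : List (Fin n × Msg n V BBA.Msg)) :
    (packets d i l).filterMap unwrap =
      (unwrapOut l).map fun q => (⟨i, q.1, q.2⟩ : BBA.Packet) := by
  unfold packets unwrapOut
  rw [List.filterMap_map, List.map_filterMap]
  refine List.filterMap_congr fun q _ => ?_
  change (unwrapMsg q.2).map _ = _
  cases unwrapMsg q.2 <;> rfl

open Classical in
/-- The configuration of the binary protocol inside a configuration of the multivalued algorithm. A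
process has proposed in the binary protocol once it has called it. -/
noncomputable def proj (c : (multivaluedBA d V BBA).Config) : BBA.Config where
  loc i := (mem c i).binary
  proposal i := if (mem c i).binaryCalled = true then some (alert (byzBound d n) (mem c i)) else none
  corrupted := c.corrupted
  log := c.log.filterMap unwrap
  delivered := (c.delivered.filter fun k => ((c.log[k]?).bind unwrap).isSome = true).image
    (filteredPos unwrap c.log)

theorem mem_proj_delivered {c : (multivaluedBA d V BBA).Config} {k' : ℕ} :
    k' ∈ (proj c).delivered ↔ ∃ k ∈ c.delivered, ∃ p q, c.log[k]? = some p ∧ unwrap p = some q ∧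
      filteredPos unwrap c.log k = k' := by
  classical
  simp only [proj, Finset.mem_image, Finset.mem_filter, Option.isSome_iff_exists,
    Option.bind_eq_some_iff]
  constructor
  · rintro ⟨k, ⟨hk, q, p, hp, hq⟩, rfl⟩
    exact ⟨k, hk, p, q, hp, hq, rfl⟩
  · rintro ⟨k, hk, p, q, hp, hq, rfl⟩
    exact ⟨k, ⟨hk, q, p, hp, hq⟩, rfl⟩

/-- Neither sending messages nor delivering `INIT` and `CONVERGE` messages changes which messages of
the binary protocol are delivered. -/
theorem proj_delivered_congr {c c' : (multivaluedBA d V BBA).Config}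
    (hlt : ∀ k ∈ c.delivered, k < c.log.length) (hlog : c.log <+: c'.log)
    (hd : ∀ k, k ∈ c'.delivered ↔ k ∈ c.delivered ∨
      (k ∈ c'.delivered ∧ ∃ p, c.log[k]? = some p ∧ unwrap p = none)) :
    (proj c').delivered = (proj c).delivered := by
  obtain ⟨l, hl⟩ := hlog
  have hget : ∀ (k : ℕ) p, c.log[k]? = some p → c'.log[k]? = some p := by
    intro k p h
    rw [← hl, List.getElem?_append_left (List.getElem?_eq_some_iff.1 h).1, h]
  ext k'
  rw [mem_proj_delivered, mem_proj_delivered]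
  constructor
  · rintro ⟨k, hk, p, q, hp, hq, rfl⟩
    rcases (hd k).1 hk with h | ⟨-, p', hp', hq'⟩
    · have hk' := hlt k h
      refine ⟨k, h, p, q, ?_, hq, ?_⟩
      · rwa [← hl, List.getElem?_append_left hk'] at hp
      · rw [← hl, filteredPos_append _ _ hk'.le]
    · rw [hget k p' hp'] at hp
      cases hp
      rw [hq] at hq'
      cases hq'
  · rintro ⟨k, hk, p, q, hp, hq, rfl⟩
    refine ⟨k, (hd k).2 (.inl hk), p, q, hget k p hp, hq, ?_⟩
    rw [← hl, filteredPos_append _ _ (hlt k hk).le]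

theorem proj_delivered_insert {c c' : (multivaluedBA d V BBA).Config}
    (hlt : ∀ k ∈ c.delivered, k < c.log.length) (hlog : c.log <+: c'.log) {k : ℕ}
    {p : (multivaluedBA d V BBA).Packet} {q : BBA.Packet} (hp : c.log[k]? = some p)
    (hq : unwrap p = some q) (hd : c'.delivered = insert k c.delivered) :
    (proj c').delivered = insert (filteredPos unwrap c.log k) (proj c).delivered := by
  obtain ⟨l, hl⟩ := hlog
  have hget : ∀ (k : ℕ) p, c.log[k]? = some p → c'.log[k]? = some p := by
    intro k p h
    rw [← hl, List.getElem?_append_left (List.getElem?_eq_some_iff.1 h).1, h]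
  ext k'
  rw [Finset.mem_insert, mem_proj_delivered, mem_proj_delivered]
  constructor
  · rintro ⟨j, hj, p', q', hp', hq', rfl⟩
    rw [hd, Finset.mem_insert] at hj
    rcases hj with rfl | hj
    · left
      rw [← hl, filteredPos_append _ _ (List.getElem?_eq_some_iff.1 hp).1.le]
    · right
      have hk' := hlt j hj
      refine ⟨j, hj, p', q', ?_, hq', ?_⟩
      · rwa [← hl, List.getElem?_append_left hk'] at hp'
      · rw [← hl, filteredPos_append _ _ hk'.le]
  · rintro (rfl | ⟨j, hj, p', q', hp', hq', rfl⟩)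
    · refine ⟨k, by rw [hd]; exact Finset.mem_insert_self _ _, p, q, hget k p hp, hq, ?_⟩
      rw [← hl, filteredPos_append _ _ (List.getElem?_eq_some_iff.1 hp).1.le]
    · refine ⟨j, by rw [hd]; exact Finset.mem_insert_of_mem hj, p', q', hget j p' hp', hq', ?_⟩
      rw [← hl, filteredPos_append _ _ (hlt j hj).le]

/-- The local step with result `r` of process `i` in the state `s` does not touch the binary
protocol. -/
structure BinaryIdle (s : State n V BBA.State) (r : Result V BBA) : Prop where
  binary : r.1.binary = s.binary
  called : r.1.binaryCalled = s.binaryCalled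
  out : unwrapOut r.2 = []

/-- The local step with result `r` of process `i` in the state `s` calls the binary protocol with the
input `x`. -/
structure BinaryStart (B : ℕ) (i : Fin n) (coin : BBA.Coin) (x : Bool) (s : State n V BBA.State)
    (r : Result V BBA) : Prop where
  notCalled : s.binaryCalled = false
  binary : r.1.binary = (BBA.start i s.binary x coin).1
  called : r.1.binaryCalled = true
  alert : alert B r.1 = x
  out : unwrapOut r.2 = (BBA.start i s.binary x coin).2

open Classical in
/-- The move in the binary protocol that corresponds to `callBinary` in the state `s`. -/
noncomputable def callAction (d : ℝ) {S : Type} (BBA : Protocol n Bool Bool) (i : Fin n)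
    (s : State n V S) : BBA.Action :=
  if CallsBinary (quorum d n) s then .start i (alert (byzBound d n) s) else .idle

open Classical in
/-- The move in the binary protocol that corresponds to the delivery of `m` to process `i` in the
state `s`, where `act m` is the move if `m` belongs to the binary protocol. -/
noncomputable def receiveAction (d : ℝ) (i : Fin n) (s : State n V BBA.State) (src : Fin n)
    (act : BBA.Msg → BBA.Action) : Msg n V BBA.Msg → BBA.Action
  | .init _ _ => .idle
  | .converge j body =>
      if j = src ∧ ValidBody (quorum d n) body then
        callAction d BBA i (recordConverge BBA (quorum d n) s j body)
      else .idle
  | .binary m => act m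

open Classical in
/-- The move in the binary protocol that corresponds to a move in the multivalued algorithm. -/
noncomputable def projAction (c : (multivaluedBA d V BBA).Config) :
    (multivaluedBA d V BBA).Action → BBA.Action
  | .start i v =>
      if i ∉ c.corrupted ∧ c.proposal i = none then
        callAction d BBA i { mem c i with input := some v }
      else .idle
  | .deliver k =>
      match c.log[k]? with
      | none => .idle
      | some p =>
          if k ∉ c.delivered ∧ p.dst ∉ c.corrupted then
            receiveAction d p.dst (mem c p.dst) p.src
              (fun _ => .deliver (filteredPos unwrap c.log k)) (content p)
          else .idle
  | .corrupt i => .corrupt i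
  | .inject src dst m =>
      if src ∈ c.corrupted ∧ dst ∉ c.corrupted ∧ (multivaluedBA d V BBA).Feasible c m then
        receiveAction d dst (mem c dst) src (fun m' => .inject src dst m') m
      else .idle
  | .idle => .idle

/-- The effect of `callBinary` after some instructions that send the messages `l` and do not touch the
binary protocol. -/
theorem callBinary_effect {W B : ℕ} (i : Fin n) (coin : BBA.Coin) (s s₁ : State n V BBA.State)
    (l : List (Fin n × Msg n V BBA.Msg)) (hl : unwrapOut l = []) (h1 : s₁.binary = s.binary)
    (h2 : s₁.binaryCalled = s.binaryCalled) :
    (CallsBinary W s₁ → BinaryStart B i coin (alert B s₁) s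
      ((callBinary BBA W B i coin s₁).1, l ++ (callBinary BBA W B i coin s₁).2)) ∧
    (¬ CallsBinary W s₁ → BinaryIdle s
      ((callBinary BBA W B i coin s₁).1, l ++ (callBinary BBA W B i coin s₁).2)) := by
  classical
  rw [callBinary_eq]
  constructor
  · intro h
    rw [if_pos h]
    refine ⟨h2 ▸ h.2.1, by rw [← h1], rfl, rfl, ?_⟩
    rw [unwrapOut_append, hl, unwrapOut_map_wrap, h1]
    rfl
  · intro h
    rw [if_neg h]
    exact ⟨h1, h2, by simpa using hl⟩

theorem unwrapOut_sendConverge {W : ℕ} (i : Fin n) (s : State n V BBA.State) :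
    unwrapOut (sendConverge BBA W i s).2 = [] := by
  classical
  rw [sendConverge_eq]
  split_ifs
  · exact unwrapOut_broadcast rfl
  · rfl

theorem unwrapOut_propose (i : Fin n) (s : State n V BBA.State) (v : V) :
    unwrapOut (propose i s v).2 = [] := by
  unfold propose
  split_ifs
  · exact unwrapOut_broadcast rfl
  · rfl

theorem propose_fst (i : Fin n) (s : State n V BBA.State) (v : V) :
    ∃ y, (propose i s v).1 = { s with input := some v, initSent := y } := by
  unfold propose
  split_ifs
  · exact ⟨_, rfl⟩
  · exact ⟨_, rfl⟩

theorem onStart_effect {W B : ℕ} (i : Fin n) (s : State n V BBA.State) (v : V) (coin : BBA.Coin) :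
    (CallsBinary W { s with input := some v } →
      BinaryStart B i coin (alert B { s with input := some v }) s
        (onStart BBA W B i s v coin)) ∧
    (¬ CallsBinary W { s with input := some v } →
      BinaryIdle s (onStart BBA W B i s v coin)) := by
  rw [onStart_eq]
  obtain ⟨y, hy⟩ := propose_fst i s v
  obtain ⟨x, hx⟩ := sendConverge_fst (W := W) i (propose i s v).1
  have h := callBinary_effect (W := W) (B := B) i coin s (sendConverge BBA W i (propose i s v).1).1
    ((propose i s v).2 ++ (sendConverge BBA W i (propose i s v).1).2)
    (by rw [unwrapOut_append, unwrapOut_propose, unwrapOut_sendConverge]; rfl)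
    (by rw [hx, hy]) (by rw [hx, hy])
  have e1 : CallsBinary W (sendConverge BBA W i (propose i s v).1).1 ↔
      CallsBinary W { s with input := some v } := by rw [hx, hy]; rfl
  have e2 : alert B (sendConverge BBA W i (propose i s v).1).1 =
      alert B { s with input := some v } := by rw [hx, hy]; rfl
  rw [e1, e2] at h
  exact h

/-- The three ways in which the reception of a message affects the binary protocol. -/
theorem onReceive_effect (i : Fin n) (s : State n V BBA.State) (src : Fin n)
    (m : Msg n V BBA.Msg) (coin : BBA.Coin) (act : BBA.Msg → BBA.Action) :
    (receiveAction d i s src act m = .idle ∧ unwrapMsg m = none ∧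
      BinaryIdle s (onReceive BBA (quorum d n) (byzBound d n) i s src m coin)) ∨
    (∃ x, receiveAction d i s src act m = .start i x ∧ unwrapMsg m = none ∧
      BinaryStart (byzBound d n) i coin x s
        (onReceive BBA (quorum d n) (byzBound d n) i s src m coin)) ∨
    ∃ m', m = .binary m' ∧ receiveAction d i s src act m = act m' := by
  classical
  cases m with
  | init j v =>
    refine .inl ⟨rfl, rfl, ?_⟩
    by_cases hj : j = src
    · have h2 : onReceive BBA (quorum d n) (byzBound d n) i s src (.init j v) coin =
        sendConverge BBA (quorum d n) i (recordInit BBA (quorum d n) s j v) := by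
        simp [onReceive, hj]
      obtain ⟨x, hx⟩ := sendConverge_fst (W := quorum d n) i (recordInit BBA (quorum d n) s j v)
      rw [h2]
      refine ⟨?_, ?_, unwrapOut_sendConverge _ _⟩
      · rw [hx]; unfold recordInit; split_ifs <;> rfl
      · rw [hx]; unfold recordInit; split_ifs <;> rfl
    · rw [(onReceive_ignored i s src coin).1 j v hj]
      exact ⟨rfl, rfl, rfl⟩
  | converge j body =>
    by_cases hj : j = src ∧ ValidBody (quorum d n) body
    · have h2 : onReceive BBA (quorum d n) (byzBound d n) i s src (.converge j body) coin =
        callBinary BBA (quorum d n) (byzBound d n) i coin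
          (recordConverge BBA (quorum d n) s j body) := by simp only [onReceive, if_pos hj]
      have h1 : (recordConverge BBA (quorum d n) s j body).binary = s.binary ∧
          (recordConverge BBA (quorum d n) s j body).binaryCalled = s.binaryCalled := by
        unfold recordConverge
        by_cases hc : j ∉ s.convergeSet ∧ s.convergeSet.card < quorum d n
        · rw [if_pos hc]; exact ⟨rfl, rfl⟩
        · rw [if_neg hc]; exact ⟨rfl, rfl⟩
      have h := callBinary_effect (W := quorum d n) (B := byzBound d n) i coin s
        (recordConverge BBA (quorum d n) s j body) [] rfl h1.1 h1.2
      simp only [receiveAction, if_pos hj, callAction, h2]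
      by_cases hc : CallsBinary (quorum d n) (recordConverge BBA (quorum d n) s j body)
      · exact .inr (.inl ⟨_, if_pos hc, rfl, h.1 hc⟩)
      · exact .inl ⟨if_neg hc, rfl, h.2 hc⟩
    · rw [(onReceive_ignored i s src coin).2 j body hj]
      exact .inl ⟨by simp only [receiveAction, if_neg hj], rfl, rfl, rfl, rfl⟩
  | binary m => exact .inr (.inr ⟨m, rfl, rfl⟩)

theorem _root_.Protocol.Config.ext' {In Out : Type} {P : Protocol n In Out} {c c' : P.Config}
    (h1 : c.loc = c'.loc) (h2 : c.proposal = c'.proposal) (h3 : c.corrupted = c'.corrupted)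
    (h4 : c.log = c'.log) (h5 : c.delivered = c'.delivered) : c = c' := by
  cases c; cases c'; simp_all

theorem LocalStep.proj_log {c c' : (multivaluedBA d V BBA).Config} {i : Fin n} {r : Result V BBA}
    (h : LocalStep c c' i r) : (proj c').log =
      (proj c).log ++ (unwrapOut r.2).map fun q => (⟨i, q.1, q.2⟩ : BBA.Packet) := by
  change c'.log.filterMap unwrap = _
  rw [h.log, List.filterMap_append, filterMap_unwrap_packets]
  rfl

/-- The input with which the binary protocol was called stays fixed, since `count` does not change any
more once `convergeSet` is full. -/
theorem LocalStep.proj_idle {c c' : (multivaluedBA d V BBA).Config} (hc : Inv c) (he : Evolves c c')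
    {i : Fin n} {r : Result V BBA} (h : LocalStep c c' i r) (hb : BinaryIdle (mem c i) r)
    (hd : (proj c').delivered = (proj c).delivered) : proj c' = proj c := by
  refine Config.ext' ?_ ?_ h.corrupted ?_ hd
  · funext j
    change (mem c' j).binary = (mem c j).binary
    by_cases hj : j = i
    · subst hj; rw [h.self, hb.binary]
    · rw [h.other j hj]
  · funext j
    change (if (mem c' j).binaryCalled = true then some (alert (byzBound d n) (mem c' j)) else none) =
      if (mem c j).binaryCalled = true then some (alert (byzBound d n) (mem c j)) else none
    by_cases hj : j = i
    · subst hj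
      have hg := he.mem j
      rw [h.self] at hg ⊢
      rw [hb.called]
      split_ifs with hcall
      · unfold alert
        rw [(hg.convergeFull ((hc.localInv j).binaryCalled.1 hcall).2).2]
      · rfl
    · rw [h.other j hj]
  · rw [h.proj_log, hb.out]
    simp

theorem LocalStep.proj_start {f : ℕ} {c c' : (multivaluedBA d V BBA).Config} {i : Fin n}
    {r : Result V BBA} (h : LocalStep c c' i r) {coin : BBA.Coin} {x : Bool}
    (hb : BinaryStart (byzBound d n) i coin x (mem c i) r)
    (hd : (proj c').delivered = (proj c).delivered) :
    proj c' = BBA.step f (proj c) coin (.start i x) := by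
  have hcond : i ∉ (proj c).corrupted ∧ (proj c).proposal i = none := by
    refine ⟨h.notMem, ?_⟩
    simp [proj, hb.notCalled]
  simp only [Protocol.step]
  rw [if_pos hcond]
  refine Config.ext' ?_ ?_ h.corrupted ?_ hd
  · funext j
    change (mem c' j).binary = Function.update (proj c).loc i _ j
    by_cases hj : j = i
    · subst hj; rw [h.self, hb.binary, Function.update_self]; rfl
    · rw [h.other j hj, Function.update_of_ne hj]; rfl
  · funext j
    change (if (mem c' j).binaryCalled = true then some (alert (byzBound d n) (mem c' j)) else none) =
      Function.update (proj c).proposal i _ j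
    by_cases hj : j = i
    · subst hj; rw [h.self, hb.called, if_pos rfl, hb.alert, Function.update_self]
    · rw [h.other j hj, Function.update_of_ne hj]; rfl
  · rw [h.proj_log, hb.out]
    rfl

theorem LocalStep.proj_receive {c c' : (multivaluedBA d V BBA).Config} {i src : Fin n}
    {m : BBA.Msg} {coin : BBA.Coin} (h : LocalStep c c' i
      (onReceive BBA (quorum d n) (byzBound d n) i (mem c i) src (.binary m) coin)) :
    { BBA.afterLocal (proj c) i (BBA.recv i ((proj c).loc i) src m coin) with
      delivered := (proj c').delivered } = proj c' := by
  symm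
  refine Config.ext' ?_ ?_ h.corrupted ?_ rfl
  · funext j
    change (mem c' j).binary = Function.update (proj c).loc i _ j
    by_cases hj : j = i
    · subst hj; rw [h.self, Function.update_self]; rfl
    · rw [h.other j hj, Function.update_of_ne hj]; rfl
  · funext j
    change (if (mem c' j).binaryCalled = true then some (alert (byzBound d n) (mem c' j)) else none) =
      if (mem c j).binaryCalled = true then some (alert (byzBound d n) (mem c j)) else none
    by_cases hj : j = i
    · subst hj; rw [h.self]; rfl
    · rw [h.other j hj]
  · rw [h.proj_log]
    change _ ++ List.map _ (unwrapOut (List.map (wrap V) _)) = _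
    rw [unwrapOut_map_wrap]
    rfl

/-- A message of the binary protocol that can be formed in the multivalued algorithm can be formed in
the binary protocol. -/
theorem feasible_binary {c : (multivaluedBA d V BBA).Config} {m : BBA.Msg}
    (h : (multivaluedBA d V BBA).Feasible c (Msg.binary m : Msg n V BBA.Msg)) :
    BBA.Feasible (proj c) m := by
  intro t ht
  rcases h (Token.binary t : Token n V BBA.Token) ⟨t, ht, rfl⟩ with ⟨p, hp, htp⟩ | ⟨j, hj, hs⟩
  · left
    have htp' : (Token.binary t : Token n V BBA.Token) ∈ msgTokens BBA.tokens (content p) := htp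
    cases hm : content p with
    | init j v => rw [hm] at htp'; cases htp'
    | converge j body =>
      rw [hm] at htp'
      cases body with
      | none => cases htp'
      | some qc =>
        rcases htp' with h' | ⟨k, -, h'⟩
        · cases h'
        · cases h'
    | binary m' =>
      rw [hm] at htp'
      obtain ⟨t', ht', h'⟩ := htp'
      cases h'
      refine ⟨⟨p.src, p.dst, m'⟩, ?_, ht'⟩
      exact List.mem_filterMap.2 ⟨p, hp, by simp [unwrap, hm, unwrapMsg]⟩
  · exact .inr ⟨j, hj, hs⟩

/-- The multivalued algorithm simulates the binary protocol step by step. -/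
theorem proj_step {f : ℕ} {c : (multivaluedBA d V BBA).Config} (hc : Inv c) (coin : BBA.Coin)
    (a : (multivaluedBA d V BBA).Action) :
    proj ((multivaluedBA d V BBA).step f c coin a) = BBA.step f (proj c) coin (projAction c a) := by
  classical
  have he := hc.evolves (f := f) coin a
  generalize hc' : (multivaluedBA d V BBA).step f c coin a = c' at he
  cases a with
  | idle => subst hc'; rfl
  | corrupt i =>
    subst hc'
    simp only [Protocol.step, projAction]
    change proj _ = if c.corrupted.card < f then _ else _
    split_ifs <;> rfl
  | start i v =>
    by_cases hcond : i ∉ c.corrupted ∧ c.proposal i = none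
    · obtain ⟨h, -, hd⟩ := step_start_pos f c coin v hcond
      rw [hc'] at h hd
      have hdel := proj_delivered_congr (c' := c') hc.delivered_lt he.log (by rw [hd]; tauto)
      have heff := onStart_effect (W := quorum d n) (B := byzBound d n) i (mem c i) v coin
      simp only [projAction]
      rw [if_pos hcond]
      unfold callAction
      by_cases hcall : CallsBinary (quorum d n) { mem c i with input := some v }
      · rw [if_pos hcall]
        exact h.proj_start (heff.1 hcall) hdel
      · rw [if_neg hcall]
        exact h.proj_idle hc he (heff.2 hcall) hdel
    · rw [← hc', step_start_neg f c coin v hcond]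
      simp only [projAction]
      rw [if_neg hcond]
      rfl
  | deliver k =>
    cases hk : c.log[k]? with
    | none =>
      rw [← hc', step_deliver_neg f c coin (by simp [hk])]
      simp only [projAction, hk]
      rfl
    | some p =>
      by_cases hcond : k ∉ c.delivered ∧ p.dst ∉ c.corrupted
      · obtain ⟨h, -, hd⟩ := step_deliver_pos f c coin hk hcond
        rw [hc'] at h hd
        have hdel : unwrapMsg (content p) = none → (proj c').delivered = (proj c).delivered := by
          intro hu
          refine proj_delivered_congr hc.delivered_lt he.log fun j => ?_
          rw [hd, Finset.mem_insert]
          constructor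
          · rintro (rfl | hj)
            · exact .inr ⟨.inl rfl, p, hk, by simp [unwrap, hu]⟩
            · exact .inl hj
          · rintro (hj | ⟨hj, -⟩)
            · exact .inr hj
            · exact hj
        simp only [projAction, hk]
        rw [if_pos hcond]
        rcases onReceive_effect (d := d) p.dst (mem c p.dst) p.src (content p) coin
          (fun _ => .deliver (filteredPos unwrap c.log k)) with ⟨h1, h2, h3⟩ | ⟨x, h1, h2, h3⟩ |
            ⟨m, h1, h2⟩
        · rw [h1]
          exact h.proj_idle hc he h3 (hdel h2)
        · rw [h1]
          exact h.proj_start h3 (hdel h2)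
        · rw [h2]
          rw [h1] at h
          have hq : unwrap p = some ⟨p.src, p.dst, m⟩ := by simp [unwrap, h1, unwrapMsg]
          have hget : (proj c).log[filteredPos unwrap c.log k]? = some ⟨p.src, p.dst, m⟩ :=
            getElem?_filteredPos hk hq
          have hcond' : filteredPos unwrap c.log k ∉ (proj c).delivered ∧
              p.dst ∉ (proj c).corrupted := by
            refine ⟨fun hmem => ?_, hcond.2⟩
            obtain ⟨j, hj, p', q', hp', hq', e⟩ := mem_proj_delivered.1 hmem
            obtain rfl := filteredPos_inj hp' hq' hk hq e
            exact hcond.1 hj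
          simp only [Protocol.step, hget]
          rw [if_pos hcond', ← h.proj_receive,
            proj_delivered_insert hc.delivered_lt he.log hk hq hd]
      · rw [← hc', step_deliver_neg f c coin (by rw [hk]; rintro _ ⟨⟩; exact hcond)]
        simp only [projAction, hk]
        rw [if_neg hcond]
        rfl
  | inject src dst m =>
    by_cases hcond : src ∈ c.corrupted ∧ dst ∉ c.corrupted ∧ (multivaluedBA d V BBA).Feasible c m
    · obtain ⟨h, -, hd⟩ := step_inject_pos f c coin hcond
      rw [hc'] at h hd
      have hdel := proj_delivered_congr (c' := c') hc.delivered_lt he.log (by rw [hd]; tauto)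
      simp only [projAction]
      rw [if_pos hcond]
      rcases onReceive_effect (d := d) dst (mem c dst) src m coin
        (fun m' => .inject src dst m') with ⟨h1, h2, h3⟩ | ⟨x, h1, h2, h3⟩ | ⟨m', h1, h2⟩
      · rw [h1]
        exact h.proj_idle hc he h3 hdel
      · rw [h1]
        exact h.proj_start h3 hdel
      · rw [h2]
        subst h1
        simp only [Protocol.step]
        have hcond' : src ∈ (proj c).corrupted ∧ dst ∉ (proj c).corrupted ∧
          BBA.Feasible (proj c) m' := ⟨hcond.1, hcond.2.1, feasible_binary hcond.2.2⟩
        rw [if_pos hcond', ← h.proj_receive, hdel]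
        rfl
    · rw [← hc', step_inject_neg f c coin hcond]
      simp only [projAction]
      rw [if_neg hcond]
      rfl

theorem proj_initial (s : (multivaluedBA d V BBA).Setup) :
    proj ((multivaluedBA d V BBA).initial s) = BBA.initial s.2 := by
  refine Config.ext' rfl ?_ rfl rfl ?_
  · funext j
    simp [proj, Protocol.initial, mem, multivaluedBA]
  · simp [proj, Protocol.initial]

end Projection

/-! ### The simulating adversary -/

section Shell

variable {n : ℕ} {d : ℝ} {V : Type} {BBA : Protocol n Bool Bool} {W B : ℕ}

/-- The state `s`, with another state of the binary protocol. -/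
def setBinary {S S' : Type} (s : State n V S) (z : S') : State n V S' := { s with binary := z }

/-- The results `r` and `r'` of two local steps agree, except for the state of the binary
protocol. -/
def SameResult (r r' : Result V BBA) : Prop :=
  (∃ z, r'.1 = setBinary r.1 z) ∧ r.2 = r'.2

theorem sendConverge_setBinary (i : Fin n) (s : State n V BBA.State) (z : BBA.State) :
    sendConverge BBA W i (setBinary s z) =
      (setBinary (sendConverge BBA W i s).1 z, (sendConverge BBA W i s).2) := by
  classical
  rw [sendConverge_eq, sendConverge_eq]
  by_cases h : SendsConverge W s
  · have h' : SendsConverge W (setBinary s z) := h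
    rw [if_pos h, if_pos h']
    rfl
  · have h' : ¬ SendsConverge W (setBinary s z) := h
    rw [if_neg h, if_neg h']

theorem sameResult_callBinary (i : Fin n) (s : State n V BBA.State) (z : BBA.State)
    (x x' : BBA.Coin)
    (hd : BBA.decision (callBinary BBA W B i x s).1.binary =
      BBA.decision (callBinary BBA W B i x' (setBinary s z)).1.binary)
    (ho : unwrapOut (callBinary BBA W B i x s).2 =
      unwrapOut (callBinary BBA W B i x' (setBinary s z)).2) :
    SameResult (callBinary BBA W B i x s) (callBinary BBA W B i x' (setBinary s z)) := by
  classical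
  rw [callBinary_eq, callBinary_eq] at hd ho ⊢
  by_cases h : CallsBinary W s
  · have h' : CallsBinary W (setBinary s z) := h
    rw [if_pos h, if_pos h'] at hd ho ⊢
    dsimp only at hd ho
    rw [unwrapOut_map_wrap, unwrapOut_map_wrap] at ho
    refine ⟨⟨(BBA.start i z (alert B (setBinary s z)) x').1, ?_⟩, ?_⟩
    · dsimp only
      rw [hd]
      rfl
    · dsimp only
      rw [ho]
  · have h' : ¬ CallsBinary W (setBinary s z) := h
    rw [if_neg h, if_neg h']
    exact ⟨⟨z, rfl⟩, rfl⟩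

theorem propose_setBinary (i : Fin n) (s : State n V BBA.State) (z : BBA.State) (v : V) :
    propose i (setBinary s z) v =
      (setBinary (propose i s v).1 z, (propose i s v).2) := by
  unfold propose
  by_cases h : s.sampled .init = true
  · have h' : (setBinary s z).sampled .init = true := h
    rw [if_pos h, if_pos h']
    rfl
  · have h' : ¬ (setBinary s z).sampled .init = true := h
    rw [if_neg h, if_neg h']
    rfl

theorem sameResult_onStart (i : Fin n) (s : State n V BBA.State) (z : BBA.State) (v : V)
    (x x' : BBA.Coin)
    (hd : BBA.decision (onStart BBA W B i s v x).1.binary =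
      BBA.decision (onStart BBA W B i (setBinary s z) v x').1.binary)
    (ho : unwrapOut (onStart BBA W B i s v x).2 =
      unwrapOut (onStart BBA W B i (setBinary s z) v x').2) :
    SameResult (onStart BBA W B i s v x) (onStart BBA W B i (setBinary s z) v x') := by
  rw [onStart_eq, onStart_eq, propose_setBinary] at hd ho ⊢
  dsimp only at hd ho ⊢
  rw [sendConverge_setBinary] at hd ho ⊢
  dsimp only at hd ho ⊢
  rw [unwrapOut_append, unwrapOut_append _ (callBinary BBA W B i x' _).2] at ho
  obtain ⟨⟨z', h1⟩, h2⟩ := sameResult_callBinary i _ z x x' hd (List.append_cancel_left ho)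
  exact ⟨⟨z', h1⟩, by dsimp only; rw [h2]⟩

theorem recordInit_setBinary (s : State n V BBA.State) (z : BBA.State) (j : Fin n) (v : V) :
    recordInit BBA W (setBinary s z) j v = setBinary (recordInit BBA W s j v) z := by
  unfold recordInit
  by_cases h : s.initSet.card < W
  · have h' : (setBinary s z).initSet.card < W := h
    rw [if_pos h, if_pos h']
    rfl
  · have h' : ¬ (setBinary s z).initSet.card < W := h
    rw [if_neg h, if_neg h']

theorem recordConverge_setBinary (s : State n V BBA.State) (z : BBA.State) (j : Fin n)
    (body : Option (QC n V)) : recordConverge BBA W (setBinary s z) j body =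
      setBinary (recordConverge BBA W s j body) z := by
  unfold recordConverge
  by_cases h : j ∉ s.convergeSet ∧ s.convergeSet.card < W
  · have h' : j ∉ (setBinary s z).convergeSet ∧ (setBinary s z).convergeSet.card < W := h
    rw [if_pos h, if_pos h']
    rfl
  · have h' : ¬ (j ∉ (setBinary s z).convergeSet ∧ (setBinary s z).convergeSet.card < W) := h
    rw [if_neg h, if_neg h']
    rfl

theorem sameResult_onReceive (i : Fin n) (s : State n V BBA.State) (z : BBA.State) (src : Fin n)
    (m : Msg n V BBA.Msg) (x x' : BBA.Coin)
    (hd : BBA.decision (onReceive BBA W B i s src m x).1.binary =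
      BBA.decision (onReceive BBA W B i (setBinary s z) src m x').1.binary)
    (ho : unwrapOut (onReceive BBA W B i s src m x).2 =
      unwrapOut (onReceive BBA W B i (setBinary s z) src m x').2) :
    SameResult (onReceive BBA W B i s src m x)
      (onReceive BBA W B i (setBinary s z) src m x') := by
  cases m with
  | init j v =>
    by_cases hj : j = src
    · subst hj
      simp only [onReceive, if_true, recordInit_setBinary, sendConverge_setBinary]
      exact ⟨⟨z, rfl⟩, rfl⟩
    · rw [(onReceive_ignored i _ src _).1 j v hj, (onReceive_ignored i _ src _).1 j v hj]
      exact ⟨⟨z, rfl⟩, rfl⟩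
  | converge j body =>
    by_cases hj : j = src ∧ ValidBody W body
    · simp only [onReceive, if_pos hj, recordConverge_setBinary] at hd ho ⊢
      exact sameResult_callBinary i _ z x x' hd ho
    · rw [(onReceive_ignored i _ src _).2 j body hj, (onReceive_ignored i _ src _).2 j body hj]
      exact ⟨⟨z, rfl⟩, rfl⟩
  | binary m =>
    change unwrapOut (List.map (wrap V) _) = unwrapOut (List.map (wrap V) _) at ho
    rw [unwrapOut_map_wrap, unwrapOut_map_wrap] at ho
    change BBA.decision (BBA.recv i s.binary src m x).1 =
      BBA.decision (BBA.recv i z src m x').1 at hd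
    refine ⟨⟨(BBA.recv i z src m x').1, ?_⟩, ?_⟩
    · simp only [onReceive]
      rw [hd]
      rfl
    · simp only [onReceive]
      rw [ho]

/-- The configurations `c` and `c'` agree, except for the states of the binary protocol. -/
structure SameShell (c c' : (multivaluedBA d V BBA).Config) : Prop where
  proposal : c'.proposal = c.proposal
  corrupted : c'.corrupted = c.corrupted
  log : c'.log = c.log
  delivered : c'.delivered = c.delivered
  mem : ∀ i, ∃ z, mem c' i = setBinary (mem c i) z

variable {c c' : (multivaluedBA d V BBA).Config}

theorem SameShell.mem_eq (h : SameShell c c') (hv : BBA.view (proj c') = BBA.view (proj c))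
    {i : Fin n} (hi : i ∈ c.corrupted) : MultivaluedBA.mem c' i = MultivaluedBA.mem c i := by
  have h1 := congrFun (congrArg View.memory hv) i
  have hi' : i ∈ c'.corrupted := by rw [h.corrupted]; exact hi
  change (if i ∈ c'.corrupted then some (MultivaluedBA.mem c' i).binary else none) =
    if i ∈ c.corrupted then some (MultivaluedBA.mem c i).binary else none at h1
  rw [if_pos hi, if_pos hi', Option.some.injEq] at h1
  obtain ⟨z, hz⟩ := h.mem i
  rw [hz] at h1 ⊢
  change z = _ at h1
  rw [h1]
  rfl

theorem SameShell.view_eq (h : SameShell c c') (hv : BBA.view (proj c') = BBA.view (proj c)) :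
    (multivaluedBA d V BBA).view c' = (multivaluedBA d V BBA).view c := by
  have hout : ∀ i, decide? (MultivaluedBA.mem c' i) = decide? (MultivaluedBA.mem c i) := by
    intro i
    obtain ⟨z, hz⟩ := h.mem i
    rw [hz]
    rfl
  have hmem : ∀ i, (if i ∈ c'.corrupted then some (MultivaluedBA.mem c' i) else none) =
      if i ∈ c.corrupted then some (MultivaluedBA.mem c i) else none := by
    intro i
    rw [h.corrupted]
    split_ifs with hi
    · rw [h.mem_eq hv hi]
    · rfl
  unfold Protocol.view
  rw [h.proposal, h.corrupted, h.log, h.delivered, View.mk.injEq]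
  refine ⟨rfl, rfl, rfl, rfl, funext hout, funext fun i => ?_⟩
  have := hmem i
  rw [h.corrupted] at this
  exact this

theorem SameShell.feasible_iff (h : SameShell c c') (hv : BBA.view (proj c') = BBA.view (proj c))
    (m : Msg n V BBA.Msg) : (multivaluedBA d V BBA).Feasible c' m ↔
      (multivaluedBA d V BBA).Feasible c m := by
  unfold Feasible
  rw [h.log, h.corrupted]
  have : ∀ t : Token n V BBA.Token,
      (∃ j ∈ c.corrupted, (multivaluedBA d V BBA).canSign j (c'.loc j) t) ↔
      ∃ j ∈ c.corrupted, (multivaluedBA d V BBA).canSign j (c.loc j) t := by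
    intro t
    refine exists_congr fun j => and_congr_right fun hj => ?_
    have := h.mem_eq hv hj
    unfold MultivaluedBA.mem at this
    rw [this]
  exact forall_congr' fun t => imp_congr_right fun _ => or_congr_right (this t)

theorem receiveAction_setBinary (i : Fin n) (s : State n V BBA.State) (z : BBA.State) (src : Fin n)
    (act : BBA.Msg → BBA.Action) (m : Msg n V BBA.Msg) :
    receiveAction d i (setBinary s z) src act m = receiveAction d i s src act m := by
  cases m with
  | init j v => rfl
  | converge j body =>
    simp only [receiveAction, recordConverge_setBinary]
    rfl
  | binary m => rfl

theorem SameShell.projAction_eq (h : SameShell c c')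
    (hv : BBA.view (proj c') = BBA.view (proj c)) (a : (multivaluedBA d V BBA).Action) :
    projAction c' a = projAction c a := by
  cases a with
  | start i v =>
    simp only [projAction, h.corrupted, h.proposal]
    obtain ⟨z, hz⟩ := h.mem i
    rw [hz]
    rfl
  | deliver k =>
    simp only [projAction, h.log, h.corrupted, h.delivered]
    cases c.log[k]? with
    | none => rfl
    | some p =>
      dsimp only
      obtain ⟨z, hz⟩ := h.mem p.dst
      rw [hz, receiveAction_setBinary]
  | corrupt i => rfl
  | inject src dst m =>
    have hf := h.feasible_iff hv m
    obtain ⟨z, hz⟩ := h.mem dst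
    have hcor := h.corrupted
    simp only [projAction]
    rw [hz]
    by_cases hcond : src ∈ c.corrupted ∧ dst ∉ c.corrupted ∧ (multivaluedBA d V BBA).Feasible c m
    · rw [if_pos hcond, if_pos (by rw [hcor]; exact ⟨hcond.1, hcond.2.1, hf.2 hcond.2.2⟩)]
      exact receiveAction_setBinary ..
    · rw [if_neg hcond, if_neg (by rw [hcor]; exact fun h' => hcond ⟨h'.1, h'.2.1, hf.1 h'.2.2⟩)]
  | idle => rfl

/-- Two corresponding local steps keep the shells equal if they agree as soon as the decisions and the
messages of the binary protocol agree; the latter can be read off from the views after the step. -/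
theorem SameShell.localStep {c₁ c₁' : (multivaluedBA d V BBA).Config} (h : SameShell c c')
    {i : Fin n} {r r' : Result V BBA} (hs : LocalStep c c₁ i r) (hs' : LocalStep c' c₁' i r')
    (hv : BBA.view (proj c₁') = BBA.view (proj c₁)) (hp : c₁'.proposal = c₁.proposal)
    (hd : c₁'.delivered = c₁.delivered)
    (hr : BBA.decision r.1.binary = BBA.decision r'.1.binary → unwrapOut r.2 = unwrapOut r'.2 →
      SameResult r r') : SameShell c₁ c₁' := by
  have h1 := congrFun (congrArg View.output hv) i
  change BBA.decision (MultivaluedBA.mem c₁' i).binary =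
    BBA.decision (MultivaluedBA.mem c₁ i).binary at h1
  rw [hs.self, hs'.self] at h1
  have h2 : (proj c₁').log = (proj c₁).log := congrArg View.log hv
  have h3 : (proj c').log = (proj c).log := by
    change c'.log.filterMap unwrap = c.log.filterMap unwrap
    rw [h.log]
  rw [hs.proj_log, hs'.proj_log, h3] at h2
  have h4 := List.append_cancel_left h2
  have hinj : Function.Injective fun q : Fin n × BBA.Msg => (⟨i, q.1, q.2⟩ : BBA.Packet) := by
    rintro ⟨a, b⟩ ⟨a', b'⟩ hab
    cases hab
    rfl
  obtain ⟨⟨z, hz⟩, hout⟩ := hr h1.symm (List.map_injective_iff.2 hinj h4).symm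
  refine ⟨hp, ?_, ?_, hd, fun j => ?_⟩
  · rw [hs.corrupted, hs'.corrupted, h.corrupted]
  · rw [hs.log, hs'.log, h.log, hout]
  · by_cases hj : j = i
    · subst hj
      rw [hs.self, hs'.self]
      exact ⟨z, hz⟩
    · rw [hs.other j hj, hs'.other j hj]
      exact h.mem j

/-- What the adversary does not know about the states of the binary protocol does not influence the
rest of the configuration. -/
theorem SameShell.step {f : ℕ} (h : SameShell c c')
    (hv : BBA.view (proj c') = BBA.view (proj c)) (x x' : BBA.Coin)
    (a : (multivaluedBA d V BBA).Action)
    (hv' : BBA.view (proj ((multivaluedBA d V BBA).step f c' x' a)) =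
      BBA.view (proj ((multivaluedBA d V BBA).step f c x a))) :
    SameShell ((multivaluedBA d V BBA).step f c x a) ((multivaluedBA d V BBA).step f c' x' a) := by
  classical
  cases a with
  | start i v =>
    by_cases hcond : i ∉ c.corrupted ∧ c.proposal i = none
    · have hcond' : i ∉ c'.corrupted ∧ c'.proposal i = none := by
        rw [h.corrupted, h.proposal]; exact hcond
      obtain ⟨s1, s2, s3⟩ := step_start_pos f c x v hcond
      obtain ⟨s1', s2', s3'⟩ := step_start_pos f c' x' v hcond'
      obtain ⟨z, hz⟩ := h.mem i
      rw [hz] at s1'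
      exact h.localStep s1 s1' hv' (by rw [s2, s2', h.proposal]) (by rw [s3, s3', h.delivered])
        (sameResult_onStart i _ z v x x')
    · have hcond' : ¬ (i ∉ c'.corrupted ∧ c'.proposal i = none) := by
        rw [h.corrupted, h.proposal]; exact hcond
      rw [step_start_neg f c x v hcond, step_start_neg f c' x' v hcond']
      exact h
  | deliver k =>
    by_cases hcond : ∃ p, c.log[k]? = some p ∧ k ∉ c.delivered ∧ p.dst ∉ c.corrupted
    · obtain ⟨p, hk, hcond⟩ := hcond
      have hcond' : k ∉ c'.delivered ∧ p.dst ∉ c'.corrupted := by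
        rw [h.corrupted, h.delivered]; exact hcond
      obtain ⟨s1, s2, s3⟩ := step_deliver_pos f c x hk hcond
      obtain ⟨s1', s2', s3'⟩ := step_deliver_pos f c' x' (by rw [h.log]; exact hk) hcond'
      obtain ⟨z, hz⟩ := h.mem p.dst
      rw [hz] at s1'
      exact h.localStep s1 s1' hv' (by rw [s2, s2', h.proposal]) (by rw [s3, s3', h.delivered])
        (sameResult_onReceive _ _ z _ _ x x')
    · rw [step_deliver_neg f c x fun p hk hp => hcond ⟨p, hk, hp⟩,
        step_deliver_neg f c' x' (by
          rw [h.log, h.corrupted, h.delivered]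
          exact fun p hk hp => hcond ⟨p, hk, hp⟩)]
      exact h
  | corrupt i =>
    simp only [Protocol.step]
    rw [h.corrupted]
    split_ifs
    · exact ⟨h.proposal, rfl, h.log, h.delivered, h.mem⟩
    · exact h
  | inject src dst m =>
    by_cases hcond : src ∈ c.corrupted ∧ dst ∉ c.corrupted ∧ (multivaluedBA d V BBA).Feasible c m
    · have hcond' : src ∈ c'.corrupted ∧ dst ∉ c'.corrupted ∧
          (multivaluedBA d V BBA).Feasible c' m := by
        rw [h.corrupted]; exact ⟨hcond.1, hcond.2.1, (h.feasible_iff hv m).2 hcond.2.2⟩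
      obtain ⟨s1, s2, s3⟩ := step_inject_pos f c x hcond
      obtain ⟨s1', s2', s3'⟩ := step_inject_pos f c' x' hcond'
      obtain ⟨z, hz⟩ := h.mem dst
      rw [hz] at s1'
      exact h.localStep s1 s1' hv' (by rw [s2, s2', h.proposal]) (by rw [s3, s3', h.delivered])
        (sameResult_onReceive _ _ z _ _ x x')
    · have hcond' : ¬ (src ∈ c'.corrupted ∧ dst ∉ c'.corrupted ∧
          (multivaluedBA d V BBA).Feasible c' m) := by
        rw [h.corrupted, h.feasible_iff hv m]; exact hcond
      rw [step_inject_neg f c x hcond, step_inject_neg f c' x' hcond']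
      exact h
  | idle => exact h

end Shell

section Simulation

variable {n : ℕ} {d : ℝ} {V : Type} {BBA : Protocol n Bool Bool} (f : ℕ)
  (adv : (multivaluedBA d V BBA).Adversary) (b : Committees n)

/-- The run of the multivalued algorithm with the committees `b`, and the views of the adversary
before time `t`. -/
noncomputable def fixedRun (ω : BBA.Outcome) (t : ℕ) :
    (multivaluedBA d V BBA).Config × List (multivaluedBA d V BBA).View :=
  (multivaluedBA d V BBA).runAux f adv (joinOutcome d V b ω) t

/-- The views of the adversary up to time `t`. -/
noncomputable def history (ω : BBA.Outcome) (t : ℕ) : List (multivaluedBA d V BBA).View :=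
  (fixedRun f adv b ω t).2 ++ [(multivaluedBA d V BBA).view (fixedRun f adv b ω t).1]

/-- The views that an adversary against the binary protocol has had up to time `t`. -/
noncomputable def projHistory (ω : BBA.Outcome) (t : ℕ) : List BBA.View :=
  (List.range (t + 1)).map fun s => BBA.view (proj (fixedRun f adv b ω s).1)

open Classical in
/-- The adversary against the binary protocol that simulates the multivalued algorithm with the
committees `b` and the adversary `adv`. Instead of keeping track of the simulated configuration, it
picks any outcome that is consistent with its own views. -/
noncomputable def simulator : BBA.Adversary := fun h =>
  if H : ∃ ω, projHistory f adv b ω (h.length - 1) = h then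
    projAction (fixedRun f adv b H.choose (h.length - 1)).1
      (adv (history f adv b H.choose (h.length - 1)))
  else .idle

theorem fixedRun_succ (ω : BBA.Outcome) (t : ℕ) : fixedRun f adv b ω (t + 1) =
    ((multivaluedBA d V BBA).step f (fixedRun f adv b ω t).1 (ω.2 t) (adv (history f adv b ω t)),
      history f adv b ω t) := rfl

theorem inv_fixedRun (ω : BBA.Outcome) (t : ℕ) : Inv (fixedRun f adv b ω t).1 :=
  inv_run f adv _ t

theorem projHistory_succ (ω : BBA.Outcome) (t : ℕ) : projHistory f adv b ω (t + 1) =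
    projHistory f adv b ω t ++ [BBA.view (proj (fixedRun f adv b ω (t + 1)).1)] := by
  unfold projHistory
  rw [List.range_succ, List.map_append]
  rfl

/-- What an adversary against the binary protocol has seen determines everything that the adversary
against the multivalued algorithm has seen. -/
theorem sameShell_of_projHistory_eq {ω ω' : BBA.Outcome} {t : ℕ}
    (h : projHistory f adv b ω' t = projHistory f adv b ω t) :
    SameShell (fixedRun f adv b ω t).1 (fixedRun f adv b ω' t).1 ∧
      BBA.view (proj (fixedRun f adv b ω' t).1) = BBA.view (proj (fixedRun f adv b ω t).1) ∧
      history f adv b ω' t = history f adv b ω t := by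
  induction t with
  | zero =>
    have hs : SameShell (fixedRun f adv b ω 0).1 (fixedRun f adv b ω' 0).1 :=
      ⟨rfl, rfl, rfl, rfl, fun i => ⟨BBA.init i ω'.1, rfl⟩⟩
    have hv : BBA.view (proj (fixedRun f adv b ω' 0).1) =
        BBA.view (proj (fixedRun f adv b ω 0).1) := by simpa [projHistory] using h
    refine ⟨hs, hv, ?_⟩
    unfold history
    rw [hs.view_eq hv]
    rfl
  | succ t ih =>
    rw [projHistory_succ, projHistory_succ] at h
    obtain ⟨h1, h2⟩ := List.append_inj' h rfl
    obtain ⟨hs, hv, hh⟩ := ih h1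
    have hv' : BBA.view (proj (fixedRun f adv b ω' (t + 1)).1) =
        BBA.view (proj (fixedRun f adv b ω (t + 1)).1) := by simpa using h2
    have hs' : SameShell (fixedRun f adv b ω (t + 1)).1 (fixedRun f adv b ω' (t + 1)).1 := by
      rw [fixedRun_succ, fixedRun_succ, hh] at hv' ⊢
      exact hs.step hv _ _ _ hv'
    refine ⟨hs', hv', ?_⟩
    unfold history
    rw [hs'.view_eq hv', fixedRun_succ, fixedRun_succ, hh]

/-- The choice of a consistent outcome in `simulator` does not matter. -/
theorem simulator_projHistory (ω : BBA.Outcome) (t : ℕ) :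
    simulator f adv b (projHistory f adv b ω t) =
      projAction (fixedRun f adv b ω t).1 (adv (history f adv b ω t)) := by
  have hlen : (projHistory f adv b ω t).length - 1 = t := by simp [projHistory]
  unfold simulator
  have H : ∃ ω', projHistory f adv b ω' ((projHistory f adv b ω t).length - 1) =
      projHistory f adv b ω t := ⟨ω, by rw [hlen]⟩
  rw [dif_pos H]
  have hch := H.choose_spec
  generalize H.choose = ω' at hch
  rw [hlen] at hch ⊢
  obtain ⟨hs, hv, hh⟩ := sameShell_of_projHistory_eq f adv b hch
  rw [hh, hs.projAction_eq hv]

theorem runAux_simulator (ω : BBA.Outcome) (t : ℕ) :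
    BBA.runAux f (simulator f adv b) ω t = (proj (fixedRun f adv b ω t).1,
      (List.range t).map fun s => BBA.view (proj (fixedRun f adv b ω s).1)) := by
  induction t with
  | zero =>
    have : proj (fixedRun f adv b ω 0).1 = BBA.initial ω.1 := proj_initial _
    rw [this]
    rfl
  | succ t ih =>
    simp only [Protocol.runAux, ih]
    have e : (List.range t).map (fun s => BBA.view (proj (fixedRun f adv b ω s).1)) ++
        [BBA.view (proj (fixedRun f adv b ω t).1)] = projHistory f adv b ω t := by
      unfold projHistory
      rw [List.range_succ, List.map_append]
      rfl
    rw [e, simulator_projHistory, fixedRun_succ, proj_step (inv_fixedRun f adv b ω t)]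
    rfl

/-- Inside every run of the multivalued algorithm there is a run of the binary protocol against an
adversary that does not depend on the coins. -/
theorem run_simulator (ω : BBA.Outcome) (t : ℕ) : BBA.run f (simulator f adv b) ω t =
    proj ((multivaluedBA d V BBA).run f adv (joinOutcome d V b ω) t) := by
  unfold Protocol.run
  rw [runAux_simulator]
  rfl

end Simulation

/-! ### Membership of a committee is secret until it is revealed -/

section Secret

variable {n : ℕ} {d : ℝ} {V : Type} {BBA : Protocol n Bool Bool} {W B : ℕ}

/-- From this moment on, it is known whether the process is a member of the committee `r`. -/
def Revealed {S : Type} (W : ℕ) (r : Role) (s : State n V S) : Prop :=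
  match r with
  | .init => s.input.isSome = true
  | .converge => InitDone W s

theorem Grows.revealed {S : Type} {s s' : State n V S} (h : Grows W s s') {r : Role}
    (hr : Revealed W r s) : Revealed W r s' := by
  cases r with
  | init =>
    obtain ⟨v, hv⟩ := Option.isSome_iff_exists.1 hr
    exact Option.isSome_iff_exists.2 ⟨v, h.input v hv⟩
  | converge => exact h.initDone hr

/-- The state `s`, with another membership of the committee `r`. -/
def setSampled {S : Type} (s : State n V S) (r : Role) (x : Bool) : State n V S :=
  { s with sampled := Function.update s.sampled r x }

/-- The result of a local step, with another membership of the committee `r`. -/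
def setSampledResult (r : Role) (x : Bool) (q : Result V BBA) : Result V BBA :=
  (setSampled q.1 r x, q.2)

theorem sendConverge_setSampled (i : Fin n) (s : State n V BBA.State) (r : Role) (x : Bool)
    (h : r = .init ∨ ¬ InitDone W s) : sendConverge BBA W i (setSampled s r x) =
      setSampledResult r x (sendConverge BBA W i s) := by
  classical
  rw [sendConverge_eq, sendConverge_eq]
  have hiff : SendsConverge W (setSampled s r x) ↔ SendsConverge W s := by
    rcases h with rfl | h
    · unfold SendsConverge setSampled
      dsimp only
      rw [Function.update_of_ne (by decide)]
      rfl
    · exact ⟨fun h' => absurd h'.2.2 h, fun h' => absurd h'.2.2 h⟩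
  by_cases hc : SendsConverge W s
  · rw [if_pos hc, if_pos (hiff.2 hc)]
    rfl
  · rw [if_neg hc, if_neg (fun h' => hc (hiff.1 h'))]
    rfl

theorem callBinary_setSampled (i : Fin n) (coin : BBA.Coin) (s : State n V BBA.State) (r : Role)
    (x : Bool) : callBinary BBA W B i coin (setSampled s r x) =
      setSampledResult r x (callBinary BBA W B i coin s) := by
  classical
  rw [callBinary_eq, callBinary_eq]
  by_cases h : CallsBinary W s
  · have h' : CallsBinary W (setSampled s r x) := h
    rw [if_pos h, if_pos h']
    rfl
  · have h' : ¬ CallsBinary W (setSampled s r x) := h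
    rw [if_neg h, if_neg h']
    rfl

theorem onStart_setSampled (i : Fin n) (s : State n V BBA.State) (v : V) (coin : BBA.Coin)
    (r : Role) (x : Bool) (h : ¬ Revealed W r (onStart BBA W B i s v coin).1) :
    onStart BBA W B i (setSampled s r x) v coin =
      setSampledResult r x (onStart BBA W B i s v coin) := by
  cases r with
  | init =>
    obtain ⟨y, x, a, b, z, e⟩ := onStart_fst (W := W) (B := B) i s v coin
    rw [e] at h
    exact absurd rfl h
  | converge =>
    have hp : propose i (setSampled s .converge x) v =
        setSampledResult .converge x (propose i s v) := by
      have e : (setSampled s .converge x).sampled .init = s.sampled .init := by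
        unfold setSampled
        exact Function.update_of_ne (show Role.init ≠ Role.converge by decide) x _
      unfold propose
      rw [e]
      split_ifs <;> rfl
    have hd : ¬ InitDone W (propose i s v).1 := by
      obtain ⟨y, hy⟩ := propose_fst i s v
      obtain ⟨y', x, a, b, z, e⟩ := onStart_fst (W := W) (B := B) i s v coin
      rw [e] at h
      rw [hy]
      exact h
    rw [onStart_eq, onStart_eq, hp]
    simp only [setSampledResult]
    rw [sendConverge_setSampled i _ _ _ (.inr hd)]
    simp only [setSampledResult]
    rw [callBinary_setSampled]
    rfl

theorem onReceive_setSampled (i : Fin n) (s : State n V BBA.State) (src : Fin n)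
    (m : Msg n V BBA.Msg) (coin : BBA.Coin) (r : Role) (x : Bool)
    (h : ¬ Revealed W r (onReceive BBA W B i s src m coin).1) :
    onReceive BBA W B i (setSampled s r x) src m coin =
      setSampledResult r x (onReceive BBA W B i s src m coin) := by
  cases m with
  | init j v =>
    by_cases hj : j = src
    · subst hj
      have e : ∀ s, onReceive BBA W B i s j (.init j v) coin =
        sendConverge BBA W i (recordInit BBA W s j v) := fun s => by simp [onReceive]
      have hrec : recordInit BBA W (setSampled s r x) j v = setSampled (recordInit BBA W s j v) r x := by
        unfold recordInit
        by_cases hc : s.initSet.card < W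
        · have hc' : (setSampled s r x).initSet.card < W := hc
          rw [if_pos hc, if_pos hc']
          rfl
        · have hc' : ¬ (setSampled s r x).initSet.card < W := hc
          rw [if_neg hc, if_neg hc']
      rw [e] at h
      rw [e, e, hrec]
      refine sendConverge_setSampled i _ _ _ ?_
      cases r with
      | init => exact .inl rfl
      | converge =>
        refine .inr fun hd => h ?_
        exact (grows_sendConverge i _).initDone hd
    · rw [(onReceive_ignored i _ src _).1 j v hj, (onReceive_ignored i _ src _).1 j v hj]
      rfl
  | converge j body =>
    by_cases hj : j = src ∧ ValidBody W body
    · have hrec : recordConverge BBA W (setSampled s r x) j body =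
          setSampled (recordConverge BBA W s j body) r x := by
        unfold recordConverge
        by_cases hc : j ∉ s.convergeSet ∧ s.convergeSet.card < W
        · have hc' : j ∉ (setSampled s r x).convergeSet ∧
            (setSampled s r x).convergeSet.card < W := hc
          rw [if_pos hc, if_pos hc']
          rfl
        · have hc' : ¬ (j ∉ (setSampled s r x).convergeSet ∧
            (setSampled s r x).convergeSet.card < W) := hc
          rw [if_neg hc, if_neg hc']
          rfl
      simp only [onReceive, if_pos hj]
      rw [hrec, callBinary_setSampled]
    · rw [(onReceive_ignored i _ src _).2 j body hj, (onReceive_ignored i _ src _).2 j body hj]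
      rfl
  | binary m => rfl

/-- The configurations `c` and `c'` agree, except that `x` replaces the membership of process `i` in
the committee `r`. -/
structure DiffersAt (i : Fin n) (r : Role) (x : Bool) (c c' : (multivaluedBA d V BBA).Config) :
    Prop where
  proposal : c'.proposal = c.proposal
  corrupted : c'.corrupted = c.corrupted
  log : c'.log = c.log
  delivered : c'.delivered = c.delivered
  self : mem c' i = setSampled (mem c i) r x
  other : ∀ j, j ≠ i → mem c' j = mem c j

variable {i : Fin n} {r : Role} {x : Bool} {c c' : (multivaluedBA d V BBA).Config}

theorem DiffersAt.view_eq (h : DiffersAt i r x c c') (hi : i ∉ c.corrupted) :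
    (multivaluedBA d V BBA).view c' = (multivaluedBA d V BBA).view c := by
  have hout : ∀ j, decide? (mem c' j) = decide? (mem c j) := by
    intro j
    by_cases hj : j = i
    · subst hj; rw [h.self]; rfl
    · rw [h.other j hj]
  have hmem : ∀ j, (if j ∈ c.corrupted then some (mem c' j) else none) =
      if j ∈ c.corrupted then some (mem c j) else none := by
    intro j
    split_ifs with hj
    · rw [h.other j (by rintro rfl; exact hi hj)]
    · rfl
  unfold Protocol.view
  rw [h.proposal, h.corrupted, h.log, h.delivered, View.mk.injEq]
  exact ⟨rfl, rfl, rfl, rfl, funext hout, funext hmem⟩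

theorem DiffersAt.feasible_iff (h : DiffersAt i r x c c') (hi : i ∉ c.corrupted)
    (m : Msg n V BBA.Msg) :
    (multivaluedBA d V BBA).Feasible c' m ↔ (multivaluedBA d V BBA).Feasible c m := by
  unfold Feasible
  rw [h.log, h.corrupted]
  have : ∀ t : Token n V BBA.Token,
      (∃ j ∈ c.corrupted, (multivaluedBA d V BBA).canSign j (c'.loc j) t) ↔
      ∃ j ∈ c.corrupted, (multivaluedBA d V BBA).canSign j (c.loc j) t := by
    intro t
    refine exists_congr fun j => and_congr_right fun hj => ?_
    have := h.other j (by rintro rfl; exact hi hj)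
    unfold MultivaluedBA.mem at this
    rw [this]
  exact forall_congr' fun t => imp_congr_right fun _ => or_congr_right (this t)

theorem DiffersAt.localStep {c₁ c₁' : (multivaluedBA d V BBA).Config} (h : DiffersAt i r x c c')
    {j : Fin n} {step : State n V BBA.State → Result V BBA}
    (hs : LocalStep c c₁ j (step (mem c j))) (hs' : LocalStep c' c₁' j (step (mem c' j)))
    (hp : c₁'.proposal = c₁.proposal) (hd : c₁'.delivered = c₁.delivered)
    (hr : i = j → step (setSampled (mem c i) r x) = setSampledResult r x (step (mem c i))) :
    DiffersAt i r x c₁ c₁' := by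
  have hout : (step (mem c' j)).2 = (step (mem c j)).2 := by
    by_cases hj : j = i
    · subst hj; rw [h.self, hr rfl]; rfl
    · rw [h.other j hj]
  refine ⟨hp, ?_, ?_, hd, ?_, fun k hk => ?_⟩
  · rw [hs.corrupted, hs'.corrupted, h.corrupted]
  · rw [hs.log, hs'.log, h.log, hout]
  · by_cases hj : i = j
    · rw [← hj] at hs hs'
      rw [hs.self, hs'.self, h.self, hr hj]
      rfl
    · rw [hs.other i hj, hs'.other i hj, h.self]
  · by_cases hj : k = j
    · subst hj
      rw [hs.self, hs'.self, h.other k hk]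
    · rw [hs.other k hj, hs'.other k hj, h.other k hk]

/-- A step in which the membership is not revealed does not depend on it. -/
theorem DiffersAt.step {f : ℕ} (h : DiffersAt i r x c c') (hi : i ∉ c.corrupted)
    (coin : BBA.Coin) (a : (multivaluedBA d V BBA).Action)
    (hr : ¬ Revealed (quorum d n) r (mem ((multivaluedBA d V BBA).step f c coin a) i)) :
    DiffersAt i r x ((multivaluedBA d V BBA).step f c coin a)
      ((multivaluedBA d V BBA).step f c' coin a) := by
  classical
  cases a with
  | start j v =>
    by_cases hcond : j ∉ c.corrupted ∧ c.proposal j = none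
    · have hcond' : j ∉ c'.corrupted ∧ c'.proposal j = none := by
        rw [h.corrupted, h.proposal]; exact hcond
      obtain ⟨s1, s2, s3⟩ := step_start_pos f c coin v hcond
      obtain ⟨s1', s2', s3'⟩ := step_start_pos f c' coin v hcond'
      refine h.localStep (step := fun s => onStart BBA _ _ j s v coin) s1 s1'
        (by rw [s2, s2', h.proposal]) (by rw [s3, s3', h.delivered]) ?_
      rintro rfl
      rw [s1.self] at hr
      exact onStart_setSampled i _ v coin r x hr
    · have hcond' : ¬ (j ∉ c'.corrupted ∧ c'.proposal j = none) := by
        rw [h.corrupted, h.proposal]; exact hcond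
      rw [step_start_neg f c coin v hcond, step_start_neg f c' coin v hcond']
      exact h
  | deliver k =>
    by_cases hcond : ∃ p, c.log[k]? = some p ∧ k ∉ c.delivered ∧ p.dst ∉ c.corrupted
    · obtain ⟨p, hk, hcond⟩ := hcond
      have hcond' : k ∉ c'.delivered ∧ p.dst ∉ c'.corrupted := by
        rw [h.corrupted, h.delivered]; exact hcond
      obtain ⟨s1, s2, s3⟩ := step_deliver_pos f c coin hk hcond
      obtain ⟨s1', s2', s3'⟩ := step_deliver_pos f c' coin (by rw [h.log]; exact hk) hcond'
      refine h.localStep (step := fun s => onReceive BBA _ _ p.dst s p.src (content p) coin) s1 s1'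
        (by rw [s2, s2', h.proposal]) (by rw [s3, s3', h.delivered]) ?_
      intro hj
      rw [← hj] at s1 ⊢
      rw [s1.self] at hr
      exact onReceive_setSampled i _ _ _ coin r x hr
    · rw [step_deliver_neg f c coin fun p hk hp => hcond ⟨p, hk, hp⟩,
        step_deliver_neg f c' coin (by
          rw [h.log, h.corrupted, h.delivered]
          exact fun p hk hp => hcond ⟨p, hk, hp⟩)]
      exact h
  | corrupt j =>
    simp only [Protocol.step]
    rw [h.corrupted]
    split_ifs
    · exact ⟨h.proposal, rfl, h.log, h.delivered, h.self, h.other⟩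
    · exact h
  | inject src dst m =>
    by_cases hcond : src ∈ c.corrupted ∧ dst ∉ c.corrupted ∧ (multivaluedBA d V BBA).Feasible c m
    · have hcond' : src ∈ c'.corrupted ∧ dst ∉ c'.corrupted ∧
          (multivaluedBA d V BBA).Feasible c' m := by
        rw [h.corrupted]; exact ⟨hcond.1, hcond.2.1, (h.feasible_iff hi m).2 hcond.2.2⟩
      obtain ⟨s1, s2, s3⟩ := step_inject_pos f c coin hcond
      obtain ⟨s1', s2', s3'⟩ := step_inject_pos f c' coin hcond'
      refine h.localStep (step := fun s => onReceive BBA _ _ dst s src m coin) s1 s1'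
        (by rw [s2, s2', h.proposal]) (by rw [s3, s3', h.delivered]) ?_
      rintro rfl
      rw [s1.self] at hr
      exact onReceive_setSampled i _ _ _ coin r x hr
    · have hcond' : ¬ (src ∈ c'.corrupted ∧ dst ∉ c'.corrupted ∧
          (multivaluedBA d V BBA).Feasible c' m) := by
        rw [h.corrupted, h.feasible_iff hi m]; exact hcond
      rw [step_inject_neg f c coin hcond, step_inject_neg f c' coin hcond']
      exact h
  | idle => exact h

/-- The run does not depend on a membership as long as it is not revealed. -/
theorem differsAt_fixedRun (f : ℕ) (adv : (multivaluedBA d V BBA).Adversary) (b : Committees n)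
    (ω : BBA.Outcome) (x : Bool) (t : ℕ) (hi : i ∉ (fixedRun f adv b ω t).1.corrupted)
    (hr : ¬ Revealed (quorum d n) r (mem (fixedRun f adv b ω t).1 i)) :
    DiffersAt i r x (fixedRun f adv b ω t).1
        (fixedRun f adv (Function.update b (i, r) x) ω t).1 ∧
      history f adv (Function.update b (i, r) x) ω t = history f adv b ω t := by
  induction t with
  | zero =>
    have h : DiffersAt i r x (fixedRun f adv b ω 0).1
        (fixedRun f adv (Function.update b (i, r) x) ω 0).1 := by
      refine ⟨rfl, rfl, rfl, rfl, ?_, fun j hj => ?_⟩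
      · have : (fun r' => Function.update b (i, r) x (i, r')) =
            Function.update (fun r' => b (i, r')) r x := by
          funext r'
          by_cases h : r' = r
          · subst h; simp
          · rw [Function.update_of_ne h, Function.update_of_ne (by simpa using h)]
        change State.mk (n := n) (V := V) (fun r' => Function.update b (i, r) x (i, r'))
          _ _ _ _ _ _ _ _ _ _ _ = _
        rw [this]
        rfl
      · have : (fun r' => Function.update b (i, r) x (j, r')) = fun r' => b (j, r') := by
          funext r'
          rw [Function.update_of_ne (by simp [hj])]
        change State.mk (n := n) (V := V) (fun r' => Function.update b (i, r) x (j, r'))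
          _ _ _ _ _ _ _ _ _ _ _ = _
        rw [this]
        rfl
    refine ⟨h, ?_⟩
    unfold history
    rw [h.view_eq hi]
    rfl
  | succ t ih =>
    have he : Evolves (fixedRun f adv b ω t).1 (fixedRun f adv b ω (t + 1)).1 :=
      (inv_fixedRun f adv b ω t).evolves _ _
    have hi' : i ∉ (fixedRun f adv b ω t).1.corrupted := fun h => hi (he.corrupted h)
    obtain ⟨h1, h2⟩ := ih hi' fun h => hr ((he.mem i).revealed h)
    have h : DiffersAt i r x (fixedRun f adv b ω (t + 1)).1
        (fixedRun f adv (Function.update b (i, r) x) ω (t + 1)).1 := by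
      rw [fixedRun_succ, fixedRun_succ, h2]
      rw [fixedRun_succ] at hr
      exact h1.step hi' _ _ hr
    refine ⟨h, ?_⟩
    unfold history
    rw [h.view_eq hi, fixedRun_succ, fixedRun_succ, h2]

open Classical in
/-- The processes that were corrupted before their membership of the committee `r` was revealed. -/
noncomputable def early (r : Role) (c : (multivaluedBA d V BBA).Config) : Finset (Fin n) :=
  c.corrupted.filter fun i => ¬ Revealed (quorum d n) r (mem c i)

theorem mem_early {r : Role} {c : (multivaluedBA d V BBA).Config} {i : Fin n} :
    i ∈ early r c ↔ i ∈ c.corrupted ∧ ¬ Revealed (quorum d n) r (mem c i) := by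
  classical
  simp [early]

theorem Evolves.early_subset (h : Evolves c c') (r : Role) : early r c ⊆ early r c' := by
  intro i hi
  rw [mem_early] at hi ⊢
  exact ⟨h.corrupted hi.1, by rw [h.frozen i hi.1]; exact hi.2⟩

theorem DiffersAt.early_eq (h : DiffersAt i r x c c') (r' : Role) : early r' c' = early r' c := by
  ext j
  rw [mem_early, mem_early, h.corrupted]
  by_cases hj : j = i
  · subst hj
    rw [h.self]
    cases r' <;> rfl
  · rw [h.other j hj]

/-- In each step at most one process is corrupted early, and a process corrupted early stays so,
since its memory is frozen. -/
theorem early_step (f : ℕ) (coin : BBA.Coin) (a : (multivaluedBA d V BBA).Action) (r : Role) :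
    early r ((multivaluedBA d V BBA).step f c coin a) = early r c ∨
      ∃ i ∉ early r c, early r ((multivaluedBA d V BBA).step f c coin a) = insert i (early r c) := by
  classical
  generalize hc' : (multivaluedBA d V BBA).step f c coin a = c'
  have hlocal : ∀ {j q}, LocalStep c c' j q → early r c' = early r c := by
    intro j q h
    ext k
    rw [mem_early, mem_early, h.corrupted]
    refine and_congr_right fun hk => ?_
    rw [h.other k (by rintro rfl; exact h.notMem hk)]
  rcases step_cases f c coin a c' hc' with h | ⟨i, -, -, h⟩ | ⟨i, v, -, -, h, -⟩ |
    ⟨k, p, -, -, -, h, -⟩ | ⟨src, dst, m, -, -, -, h, -⟩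
  · rw [h]; exact .inl rfl
  · subst h
    by_cases hi : i ∉ c.corrupted ∧ ¬ Revealed (quorum d n) r (mem c i)
    · refine .inr ⟨i, fun h => hi.1 (mem_early.1 h).1, ?_⟩
      ext k
      rw [Finset.mem_insert, mem_early, mem_early]
      change k ∈ insert i c.corrupted ∧ _ ↔ _
      rw [Finset.mem_insert]
      change _ ∧ ¬ Revealed (quorum d n) r (mem c k) ↔ _
      constructor
      · tauto
      · rintro (rfl | h)
        · exact ⟨.inl rfl, hi.2⟩
        · exact ⟨.inr h.1, h.2⟩
    · left
      ext k
      rw [mem_early, mem_early]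
      change k ∈ insert i c.corrupted ∧ _ ↔ _
      rw [Finset.mem_insert]
      change _ ∧ ¬ Revealed (quorum d n) r (mem c k) ↔ _
      constructor
      · rintro ⟨rfl | h1, h2⟩
        · exact ⟨by tauto, h2⟩
        · exact ⟨h1, h2⟩
      · exact fun h => ⟨.inr h.1, h.2⟩
  · exact .inl (hlocal h)
  · exact .inl (hlocal h)
  · exact .inl (hlocal h)

theorem card_corrupted_le (f : ℕ) (adv : (multivaluedBA d V BBA).Adversary)
    (ω : (multivaluedBA d V BBA).Outcome) (t : ℕ) :
    ((multivaluedBA d V BBA).run f adv ω t).corrupted.card ≤ f := by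
  classical
  induction t with
  | zero => exact Nat.zero_le _
  | succ t ih =>
    rw [run_succ]
    generalize (multivaluedBA d V BBA).run f adv ω t = c at ih
    generalize hc' : (multivaluedBA d V BBA).step f c _ _ = c'
    rcases step_cases f c _ _ c' hc' with h | ⟨i, -, hf, h⟩ | ⟨i, v, -, -, h, -⟩ |
      ⟨k, p, -, -, -, h, -⟩ | ⟨src, dst, m, -, -, -, h, -⟩
    · rw [h]; exact ih
    · rw [h]; exact (Finset.card_insert_le _ _).trans hf
    · rw [h.corrupted]; exact ih
    · rw [h.corrupted]; exact ih
    · rw [h.corrupted]; exact ih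

theorem sampled_run (f : ℕ) (adv : (multivaluedBA d V BBA).Adversary) (b : Committees n)
    (ω : BBA.Outcome) (t : ℕ) (i : Fin n) (r : Role) :
    (mem ((multivaluedBA d V BBA).run f adv (joinOutcome d V b ω) t) i).sampled r = b (i, r) := by
  rw [((evolves_run f adv (joinOutcome d V b ω) (Nat.zero_le t)).mem i).sampled]
  rfl

/-- The processes that were corrupted before their membership was revealed, as indices of the bits
of `Committees n`. -/
noncomputable def earlyBits (f : ℕ) (adv : (multivaluedBA d V BBA).Adversary) (ω : BBA.Outcome)
    (r : Role) (t : ℕ) (b : Committees n) : Finset (Fin n × Role) :=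
  (early r (fixedRun f adv b ω t).1).map ⟨fun i => (i, r), fun _ _ h => congrArg Prod.fst h⟩

theorem mem_earlyBits {f : ℕ} {adv : (multivaluedBA d V BBA).Adversary} {ω : BBA.Outcome}
    {r : Role} {t : ℕ} {b : Committees n} {p : Fin n × Role} :
    p ∈ earlyBits f adv ω r t b ↔ p.2 = r ∧ p.1 ∈ early r (fixedRun f adv b ω t).1 := by
  unfold earlyBits
  simp only [Finset.mem_map]
  constructor
  · rintro ⟨i, hi, rfl⟩
    exact ⟨rfl, hi⟩
  · rintro ⟨rfl, hi⟩
    exact ⟨p.1, hi, rfl⟩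

/-- Early corruption is a fair game for the adversary. -/
theorem sum_bitWeight_mul_prod_earlyBits {q : ℝ} (h0 : 0 ≤ q) (h1 : q ≤ 1) (θ : ℝ) (f : ℕ)
    (adv : (multivaluedBA d V BBA).Adversary) (ω : BBA.Outcome) (r : Role) (t : ℕ) :
    ∑ b, bitWeight q b * ∏ p ∈ earlyBits f adv ω r t b, tilt q θ (b p) = 1 := by
  refine sum_bitWeight_mul_prod_tilt h0 h1 θ (earlyBits f adv ω r) ?_ ?_ ?_ t
  · intro b
    rw [Finset.eq_empty_iff_forall_notMem]
    intro p hp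
    have := (mem_early.1 (mem_earlyBits.1 hp).2).1
    exact absurd this (Finset.notMem_empty _)
  · intro t b
    rcases early_step (c := (fixedRun f adv b ω t).1) f (ω.2 t) (adv (history f adv b ω t)) r with
      h | ⟨i, hi, h⟩
    · left
      unfold earlyBits
      rw [fixedRun_succ, h]
    · right
      refine ⟨(i, r), fun h' => hi (mem_earlyBits.1 h').2, ?_⟩
      unfold earlyBits
      rw [fixedRun_succ, h, Finset.map_insert]
      rfl
  · rintro t b ⟨i, r'⟩ x hp hn
    obtain ⟨hr, hi⟩ := mem_earlyBits.1 hp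
    dsimp only at hr hi
    subst hr
    have hn' : i ∉ early r' (fixedRun f adv b ω t).1 := fun h => hn (mem_earlyBits.2 ⟨rfl, h⟩)
    have he : Evolves (fixedRun f adv b ω t).1 (fixedRun f adv b ω (t + 1)).1 :=
      (inv_fixedRun f adv b ω t).evolves _ _
    rw [mem_early] at hi hn'
    have hc : i ∉ (fixedRun f adv b ω t).1.corrupted := by
      intro h
      refine hn' ⟨h, ?_⟩
      rw [← he.frozen i h]
      exact hi.2
    obtain ⟨h1, h2⟩ := differsAt_fixedRun (r := r') f adv b ω x t hc fun h =>
      hi.2 ((he.mem i).revealed h)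
    have h3 : DiffersAt i r' x (fixedRun f adv b ω (t + 1)).1
        (fixedRun f adv (Function.update b (i, r') x) ω (t + 1)).1 := by
      rw [fixedRun_succ, fixedRun_succ, h2]
      have := hi.2
      rw [fixedRun_succ] at this
      exact h1.step hc _ _ this
    unfold earlyBits
    rw [h1.early_eq, h3.early_eq]
    exact ⟨rfl, rfl⟩

end Secret

/-! ### The committees are good with high probability -/

section Good

variable {n : ℕ} {d : ℝ} {V : Type} {BBA : Protocol n Bool Bool}

open Classical in
/-- The number of members of the committee `r`. -/
noncomputable def committeeCard (r : Role) (c : (multivaluedBA d V BBA).Config) : ℕ :=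
  (Finset.univ.filter fun i => (mem c i).sampled r = true).card

open Classical in
/-- The members of the committee `r` that were corrupted before they were revealed. Only they can
send contradictory messages, or none. -/
noncomputable def earlyMembers (r : Role) (c : (multivaluedBA d V BBA).Config) : Finset (Fin n) :=
  (early r c).filter fun i => (mem c i).sampled r = true

/-- The committees have the properties on which the algorithm relies. -/
structure Good (c : (multivaluedBA d V BBA).Config) : Prop where
  early_le : ∀ r, (earlyMembers r c).card ≤ byzBound d n
  quorum_le : ∀ r, quorum d n + (earlyMembers r c).card ≤ committeeCard r c
  intersect : committeeCard .init c + byzBound d n < 2 * quorum d n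
  byzBound_lt : byzBound d n < quorum d n

variable (f : ℕ) (adv : (multivaluedBA d V BBA).Adversary) (b : Committees n) (ω : BBA.Outcome)

/-- The bits of the committee `r`. -/
def committeeBits (n : ℕ) (r : Role) : Finset (Fin n × Role) :=
  Finset.univ.map ⟨fun i => (i, r), fun _ _ h => congrArg Prod.fst h⟩

theorem card_committeeBits (r : Role) : (committeeBits n r).card = n := by
  simp [committeeBits]

theorem committeeCard_run (r : Role) (t : ℕ) :
    committeeCard r (fixedRun (d := d) (V := V) f adv b ω t).1 =
      ((committeeBits n r).filter fun p => b p = true).card := by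
  classical
  unfold committeeCard committeeBits
  rw [Finset.filter_map, Finset.card_map]
  congr 1
  ext i
  simp only [Finset.mem_filter, Finset.mem_univ, true_and]
  change _ ↔ b (i, r) = true
  rw [← sampled_run f adv b ω t i r]
  rfl

theorem card_earlyMembers_run (r : Role) (t : ℕ) :
    (earlyMembers r (fixedRun (d := d) (V := V) f adv b ω t).1).card =
      ((earlyBits f adv ω r t b).filter fun p => b p = true).card := by
  classical
  unfold earlyMembers earlyBits
  rw [Finset.filter_map, Finset.card_map]
  congr 1
  ext i
  simp only [Finset.mem_filter]
  change _ ↔ _ ∧ b (i, r) = true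
  rw [← sampled_run f adv b ω t i r]
  rfl

theorem card_earlyBits_le (r : Role) (t : ℕ) : (earlyBits f adv ω r t b).card ≤ f := by
  unfold earlyBits
  rw [Finset.card_map]
  refine le_trans (Finset.card_le_card fun i hi => ?_)
    (card_corrupted_le f adv (joinOutcome d V b ω) t)
  exact (mem_early.1 hi).1

theorem earlyMembers_card_mono (r : Role) {s t : ℕ} (h : s ≤ t) :
    (earlyMembers r (fixedRun (d := d) (V := V) f adv b ω s).1).card ≤
      (earlyMembers r (fixedRun (d := d) (V := V) f adv b ω t).1).card := by
  classical
  have he : Evolves (fixedRun f adv b ω s).1 (fixedRun f adv b ω t).1 :=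
    evolves_run f adv (joinOutcome d V b ω) h
  refine Finset.card_le_card fun i hi => ?_
  unfold earlyMembers at hi ⊢
  rw [Finset.mem_filter] at hi ⊢
  exact ⟨he.early_subset r hi.1, by rw [(he.mem i).sampled]; exact hi.2⟩

variable {q L δ a : ℝ}

/-- Few members of a committee are corrupted early. -/
theorem committeeLaw_early_le (hq : (sampleProb n : ℝ) * n = L) (hδ : 0 < δ) (hδ1 : δ ≤ 1)
    (ha : a ≤ 1) (hL : 0 ≤ L) (hf : f ≤ a * n) (r : Role) :
    committeeLaw n {b | ∃ t, (a + δ) * L ≤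
      (earlyMembers r (fixedRun (d := d) (V := V) f adv b ω t).1).card} ≤
      ENNReal.ofReal (Real.exp (-(δ ^ 2 / 4 * L))) := by
  have h0 := (sampleProb n).2.1
  have h1 := (sampleProb n).2.2
  have hmono : Monotone fun t => {b : Committees n | (a + δ) * L ≤
      (earlyMembers r (fixedRun (d := d) (V := V) f adv b ω t).1).card} := by
    intro s t hst b hb
    exact le_trans (α := ℝ) hb (by exact_mod_cast earlyMembers_card_mono f adv b ω r hst)
  rw [Set.ofPred_exists, hmono.measure_iUnion]
  refine iSup_le fun t => committeeLaw_le_of_sum_le fun A hA => ?_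
  -- The tilt `θ = δ / 2` makes the exponent `θ (a + δ) L - a L (θ + θ²)` at least `δ² L / 4`.
  refine sum_bitWeight_le_exp (θ := δ / 2) h0 h1 (by rw [abs_le]; constructor <;> linarith)
    (earlyBits f adv ω r t) (sum_bitWeight_mul_prod_earlyBits h0 h1 _ f adv ω r t) A ?_
  intro b hb
  have hb' : (a + δ) * L ≤ (earlyMembers r (fixedRun (d := d) (V := V) f adv b ω t).1).card := by
    have : b ∈ (A : Set (Committees n)) := hb
    rw [hA] at this
    exact this
  rw [card_earlyMembers_run] at hb'
  have hK : ((earlyBits f adv ω r t b).card : ℝ) ≤ f := by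
    exact_mod_cast card_earlyBits_le f adv b ω r t
  have hKq : ((earlyBits f adv ω r t b).card : ℝ) * sampleProb n ≤ a * L := by
    calc _ ≤ (a * n) * (sampleProb n : ℝ) := by gcongr; exact hK.trans hf
      _ = a * L := by rw [← hq]; ring
  have e1 : δ / 2 * ((a + δ) * L) ≤
      δ / 2 * ((earlyBits f adv ω r t b).filter fun p => b p = true).card := by gcongr
  have e2 : ((earlyBits f adv ω r t b).card : ℝ) * (sampleProb n * (δ / 2 + (δ / 2) ^ 2)) ≤
      a * L * (δ / 2 + (δ / 2) ^ 2) := by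
    rw [← mul_assoc]
    gcongr
  have e3 : a * (L * δ ^ 2) ≤ 1 * (L * δ ^ 2) := by gcongr
  nlinarith

/-- A committee is not too large. -/
theorem committeeLaw_large_le (hq : (sampleProb n : ℝ) * n = L) (hδ : 0 < δ) (hδ1 : δ ≤ 1)
    (r : Role) :
    committeeLaw n {b | (1 + δ) * L ≤ ((committeeBits n r).filter fun p => b p = true).card} ≤
      ENNReal.ofReal (Real.exp (-(δ ^ 2 / 4 * L))) := by
  have h0 := (sampleProb n).2.1
  have h1 := (sampleProb n).2.2
  refine committeeLaw_le_of_sum_le fun A hA => ?_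
  refine sum_bitWeight_le_exp (θ := δ / 2) h0 h1 (by rw [abs_le]; constructor <;> linarith)
    (fun _ => committeeBits n r) (sum_bitWeight_mul_prod_tilt_const h0 h1 _ _) A ?_
  intro b hb
  have hb' : (1 + δ) * L ≤ ((committeeBits n r).filter fun p => b p = true).card := by
    have : b ∈ (A : Set (Committees n)) := hb
    rw [hA] at this
    exact this
  rw [card_committeeBits]
  have e1 : δ / 2 * ((1 + δ) * L) ≤
      δ / 2 * ((committeeBits n r).filter fun p => b p = true).card := by gcongr
  have e2 : (n : ℝ) * (sampleProb n * (δ / 2 + (δ / 2) ^ 2)) = L * (δ / 2 + (δ / 2) ^ 2) := by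
    rw [← hq]; ring
  rw [e2]
  nlinarith

/-- A committee is not too small. -/
theorem committeeLaw_small_le (hq : (sampleProb n : ℝ) * n = L) (hδ : 0 < δ) (hδ1 : δ ≤ 1)
    (r : Role) :
    committeeLaw n {b | (((committeeBits n r).filter fun p => b p = true).card : ℝ) ≤ (1 - δ) * L} ≤
      ENNReal.ofReal (Real.exp (-(δ ^ 2 / 4 * L))) := by
  have h0 := (sampleProb n).2.1
  have h1 := (sampleProb n).2.2
  refine committeeLaw_le_of_sum_le fun A hA => ?_
  refine sum_bitWeight_le_exp (θ := -(δ / 2)) h0 h1 (by rw [abs_le]; constructor <;> linarith)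
    (fun _ => committeeBits n r) (sum_bitWeight_mul_prod_tilt_const h0 h1 _ _) A ?_
  intro b hb
  have hb' : (((committeeBits n r).filter fun p => b p = true).card : ℝ) ≤ (1 - δ) * L := by
    have : b ∈ (A : Set (Committees n)) := hb
    rw [hA] at this
    exact this
  rw [card_committeeBits]
  have e1 : δ / 2 * ((committeeBits n r).filter fun p => b p = true).card ≤
      δ / 2 * ((1 - δ) * L) := by gcongr
  have e2 : (n : ℝ) * (sampleProb n * (-(δ / 2) + (-(δ / 2)) ^ 2)) =
      L * (-(δ / 2) + (δ / 2) ^ 2) := by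
    rw [← hq]; ring
  rw [e2]
  nlinarith

/-- The numerical relations between the parameters. The slack of `ε - 3d` absorbs the deviations of
the committees from their means, and the roundings in `quorum` and `byzBound`. -/
theorem good_of_bounds {ε : ℝ} {c : (multivaluedBA d V BBA).Config} (hd : 0 < d)
    (hδd : δ ≤ d) (hδε : 4 * δ ≤ ε - 3 * d) (hL : committeeSize n = L) (hL0 : 1 ≤ 2 * δ * L)
    (hδ : 0 < δ)
    (h1 : ∀ r, ((earlyMembers r c).card : ℝ) < (1 / 3 - ε + δ) * L)
    (h2 : ∀ r, (committeeCard r c : ℝ) < (1 + δ) * L)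
    (h3 : ∀ r, (1 - δ) * L < committeeCard r c) (hd3 : d ≤ 1 / 3) : Good c := by
  have hLpos : 0 < L := by
    by_contra h
    nlinarith [not_lt.1 h]
  have hW1 : (2 / 3 + 3 * d) * L ≤ quorum d n := by
    unfold quorum; rw [hL]; exact Nat.le_ceil _
  have hW2 : (quorum d n : ℝ) < (2 / 3 + 3 * d) * L + 1 := by
    unfold quorum; rw [hL]; exact Nat.ceil_lt_add_one (by positivity)
  have hB : (byzBound d n : ℝ) ≤ (1 / 3 - d) * L := by
    unfold byzBound; rw [hL]
    exact Nat.floor_le (mul_nonneg (by linarith) hLpos.le)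
  refine ⟨fun r => ?_, fun r => ?_, ?_, ?_⟩
  · unfold byzBound
    rw [hL]
    refine Nat.le_floor ((h1 r).le.trans ?_)
    nlinarith
  · have := h1 r
    have := h3 r
    have : (quorum d n + (earlyMembers r c).card : ℝ) ≤ committeeCard r c := by nlinarith
    exact_mod_cast this
  · have := h2 .init
    have : (committeeCard .init c + byzBound d n : ℝ) < 2 * quorum d n := by nlinarith
    exact_mod_cast this
  · have : (byzBound d n : ℝ) < quorum d n := by nlinarith
    exact_mod_cast this

/-- For fixed coins, the committees are good with high probability. -/
theorem committeeLaw_not_good_le {ε : ℝ} (hd : 0 < d) (hδ : 0 < δ)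
    (hδd : δ ≤ d) (hδε : 4 * δ ≤ ε - 3 * d) (hε : ε < 1 / 3) (hd3 : d ≤ 1 / 3)
    (hL0 : 1 ≤ 2 * δ * committeeSize n)
    (hq : (sampleProb n : ℝ) * n = committeeSize n)
    (adv : (multivaluedBA d V BBA).Adversary) :
    committeeLaw n {b | ∃ t, ¬ Good (fixedRun (maxCorrupt ε n) adv b ω t).1} ≤
      6 * ENNReal.ofReal (Real.exp (-(δ ^ 2 / 4 * committeeSize n))) := by
  have hL : 0 ≤ committeeSize n := by
    by_contra h
    nlinarith [not_le.1 h]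
  have hf : (maxCorrupt ε n : ℝ) ≤ (1 / 3 - ε) * n := by
    unfold maxCorrupt
    exact Nat.floor_le (mul_nonneg (by linarith) (Nat.cast_nonneg n))
  have hδ1 : δ ≤ 1 := by linarith
  set f := maxCorrupt ε n
  set L := committeeSize n with hLdef
  set x := ENNReal.ofReal (Real.exp (-(δ ^ 2 / 4 * L)))
  let E : Role → Set (Committees n) := fun r =>
    {b | ∃ t, (1 / 3 - ε + δ) * L ≤ (earlyMembers r (fixedRun f adv b ω t).1).card} ∪
    ({b | (1 + δ) * L ≤ ((committeeBits n r).filter fun p => b p = true).card} ∪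
    {b | (((committeeBits n r).filter fun p => b p = true).card : ℝ) ≤ (1 - δ) * L})
  have hE : ∀ r, committeeLaw n (E r) ≤ x + (x + x) := fun r =>
    (measure_union_le _ _).trans (add_le_add
      (committeeLaw_early_le f adv ω hq hδ hδ1 (by linarith) hL hf r)
      ((measure_union_le _ _).trans (add_le_add (committeeLaw_large_le hq hδ hδ1 r)
        (committeeLaw_small_le hq hδ hδ1 r))))
  have hsub : {b | ∃ t, ¬ Good (fixedRun f adv b ω t).1} ⊆ E .init ∪ E .converge := by
    rintro b ⟨t, ht⟩
    by_contra hb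
    apply ht
    have hr : ∀ r, b ∉ E r := by
      intro r h
      cases r
      · exact hb (.inl h)
      · exact hb (.inr h)
    have hr' : ∀ r, (¬ ∃ t, (1 / 3 - ε + δ) * L ≤
        (earlyMembers r (fixedRun f adv b ω t).1).card) ∧
        ¬ ((1 + δ) * L ≤ ((committeeBits n r).filter fun p => b p = true).card) ∧
        ¬ ((((committeeBits n r).filter fun p => b p = true).card : ℝ) ≤ (1 - δ) * L) := by
      intro r
      have := hr r
      simp only [E, Set.mem_union, not_or] at this
      exact this
    refine good_of_bounds hd hδd hδε rfl hL0 hδ (fun r => ?_) (fun r => ?_) (fun r => ?_) hd3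
    · have := (hr' r).1
      push Not at this
      exact this t
    · rw [committeeCard_run]
      exact not_le.1 (hr' r).2.1
    · rw [committeeCard_run]
      exact not_le.1 (hr' r).2.2
  calc _ ≤ committeeLaw n (E .init ∪ E .converge) := measure_mono hsub
    _ ≤ (x + (x + x)) + (x + (x + x)) :=
        (measure_union_le _ _).trans (add_le_add (hE _) (hE _))
    _ = 6 * x := by ring

/-- The estimate is integrated over the coins of the binary protocol, with the committees drawn
last. -/
theorem law_not_good_le {ε : ℝ} (hd : 0 < d) (hδ : 0 < δ)
    (hδd : δ ≤ d) (hδε : 4 * δ ≤ ε - 3 * d) (hε : ε < 1 / 3) (hd3 : d ≤ 1 / 3)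
    (hL0 : 1 ≤ 2 * δ * committeeSize n)
    (hq : (sampleProb n : ℝ) * n = committeeSize n) (adv : (multivaluedBA d V BBA).Adversary) :
    (multivaluedBA d V BBA).law
        {ω | ∃ t, ¬ Good ((multivaluedBA d V BBA).run (maxCorrupt ε n) adv ω t)} ≤
      6 * ENNReal.ofReal (Real.exp (-(δ ^ 2 / 4 * committeeSize n))) := by
  have hmeas : MeasurableSet
      {ω | ∃ t, ¬ Good ((multivaluedBA d V BBA).run (maxCorrupt ε n) adv ω t)} := by
    rw [Set.ofPred_exists]
    refine MeasurableSet.iUnion fun t => ?_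
    exact measurableSet_setOfPred.2 (measurable_run_comp _ _ adv t fun c => ¬ Good c)
  rw [← lintegral_indicator_one hmeas,
    lintegral_law_multivaluedBA_symm (measurable_one.indicator hmeas)]
  calc _ ≤ ∫⁻ ω : BBA.Outcome, 6 * ENNReal.ofReal (Real.exp (-(δ ^ 2 / 4 * committeeSize n)))
        ∂BBA.law := by
        refine lintegral_mono fun ω => ?_
        refine le_trans (le_of_eq ?_)
          (committeeLaw_not_good_le ω hd hδ hδd hδε hε hd3 hL0 hq adv)
        have : ∀ b : Committees n, Set.indicator
            {ω | ∃ t, ¬ Good ((multivaluedBA d V BBA).run (maxCorrupt ε n) adv ω t)} 1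
              (joinOutcome d V b ω) =
            Set.indicator {b | ∃ t, ¬ Good (fixedRun (maxCorrupt ε n) adv b ω t).1}
              (1 : Committees n → ℝ≥0∞) b := fun b => rfl
        simp_rw [this]
        rw [lintegral_indicator_one (Set.toFinite _).measurableSet]
    _ = _ := by rw [lintegral_const, measure_univ, mul_one]

end Good

/-- The probability that the committees are bad tends to `0`, uniformly over all adversaries. -/
theorem tendsto_iSup_law_not_good {ε d : ℝ} (hd : 0 < d) (hdε : d < ε / 3) (hε : ε < 1 / 3)
    (V : ℕ → Type) (BBA : ∀ n, Protocol n Bool Bool) :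
    Tendsto (fun n => ⨆ adv : (multivaluedBA d (V n) (BBA n)).Adversary,
      (multivaluedBA d (V n) (BBA n)).law
        {ω | ∃ t, ¬ Good ((multivaluedBA d (V n) (BBA n)).run (maxCorrupt ε n) adv ω t)})
      atTop (𝓝 0) := by
  obtain ⟨δ, hδ, hδd, hδε⟩ : ∃ δ : ℝ, 0 < δ ∧ δ ≤ d ∧ 4 * δ ≤ ε - 3 * d :=
    ⟨min d ((ε - 3 * d) / 4), lt_min hd (by linarith), min_le_left _ _,
      by linarith [min_le_right d ((ε - 3 * d) / 4)]⟩
  have hlog : Tendsto (fun n : ℕ => Real.log n) atTop atTop :=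
    Real.tendsto_log_atTop.comp tendsto_natCast_atTop_atTop
  have hsize : Tendsto committeeSize atTop atTop :=
    hlog.const_mul_atTop (by norm_num : (0 : ℝ) < 8)
  have hlim : Tendsto (fun n => 6 * ENNReal.ofReal (Real.exp (-(δ ^ 2 / 4 * committeeSize n))))
      atTop (𝓝 0) := by
    have h1 : Tendsto (fun n => Real.exp (-(δ ^ 2 / 4 * committeeSize n))) atTop (𝓝 0) :=
      Real.tendsto_exp_neg_atTop_nhds_zero.comp (hsize.const_mul_atTop (by positivity))
    have h2 := ENNReal.tendsto_ofReal h1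
    rw [ENNReal.ofReal_zero] at h2
    have h3 := ENNReal.Tendsto.const_mul (a := 6) h2 (.inr (by norm_num))
    simpa using h3
  have hsmall : ∀ᶠ n : ℕ in atTop, committeeSize n ≤ n := by
    have := (Real.isLittleO_log_id_atTop.comp_tendsto tendsto_natCast_atTop_atTop).bound
      (by norm_num : (0 : ℝ) < 1 / 8)
    filter_upwards [this] with n hn
    simp only [Function.comp, id, Real.norm_eq_abs, Nat.abs_cast] at hn
    have := le_abs_self (Real.log n)
    unfold committeeSize
    linarith
  refine tendsto_of_tendsto_of_tendsto_of_le_of_le' tendsto_const_nhds hlim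
    (Eventually.of_forall fun _ => zero_le) ?_
  filter_upwards [hsmall, hsize.eventually_ge_atTop (1 / (2 * δ)), eventually_ge_atTop 1]
    with n h1 h2 h3
  have hn : (0 : ℝ) < n := by exact_mod_cast h3
  have hpos : 0 ≤ committeeSize n := le_trans (by positivity) h2
  refine iSup_le fun adv => law_not_good_le hd hδ hδd hδε hε (by linarith) ?_ ?_ adv
  · rw [div_le_iff₀ (by positivity)] at h2
    linarith
  · unfold sampleProb
    rw [Set.coe_projIcc, min_eq_right ((div_le_one hn).2 h1), max_eq_right (by positivity)]
    field_simp

/-! ### The decision of the binary protocol -/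

section Decision

variable {n : ℕ} {V : Type} {BBA : Protocol n Bool Bool} {W B : ℕ}

/-- The record of the decision of the binary protocol in a local step from `s` to `s'`: it is kept,
and a new one is an actual decision. -/
structure DecisionStep (s s' : State n V BBA.State) : Prop where
  keep : ∀ x, s.binaryDecision = some x → s'.binaryDecision = some x
  new : ∀ x, s'.binaryDecision = some x → s.binaryDecision = some x ∨
    s'.binaryCalled = true ∧ BBA.decision s'.binary = some x

theorem DecisionStep.of_eq {s s' : State n V BBA.State}
    (h : s'.binaryDecision = s.binaryDecision) : DecisionStep s s' :=
  ⟨fun _ hx => h.trans hx, fun _ hx => .inl (h.symm.trans hx)⟩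

theorem decisionStep_callBinary {s s₁ : State n V BBA.State} (hs : LocalInv BBA W s)
    (h1 : s₁.binaryDecision = s.binaryDecision) (h2 : s₁.binaryCalled = s.binaryCalled)
    (i : Fin n) (coin : BBA.Coin) : DecisionStep s (callBinary BBA W B i coin s₁).1 := by
  classical
  rw [callBinary_eq]
  split_ifs with hc
  · refine ⟨fun x hx => ?_, fun x hx => .inr ⟨rfl, hx⟩⟩
    have := hs.called_of_decision (by rw [hx]; rfl)
    rw [← h2, hc.2.1] at this
    cases this
  · exact .of_eq h1

theorem decisionStep_onStart {s : State n V BBA.State} (hs : LocalInv BBA W s) (i : Fin n) (v : V)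
    (coin : BBA.Coin) : DecisionStep s (onStart BBA W B i s v coin).1 := by
  rw [onStart_eq]
  obtain ⟨y, hy⟩ := propose_fst i s v
  obtain ⟨x, hx⟩ := sendConverge_fst (W := W) i (propose i s v).1
  exact decisionStep_callBinary hs (by rw [hx, hy]) (by rw [hx, hy]) i coin

theorem decisionStep_onReceive {s : State n V BBA.State} (hs : LocalInv BBA W s) (i src : Fin n)
    (m : Msg n V BBA.Msg) (coin : BBA.Coin) :
    DecisionStep s (onReceive BBA W B i s src m coin).1 := by
  cases m with
  | init j v =>
    by_cases hj : j = src
    · subst hj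
      obtain ⟨x, hx⟩ := onReceive_init_fst (W := W) (B := B) i s j v coin
      rw [hx]
      refine .of_eq ?_
      unfold recordInit
      split_ifs <;> rfl
    · rw [(onReceive_ignored i s src coin).1 j v hj]
      exact .of_eq rfl
  | converge j body =>
    by_cases hj : j = src ∧ ValidBody W body
    · simp only [onReceive, if_pos hj]
      refine decisionStep_callBinary hs ?_ ?_ i coin
      · unfold recordConverge
        by_cases h : j ∉ s.convergeSet ∧ s.convergeSet.card < W
        · rw [if_pos h]
        · rw [if_neg h]
      · unfold recordConverge
        by_cases h : j ∉ s.convergeSet ∧ s.convergeSet.card < W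
        · rw [if_pos h]
        · rw [if_neg h]
    · rw [(onReceive_ignored i s src coin).2 j body hj]
      exact .of_eq rfl
  | binary m =>
    simp only [onReceive]
    refine ⟨fun x hx => ?_, fun x hx => ?_⟩
    · simp [hx]
    · dsimp only at hx
      split_ifs at hx with hc
      · cases h : s.binaryDecision with
        | some y => left; simpa [h] using hx
        | none => right; exact ⟨hc, by simpa [h] using hx⟩
      · exact .inl hx

end Decision

section Deterministic

variable {n : ℕ} {d : ℝ} {V : Type} {BBA : Protocol n Bool Bool}

theorem decisionStep_step {f : ℕ} {c : (multivaluedBA d V BBA).Config} (hc : Inv c) (coin : BBA.Coin)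
    (a : (multivaluedBA d V BBA).Action) (i : Fin n) :
    DecisionStep (mem c i) (mem ((multivaluedBA d V BBA).step f c coin a) i) := by
  generalize hc' : (multivaluedBA d V BBA).step f c coin a = c'
  have hlocal : ∀ {j q}, LocalStep c c' j q → DecisionStep (mem c j) q.1 →
      DecisionStep (mem c i) (mem c' i) := by
    intro j q h hq
    by_cases hj : i = j
    · subst hj; rw [h.self]; exact hq
    · rw [h.other i hj]; exact .of_eq rfl
  rcases step_cases f c coin a c' hc' with h | ⟨j, -, -, h⟩ | ⟨j, v, -, -, h, -⟩ |
    ⟨k, p, -, -, -, h, -⟩ | ⟨src, dst, m, -, -, -, h, -⟩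
  · rw [h]; exact .of_eq rfl
  · rw [h]; exact .of_eq rfl
  · exact hlocal h (decisionStep_onStart (hc.localInv _) _ _ _)
  · exact hlocal h (decisionStep_onReceive (hc.localInv _) _ _ _ _)
  · exact hlocal h (decisionStep_onReceive (hc.localInv _) _ _ _ _)

variable {f : ℕ} {adv : (multivaluedBA d V BBA).Adversary} {ω : (multivaluedBA d V BBA).Outcome}

theorem binaryDecision_mono {s t : ℕ} (h : s ≤ t) {i : Fin n} {x : Bool}
    (hx : (mem ((multivaluedBA d V BBA).run f adv ω s) i).binaryDecision = some x) :
    (mem ((multivaluedBA d V BBA).run f adv ω t) i).binaryDecision = some x := by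
  induction h with
  | refl => exact hx
  | step _ ih =>
    rw [Nat.succ_eq_add_one, run_succ]
    exact (decisionStep_step (inv_run f adv ω _) _ _ i).keep x ih

/-- A recorded decision is a decision in the embedded run of the binary protocol. -/
theorem decides_of_binaryDecision {t : ℕ} {i : Fin n} {x : Bool}
    (hx : (mem ((multivaluedBA d V BBA).run f adv ω t) i).binaryDecision = some x) :
    Decides (fun t => proj ((multivaluedBA d V BBA).run f adv ω t)) i x := by
  induction t with
  | zero => cases hx
  | succ t ih =>
    have h := (decisionStep_step (f := f) (inv_run f adv ω t) (ω.2 t)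
      (adv (((multivaluedBA d V BBA).runAux f adv ω t).2 ++
        [(multivaluedBA d V BBA).view ((multivaluedBA d V BBA).run f adv ω t)])) i).new x
    rw [← run_succ] at h
    rcases h hx with h | ⟨h1, h2⟩
    · exact ih h
    · exact ⟨t + 1, by simp [proj, h1], h2⟩

theorem exists_binaryDecision {i : Fin n} {x : Bool}
    (hx : Decides (fun t => proj ((multivaluedBA d V BBA).run f adv ω t)) i x) :
    ∃ t y, (mem ((multivaluedBA d V BBA).run f adv ω t) i).binaryDecision = some y := by
  obtain ⟨t, h1, h2⟩ := hx
  have hcall : (mem ((multivaluedBA d V BBA).run f adv ω t) i).binaryCalled = true := by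
    by_contra h
    exact h1 (by simp [proj, h])
  have := ((inv_run f adv ω t).localInv i).decision_of_called hcall (by
    change (BBA.decision ((proj ((multivaluedBA d V BBA).run f adv ω t)).loc i)).isSome = true
    rw [h2]
    rfl)
  obtain ⟨y, hy⟩ := Option.isSome_iff_exists.1 this
  exact ⟨t, y, hy⟩

/-! ### Every correct process calls the binary protocol -/

/-- A message that has been sent to a correct process is eventually taken into account. -/
theorem eventually_processed (hfair : Fair ((multivaluedBA d V BBA).run f adv ω)) {t : ℕ}
    {p : (multivaluedBA d V BBA).Packet} (hp : p ∈ ((multivaluedBA d V BBA).run f adv ω t).log)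
    (hc : Correct ((multivaluedBA d V BBA).run f adv ω) p.dst) :
    ∀ᶠ s in atTop, Processed (quorum d n) (mem ((multivaluedBA d V BBA).run f adv ω s) p.dst) p.src
      (content p) := by
  obtain ⟨k, hk⟩ := List.mem_iff_getElem?.1 hp
  obtain ⟨t', ht'⟩ := hfair.2 t k p hk hc
  filter_upwards [eventually_ge_atTop (max t t')] with s hs
  refine (inv_run f adv ω s).processed k
    ((evolves_run f adv ω ((le_max_right _ _).trans hs)).delivered ht') p ?_
  obtain ⟨l, hl⟩ := (evolves_run f adv ω ((le_max_left _ _).trans hs)).log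
  rw [← hl, List.getElem?_append_left (List.getElem?_eq_some_iff.1 hk).1, hk]

/-- If the memberships of all correct processes are revealed, then eventually that of every process
is revealed or the process is corrupted early. -/
theorem eventually_revealed_or_early (r : Role)
    (h : ∀ i, Correct ((multivaluedBA d V BBA).run f adv ω) i →
      ∃ t, Revealed (quorum d n) r (mem ((multivaluedBA d V BBA).run f adv ω t) i)) :
    ∀ᶠ t in atTop, ∀ i, Revealed (quorum d n) r (mem ((multivaluedBA d V BBA).run f adv ω t) i) ∨
      i ∈ early r ((multivaluedBA d V BBA).run f adv ω t) := by
  rw [eventually_all]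
  intro i
  have : ∃ t, Revealed (quorum d n) r (mem ((multivaluedBA d V BBA).run f adv ω t) i) ∨
      i ∈ early r ((multivaluedBA d V BBA).run f adv ω t) := by
    by_cases hi : Correct ((multivaluedBA d V BBA).run f adv ω) i
    · obtain ⟨t, ht⟩ := h i hi
      exact ⟨t, .inl ht⟩
    · unfold Correct at hi
      push Not at hi
      obtain ⟨t, ht⟩ := hi
      refine ⟨t, ?_⟩
      rw [mem_early]
      tauto
  obtain ⟨t, ht⟩ := this
  filter_upwards [eventually_ge_atTop t] with s hs
  have he := evolves_run f adv ω hs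
  exact ht.imp (fun h => (he.mem i).revealed h) (fun h => he.early_subset r h)

/-- A committee has a quorum of members that sent their message while they were correct. -/
theorem exists_quorum {c : (multivaluedBA d V BBA).Config} (hg : Good c) {r : Role}
    (h : ∀ i, Revealed (quorum d n) r (mem c i) ∨ i ∈ early r c) :
    ∃ S : Finset (Fin n), quorum d n ≤ S.card ∧
      ∀ i ∈ S, (mem c i).sampled r = true ∧ Revealed (quorum d n) r (mem c i) := by
  classical
  refine ⟨(Finset.univ.filter fun i => (mem c i).sampled r = true) \ earlyMembers r c, ?_, ?_⟩
  · have h1 := hg.quorum_le r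
    have h2 := Finset.le_card_sdiff (earlyMembers r c)
      (Finset.univ.filter fun i => (mem c i).sampled r = true)
    unfold committeeCard at h1
    omega
  · intro i hi
    simp only [Finset.mem_sdiff, Finset.mem_filter, Finset.mem_univ, true_and, earlyMembers,
      not_and] at hi
    refine ⟨hi.1, ?_⟩
    rcases h i with h' | h'
    · exact h'
    · exact absurd hi.1 (hi.2 h')

theorem isSome_input_of_correct (hfair : Fair ((multivaluedBA d V BBA).run f adv ω)) {i : Fin n}
    (hi : Correct ((multivaluedBA d V BBA).run f adv ω) i) :
    ∃ t, (mem ((multivaluedBA d V BBA).run f adv ω t) i).input.isSome = true := by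
  obtain ⟨v, t, ht⟩ := hfair.1 i hi
  refine ⟨t, ?_⟩
  rw [← (inv_run f adv ω t).proposal i, ht]
  rfl

/-- Every correct process eventually has `W` messages `INIT`. -/
theorem exists_initDone (hgood : ∀ t, Good ((multivaluedBA d V BBA).run f adv ω t))
    (hfair : Fair ((multivaluedBA d V BBA).run f adv ω)) {k : Fin n}
    (hk : Correct ((multivaluedBA d V BBA).run f adv ω) k) :
    ∃ t, InitDone (quorum d n) (mem ((multivaluedBA d V BBA).run f adv ω t) k) := by
  obtain ⟨t, ht⟩ := (eventually_revealed_or_early (f := f) (adv := adv) (ω := ω) .init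
    fun i hi => isSome_input_of_correct hfair hi).exists
  obtain ⟨S, hS, hS'⟩ := exists_quorum (hgood t) ht
  have hall : ∀ᶠ s in atTop, ∀ j ∈ S,
      j ∈ (mem ((multivaluedBA d V BBA).run f adv ω s) k).initSet ∨
        (mem ((multivaluedBA d V BBA).run f adv ω s) k).initSet.card = quorum d n := by
    rw [Filter.eventually_all_finset]
    intro j hj
    obtain ⟨h1, h2⟩ := hS' j hj
    obtain ⟨v, hv⟩ := Option.isSome_iff_exists.1 h2
    have := eventually_processed hfair ((inv_run f adv ω t).initSent j v hv h1 k) hk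
    filter_upwards [this] with s hs
    exact hs rfl
  obtain ⟨t₁, ht₁⟩ := isSome_input_of_correct hfair hk
  obtain ⟨s, hs, hs₁⟩ := (hall.and (eventually_ge_atTop t₁)).exists
  refine ⟨s, (evolves_run f adv ω hs₁ |>.mem k).revealed (r := .init) ht₁, ?_⟩
  by_contra hne
  have hsub : S ⊆ (mem ((multivaluedBA d V BBA).run f adv ω s) k).initSet :=
    fun j hj => (hs j hj).resolve_right hne
  exact hne (le_antisymm ((inv_run f adv ω s).localInv k).initSet_le
    (hS.trans (Finset.card_le_card hsub)))

/-- Every correct process eventually has `W` messages `CONVERGE`. -/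
theorem exists_binaryCalled (hgood : ∀ t, Good ((multivaluedBA d V BBA).run f adv ω t))
    (hfair : Fair ((multivaluedBA d V BBA).run f adv ω)) {k : Fin n}
    (hk : Correct ((multivaluedBA d V BBA).run f adv ω) k) :
    ∃ t, (mem ((multivaluedBA d V BBA).run f adv ω t) k).binaryCalled = true := by
  obtain ⟨t, ht⟩ := (eventually_revealed_or_early (f := f) (adv := adv) (ω := ω) .converge
    fun i hi => exists_initDone hgood hfair hi).exists
  obtain ⟨S, hS, hS'⟩ := exists_quorum (hgood t) ht
  have hall : ∀ᶠ s in atTop, ∀ j ∈ S,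
      j ∈ (mem ((multivaluedBA d V BBA).run f adv ω s) k).convergeSet ∨
        (mem ((multivaluedBA d V BBA).run f adv ω s) k).convergeSet.card = quorum d n := by
    rw [Filter.eventually_all_finset]
    intro j hj
    obtain ⟨h1, h2⟩ := hS' j hj
    have hinv := inv_run f adv ω t
    obtain ⟨body, hb⟩ := hinv.convergeSent j ((hinv.localInv j).convergeSent.2 ⟨h1, h2⟩)
    have := eventually_processed hfair (hb k) hk
    filter_upwards [this] with s hs
    exact (hs rfl (hinv.wellFormed _ (hb k)).2).1
  obtain ⟨t₁, ht₁⟩ := isSome_input_of_correct hfair hk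
  obtain ⟨s, hs, hs₁⟩ := (hall.and (eventually_ge_atTop t₁)).exists
  have hl := (inv_run f adv ω s).localInv k
  refine ⟨s, hl.binaryCalled.2 ⟨(evolves_run f adv ω hs₁ |>.mem k).revealed (r := .init) ht₁, ?_⟩⟩
  by_contra hne
  have hsub : S ⊆ (mem ((multivaluedBA d V BBA).run f adv ω s) k).convergeSet :=
    fun j hj => (hs j hj).resolve_right hne
  exact hne (le_antisymm hl.convergeSet_le (hS.trans (Finset.card_le_card hsub)))

/-- The embedded run of the binary protocol is fair. -/
theorem fair_proj (hgood : ∀ t, Good ((multivaluedBA d V BBA).run f adv ω t))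
    (hfair : Fair ((multivaluedBA d V BBA).run f adv ω)) :
    Fair fun t => proj ((multivaluedBA d V BBA).run f adv ω t) := by
  constructor
  · intro i hi
    obtain ⟨t, ht⟩ := exists_binaryCalled hgood hfair (k := i) hi
    exact ⟨_, t, if_pos ht⟩
  · intro t k q hq hc
    obtain ⟨j, p, hj, hpq, rfl⟩ := exists_filteredPos hq
    have hdst : q.dst = p.dst := by
      unfold unwrap at hpq
      obtain ⟨m, -, rfl⟩ := Option.map_eq_some_iff.1 hpq
      rfl
    obtain ⟨t', ht'⟩ := hfair.2 t j p hj (by rw [← hdst]; exact hc)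
    refine ⟨max t t', mem_proj_delivered.2 ⟨j,
      (evolves_run f adv ω (le_max_right t t')).delivered ht', p, q, ?_, hpq, ?_⟩⟩
    all_goals
      obtain ⟨l, hl⟩ := (evolves_run f adv ω (le_max_left t t')).log
      rw [← hl]
    · rw [List.getElem?_append_left (List.getElem?_eq_some_iff.1 hj).1, hj]
    · exact filteredPos_append _ _ (List.getElem?_eq_some_iff.1 hj).1.le

/-! ### The properties of the multivalued algorithm -/

/-- Two quorum certificates have a common signer that was not corrupted early, and therefore the same
value. -/
theorem Good.value_eq {c : (multivaluedBA d V BBA).Config} (hg : Good c) {v w : V}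
    {S T : Finset (Fin n)} (hS : S.card = quorum d n) (hT : T.card = quorum d n)
    (hSv : ∀ j ∈ S, InitCert c j v) (hTw : ∀ j ∈ T, InitCert c j w) : v = w := by
  classical
  have h1 : (S ∪ T).card ≤ committeeCard .init c := by
    refine Finset.card_le_card fun j hj => ?_
    rw [Finset.mem_filter]
    refine ⟨Finset.mem_univ _, ?_⟩
    rcases Finset.mem_union.1 hj with hj | hj
    · exact (hSv j hj).1
    · exact (hTw j hj).1
  have h2 := Finset.card_union_add_card_inter S T
  have h3 := hg.intersect
  have h4 := hg.early_le .init
  obtain ⟨j, hj, hj'⟩ := Finset.exists_mem_notMem_of_card_lt_card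
    (show (earlyMembers .init c).card < (S ∩ T).card by omega)
  rw [Finset.mem_inter] at hj
  obtain ⟨hs, h5⟩ := hSv j hj.1
  obtain ⟨-, h6⟩ := hTw j hj.2
  have hne : ¬ (j ∈ c.corrupted ∧ (mem c j).input = none) := by
    rintro ⟨ha, hb⟩
    refine hj' (Finset.mem_filter.2 ⟨mem_early.2 ⟨ha, ?_⟩, hs⟩)
    simp [Revealed, hb]
  have h7 := h5.resolve_right hne
  rw [h6.resolve_right hne] at h7
  cases h7
  rfl

theorem decide?_eq_some {S : Type} {s : State n V S} {x : Option V} (h : decide? s = some x) :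
    (s.binaryDecision = some true ∧ x = none) ∨
      (s.binaryDecision = some false ∧ ∃ v, s.qcValue = some v ∧ x = some v) := by
  unfold decide? at h
  cases hb : s.binaryDecision with
  | none => rw [hb] at h; cases h
  | some b =>
    rw [hb] at h
    cases b with
    | true => cases h; exact .inl ⟨rfl, rfl⟩
    | false =>
      obtain ⟨v, hv, rfl⟩ := Option.map_eq_some_iff.1 h
      exact .inr ⟨rfl, v, hv, rfl⟩

theorem agreement_of_binary (hgood : ∀ t, Good ((multivaluedBA d V BBA).run f adv ω t))
    (hagree : Agreement fun t => proj ((multivaluedBA d V BBA).run f adv ω t)) :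
    Agreement ((multivaluedBA d V BBA).run f adv ω) := by
  rintro i j x y hi hj ⟨t, -, ht⟩ ⟨t', -, ht'⟩
  rcases decide?_eq_some ht with ⟨h1, rfl⟩ | ⟨h1, v, hv, rfl⟩ <;>
  rcases decide?_eq_some ht' with ⟨h2, rfl⟩ | ⟨h2, w, hw, rfl⟩
  · rfl
  · cases hagree i j _ _ hi hj (decides_of_binaryDecision h1) (decides_of_binaryDecision h2)
  · cases hagree i j _ _ hi hj (decides_of_binaryDecision h1) (decides_of_binaryDecision h2)
  · have e1 := (evolves_run f adv ω (le_max_left t t')).mem i |>.qcValue v hv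
    have e2 := (evolves_run f adv ω (le_max_right t t')).mem j |>.qcValue w hw
    obtain ⟨S, hS, hSv⟩ := (inv_run f adv ω _).qcRecord i v e1
    obtain ⟨T, hT, hTw⟩ := (inv_run f adv ω _).qcRecord j w e2
    rw [(hgood _).value_eq hS hT hSv hTw]

theorem proposes_proj {t : ℕ} {i : Fin n} {x : Bool}
    (h : (proj ((multivaluedBA d V BBA).run f adv ω t)).proposal i = some x) :
    (mem ((multivaluedBA d V BBA).run f adv ω t) i).binaryCalled = true ∧
      alert (byzBound d n) (mem ((multivaluedBA d V BBA).run f adv ω t) i) = x := by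
  simp only [proj] at h
  split_ifs at h with hc
  · cases h
    exact ⟨hc, rfl⟩

/-- If a correct process calls the binary protocol with the input `false`, then every correct process
eventually has a quorum certificate. -/
theorem eventually_qcValue (hgood : ∀ t, Good ((multivaluedBA d V BBA).run f adv ω t))
    (hfair : Fair ((multivaluedBA d V BBA).run f adv ω)) {i j : Fin n}
    (hi : Correct ((multivaluedBA d V BBA).run f adv ω) i)
    (hj : Proposes (fun t => proj ((multivaluedBA d V BBA).run f adv ω t)) j false) :
    ∀ᶠ t in atTop, (mem ((multivaluedBA d V BBA).run f adv ω t) i).qcValue.isSome = true := by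
  classical
  obtain ⟨t, ht⟩ := hj
  obtain ⟨-, h2⟩ := proposes_proj ht
  have hinv := inv_run f adv ω t
  obtain ⟨T, -, hT, hcert, -⟩ := hinv.convergeRecord j
  have h3 := (hgood t).early_le .converge
  have h4 : byzBound d n + 1 ≤ T.card := by
    rw [hT]
    simpa [alert] using h2
  obtain ⟨k, hk, hk'⟩ := Finset.exists_mem_notMem_of_card_lt_card
    (show (earlyMembers .converge _).card < T.card from h3.trans_lt h4)
  obtain ⟨qc, hs, hq⟩ := hcert k hk
  have hne : ¬ (k ∈ ((multivaluedBA d V BBA).run f adv ω t).corrupted ∧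
      ¬ InitDone (quorum d n) (mem ((multivaluedBA d V BBA).run f adv ω t) k)) := by
    intro h
    exact hk' (Finset.mem_filter.2 ⟨mem_early.2 h, hs⟩)
  obtain ⟨-, hlog, -⟩ := hq.resolve_right hne
  filter_upwards [eventually_processed hfair (hlog i) hi] with s hs
  exact (hs rfl (hinv.wellFormed _ (hlog i)).2).2 rfl

theorem termination_of_binary (hgood : ∀ t, Good ((multivaluedBA d V BBA).run f adv ω t))
    (hfair : Fair ((multivaluedBA d V BBA).run f adv ω))
    (hstrong : StrongUnanimity fun t => proj ((multivaluedBA d V BBA).run f adv ω t))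
    (hterm : Termination fun t => proj ((multivaluedBA d V BBA).run f adv ω t)) :
    Termination ((multivaluedBA d V BBA).run f adv ω) := by
  intro i hi
  obtain ⟨x, hx⟩ := hterm i hi
  obtain ⟨t, y, hy⟩ := exists_binaryDecision hx
  have hin : ∀ s, t ≤ s → ((multivaluedBA d V BBA).run f adv ω s).proposal i ≠ none := by
    intro s hs
    have hl := (inv_run f adv ω s).localInv i
    have hc := hl.called_of_decision (by rw [binaryDecision_mono hs hy]; rfl)
    rw [(inv_run f adv ω s).proposal]
    exact Option.isSome_iff_ne_none.1 (hl.binaryCalled.1 hc).1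
  cases y with
  | true =>
    refine ⟨none, t, hin t le_rfl, ?_⟩
    change decide? (mem _ i) = _
    simp [decide?, hy]
  | false =>
    have hex : ∃ j, Correct ((multivaluedBA d V BBA).run f adv ω) j ∧
        ¬ Proposes (fun t => proj ((multivaluedBA d V BBA).run f adv ω t)) j true := by
      by_contra h
      push Not at h
      cases hstrong true h i false hi (decides_of_binaryDecision hy)
    obtain ⟨j, hj, hj'⟩ := hex
    obtain ⟨z, hz⟩ := (fair_proj hgood hfair).1 j hj
    have hz' : z = false := by
      cases z
      · rfl
      · exact absurd hz hj'
    subst hz'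
    obtain ⟨s, hs, hts⟩ :=
      ((eventually_qcValue hgood hfair hi hz).and (eventually_ge_atTop t)).exists
    obtain ⟨v, hv⟩ := Option.isSome_iff_exists.1 hs
    refine ⟨some v, s, hin s hts, ?_⟩
    change decide? (mem _ i) = _
    simp [decide?, binaryDecision_mono hts hy, hv]

theorem weakUnanimity_of_binary (hgood : ∀ t, Good ((multivaluedBA d V BBA).run f adv ω t))
    (hfair : Fair ((multivaluedBA d V BBA).run f adv ω))
    (hstrong : StrongUnanimity fun t => proj ((multivaluedBA d V BBA).run f adv ω t)) :
    WeakUnanimity ((multivaluedBA d V BBA).run f adv ω) := by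
  rintro v hall i x ⟨t, -, ht⟩
  have hW : 0 < quorum d n := (Nat.zero_le _).trans_lt (hgood 0).byzBound_lt
  -- No process is ever corrupted, so only `v` can be signed.
  have hinput : ∀ t j w, (mem ((multivaluedBA d V BBA).run f adv ω t) j).input = some w → w = v := by
    intro t j w hw
    obtain ⟨t', ht'⟩ := (hall j).2
    rw [(inv_run f adv ω t').proposal] at ht'
    have e1 := (evolves_run f adv ω (le_max_left t t')).mem j |>.input w hw
    have e2 := (evolves_run f adv ω (le_max_right t t')).mem j |>.input v ht'
    rw [e1] at e2
    cases e2
    rfl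
  have hcert : ∀ t j w, InitCert ((multivaluedBA d V BBA).run f adv ω t) j w → w = v := by
    rintro t j w ⟨-, h | h⟩
    · exact hinput t j w h
    · exact absurd h.1 ((hall j).1 t)
  have hnone : ∀ t j, ¬ ConvergeCert ((multivaluedBA d V BBA).run f adv ω t) j none := by
    rintro t j ⟨-, ⟨h1, -, h2⟩ | h⟩
    · obtain ⟨w, hw⟩ := Option.isSome_iff_exists.1 h1.1
      refine h2 rfl w hw ?_
      obtain rfl := hinput t j w hw
      have hinv := inv_run f adv ω t
      have hne : (mem ((multivaluedBA d V BBA).run f adv ω t) j).initValues.Nonempty :=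
        (hinv.localInv j).initValues (Finset.card_pos.1 (by rw [h1.2]; exact hW))
      refine Finset.eq_singleton_iff_nonempty_unique_mem.2 ⟨hne, fun u hu => ?_⟩
      obtain ⟨k, -, hk⟩ := (hinv.initRecord j).2 u hu
      exact hcert t k u hk
    · exact absurd h.1 ((hall j).1 t)
  have hfalse : ∀ j, Correct (fun t => proj ((multivaluedBA d V BBA).run f adv ω t)) j →
      Proposes (fun t => proj ((multivaluedBA d V BBA).run f adv ω t)) j false := by
    intro j hj
    obtain ⟨z, s, hs⟩ := (fair_proj hgood hfair).1 j hj
    obtain ⟨h1, h2⟩ := proposes_proj hs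
    have hinv := inv_run f adv ω s
    obtain ⟨T, hT, hcount, -, hrest⟩ := hinv.convergeRecord j
    have hTeq : T = (mem ((multivaluedBA d V BBA).run f adv ω s) j).convergeSet := by
      refine Finset.Subset.antisymm hT fun k hk => ?_
      by_contra hkT
      exact hnone s k (hrest k hk hkT)
    have hlt := (hgood 0).byzBound_lt
    rw [hTeq, ((hinv.localInv j).binaryCalled.1 h1).2] at hcount
    have : z = false := by
      rw [← h2]
      simp only [alert, decide_eq_false_iff_not]
      omega
    subst this
    exact ⟨s, hs⟩
  rcases decide?_eq_some ht with ⟨h1, rfl⟩ | ⟨h1, w, hw, rfl⟩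
  · cases hstrong false hfalse i true (hall i).1 (decides_of_binaryDecision h1)
  · obtain ⟨S, hS, hSv⟩ := (inv_run f adv ω t).qcRecord i w hw
    obtain ⟨j, hj⟩ := Finset.card_pos.1 (by rw [hS]; exact hW)
    rw [hcert t j w (hSv j hj)]

end Deterministic

end MultivaluedBA

/-- The multivalued algorithm solves weak Byzantine Agreement. -/
theorem solvesMultivaluedWeakBA {ε d : ℝ} (hd : 0 < d) (hdε : d < ε / 3) (hε : ε < 1 / 3)
    (V : ℕ → Type) (BBA : ∀ n, Protocol n Bool Bool)
    (h : SolvesBinaryStrongBA (maxCorrupt ε) BBA) :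
    SolvesMultivaluedWeakBA (maxCorrupt ε) fun n => multivaluedBA d (V n) (BBA n) := by
  have hlim := (tendsto_iSup_law_not_good hd hdε hε V BBA).add h
  rw [add_zero] at hlim
  refine tendsto_of_tendsto_of_tendsto_of_le_of_le tendsto_const_nhds hlim (fun _ => zero_le) ?_
  intro n
  refine iSup_le fun adv => ?_
  set f := maxCorrupt ε n
  let P := multivaluedBA d (V n) (BBA n)
  let bad : Set P.Outcome := {ω | Fair (fun t => proj (P.run f adv ω t)) ∧
    ¬ (StrongUnanimity (fun t => proj (P.run f adv ω t)) ∧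
      Agreement (fun t => proj (P.run f adv ω t)) ∧
      Termination fun t => proj (P.run f adv ω t))}
  have hsub : {ω | Fair (P.run f adv ω) ∧ ¬ (WeakUnanimity (P.run f adv ω) ∧
      Agreement (P.run f adv ω) ∧ Termination (P.run f adv ω))} ⊆
      {ω | ∃ t, ¬ Good (P.run f adv ω t)} ∪ bad := by
    rintro ω ⟨hfair, hnot⟩
    by_contra hω
    rw [Set.mem_union, not_or] at hω
    obtain ⟨h1, h2⟩ := hω
    have hgood : ∀ t, Good (P.run f adv ω t) := by
      intro t
      by_contra hg
      exact h1 ⟨t, hg⟩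
    have hB : StrongUnanimity (fun t => proj (P.run f adv ω t)) ∧
        Agreement (fun t => proj (P.run f adv ω t)) ∧
        Termination fun t => proj (P.run f adv ω t) := by
      by_contra hB
      exact h2 ⟨fair_proj hgood hfair, hB⟩
    exact hnot ⟨weakUnanimity_of_binary hgood hfair hB.1, agreement_of_binary hgood hB.2.1,
      termination_of_binary hgood hfair hB.1 hB.2.2⟩
  have hbad : P.law bad ≤ ⨆ adv : (BBA n).Adversary, (BBA n).law
      {ω | Fair ((BBA n).run f adv ω) ∧ ¬ (StrongUnanimity ((BBA n).run f adv ω) ∧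
        Agreement ((BBA n).run f adv ω) ∧ Termination ((BBA n).run f adv ω))} := by
    refine law_multivaluedBA_le fun b => ?_
    refine le_trans (le_of_eq ?_) (le_iSup _ (simulator f adv b))
    congr 1
    ext ω
    have : (fun t => proj (P.run f adv (joinOutcome d (V n) b ω) t)) =
        (BBA n).run f (simulator f adv b) ω := funext fun t => (run_simulator f adv b ω t).symm
    change (Fair _ ∧ ¬ (StrongUnanimity _ ∧ Agreement _ ∧ Termination _)) ↔ _
    rw [this]
    rfl
  calc _ ≤ P.law ({ω | ∃ t, ¬ Good (P.run f adv ω t)} ∪ bad) := measure_mono hsub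
    _ ≤ _ := (measure_union_le _ _).trans (add_le_add
        (le_iSup (fun adv : P.Adversary => P.law {ω | ∃ t, ¬ Good (P.run f adv ω t)}) adv) hbad)

/-! ### Word complexity -/

namespace MultivaluedBA

section Words

variable {n : ℕ} {V : Type} {BBA : Protocol n Bool Bool} {W B : ℕ}

/-- The number of words in the `INIT` and `CONVERGE` messages among the outgoing messages `l`. -/
def outWords {M : Type} (l : List (Fin n × Msg n V M)) : ℕ := (l.map fun q => ownWords q.2).sum

/-- A bound for the number of words in the `INIT` and `CONVERGE` messages that a process with the
memory `s` has sent. -/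
def wordBudget {S : Type} (W : ℕ) (s : State n V S) : ℕ :=
  n * (3 * s.initSent.toNat + (4 + 2 * W) * s.convergeSent.toNat)

theorem outWords_append {M : Type} (l l' : List (Fin n × Msg n V M)) :
    outWords (l ++ l') = outWords l + outWords l' := by
  simp [outWords]

theorem outWords_broadcast {M : Type} (m : Msg n V M) :
    outWords (broadcast m) = n * ownWords m := by
  simp [outWords, broadcast, Function.comp_def]

theorem outWords_binary {M : Type} (l : List (Fin n × Msg n V M))
    (h : ∀ q ∈ l, ∃ m, q.2 = .binary m) : outWords l = 0 := by
  refine List.sum_eq_zero fun x hx => ?_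
  obtain ⟨q, hq, rfl⟩ := List.mem_map.1 hx
  obtain ⟨m, hm⟩ := h q hq
  rw [hm]
  rfl

theorem ownWords_convergeBody_le {M : Type} (i : Fin n) {s : State n V BBA.State}
    (hs : InitDone W s) :
    ownWords (Msg.converge (M := M) i (convergeBody s)) ≤ 4 + 2 * W := by
  unfold convergeBody
  cases s.input with
  | none => simp only [Option.bind_none, ownWords]; omega
  | some v =>
    rw [Option.bind_some]
    split_ifs
    · simp only [ownWords, hs.2]; exact le_rfl
    · simp only [ownWords]; omega

theorem outWords_sendConverge (i : Fin n) (s : State n V BBA.State) :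
    outWords (sendConverge BBA W i s).2 + wordBudget W s ≤
      wordBudget W (sendConverge BBA W i s).1 := by
  classical
  rw [sendConverge_eq]
  split_ifs with h
  · have := Nat.mul_le_mul_left n (ownWords_convergeBody_le (M := BBA.Msg) i h.2.2)
    simp only [outWords_broadcast, wordBudget, h.2.1, Bool.toNat_false, Bool.toNat_true]
    linarith
  · simp [outWords]

theorem outWords_propose (i : Fin n) {s : State n V BBA.State} (hs : s.initSent = false) (v : V) :
    outWords (propose i s v).2 + wordBudget W s = wordBudget W (propose i s v).1 := by
  unfold propose
  split_ifs
  · simp only [outWords_broadcast, wordBudget, hs, Bool.toNat_false, Bool.toNat_true, ownWords]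
    ring
  · simp [outWords, wordBudget]

theorem wordBudget_callBinary (i : Fin n) (coin : BBA.Coin) (s : State n V BBA.State) :
    wordBudget W (callBinary BBA W B i coin s).1 = wordBudget W s := by
  obtain ⟨_, _, _, h⟩ := callBinary_fst (W := W) (B := B) i coin s
  rw [h]
  rfl

theorem outWords_onStart (i : Fin n) {s : State n V BBA.State} (h : LocalInv BBA W s)
    (hs : s.input = none) (v : V) (coin : BBA.Coin) :
    outWords (onStart BBA W B i s v coin).2 + wordBudget W s ≤
      wordBudget W (onStart BBA W B i s v coin).1 := by
  have h0 : s.initSent = false := by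
    by_contra h'
    have := (h.initSent.1 (by simpa using h')).2
    simp [hs] at this
  rw [onStart_eq, outWords_append, outWords_append, outWords_binary _ (callBinary_snd _ _ _),
    wordBudget_callBinary]
  have h1 := outWords_propose (W := W) i h0 v
  have h2 := outWords_sendConverge (W := W) i (propose i s v).1
  omega

/-- The budget pays for the messages that are sent, as the flags are raised at most once. -/
theorem outWords_onReceive (i : Fin n) (s : State n V BBA.State) (src : Fin n)
    (m : Msg n V BBA.Msg) (coin : BBA.Coin) :
    outWords (onReceive BBA W B i s src m coin).2 + wordBudget W s ≤
      wordBudget W (onReceive BBA W B i s src m coin).1 := by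
  cases m with
  | init j v =>
    simp only [onReceive]
    split_ifs
    · have h := outWords_sendConverge (W := W) i (recordInit BBA W s j v)
      have e : wordBudget W (recordInit BBA W s j v) = wordBudget W s := by
        unfold recordInit
        split_ifs <;> rfl
      rwa [e] at h
    · simp [outWords]
  | converge j body =>
    simp only [onReceive]
    split_ifs
    · rw [outWords_binary _ (callBinary_snd _ _ _), wordBudget_callBinary, zero_add]
      apply le_of_eq
      unfold recordConverge
      by_cases hc : j ∉ s.convergeSet ∧ s.convergeSet.card < W
      · rw [if_pos hc]; rfl
      · rw [if_neg hc]; rfl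
    · simp [outWords]
  | binary m =>
    rw [outWords_binary]
    · simp [onReceive, wordBudget]
    · intro q hq
      obtain ⟨x, _, rfl⟩ := List.mem_map.1 hq
      exact ⟨_, rfl⟩

end Words

section Runs

variable {n : ℕ} {d : ℝ} {V : Type} {BBA : Protocol n Bool Bool}

/-- The number of words in the `INIT` and `CONVERGE` messages that were sent. -/
def ownTotal (c : (multivaluedBA d V BBA).Config) : ℕ :=
  (c.log.map fun p => ownWords (content p)).sum

/-- The number of words in the messages of the binary protocol that were sent. -/
def binaryTotal (c : BBA.Config) : ℕ := (c.log.map fun p => BBA.words p.msg).sum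

theorem LocalStep.ownTotal_le {c c' : (multivaluedBA d V BBA).Config} {i : Fin n}
    {r : Result V BBA} (h : LocalStep c c' i r)
    (hr : outWords r.2 + wordBudget (quorum d n) (mem c i) ≤ wordBudget (quorum d n) r.1)
    (hc : ownTotal c ≤ ∑ j, wordBudget (quorum d n) (mem c j)) :
    ownTotal c' ≤ ∑ j, wordBudget (quorum d n) (mem c' j) := by
  have e : ownTotal c' = ownTotal c + outWords r.2 := by
    simp [ownTotal, h.log, packets, outWords, Function.comp_def, content, packet]
  have hsum : ∑ j ∈ Finset.univ.erase i, wordBudget (quorum d n) (mem c' j) =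
      ∑ j ∈ Finset.univ.erase i, wordBudget (quorum d n) (mem c j) :=
    Finset.sum_congr rfl fun j hj => by rw [h.other j (Finset.ne_of_mem_erase hj)]
  rw [← Finset.add_sum_erase _ _ (Finset.mem_univ i)] at hc ⊢
  rw [hsum, h.self, e]
  omega

/-- Every process sends at most one `INIT` and one `CONVERGE` message to each process. -/
theorem ownTotal_run_le (f : ℕ) (adv : (multivaluedBA d V BBA).Adversary)
    (ω : (multivaluedBA d V BBA).Outcome) (t : ℕ) :
    ownTotal ((multivaluedBA d V BBA).run f adv ω t) ≤
      ∑ i, wordBudget (quorum d n) (mem ((multivaluedBA d V BBA).run f adv ω t) i) := by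
  induction t with
  | zero => exact Nat.zero_le _
  | succ t ih =>
    have hinv := inv_run f adv ω t
    rw [Protocol.run_succ]
    generalize (multivaluedBA d V BBA).run f adv ω t = c at *
    generalize hc' : (multivaluedBA d V BBA).step f c _ _ = c'
    rcases step_cases f c _ _ c' hc' with h | ⟨i, _, _, h⟩ | ⟨i, v, _, hi, h, _⟩ |
      ⟨k, p, _, _, _, h, _⟩ | ⟨src, dst, m, _, _, _, h, _⟩
    · rw [h]; exact ih
    · rw [h]; exact ih
    · refine h.ownTotal_le (outWords_onStart i (hinv.localInv i) ?_ v _) ih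
      rw [← hinv.proposal i, hi]
    · exact h.ownTotal_le (outWords_onReceive _ _ _ _ _) ih
    · exact h.ownTotal_le (outWords_onReceive _ _ _ _ _) ih

/-- A bound for the number of words in `INIT` and `CONVERGE` messages in terms of the
committees. -/
noncomputable def committeeBudget (d : ℝ) {n : ℕ} (b : Committees n) : ℕ :=
  ∑ i, n * (3 * (b (i, .init)).toNat + (4 + 2 * quorum d n) * (b (i, .converge)).toNat)

theorem ownTotal_run_le_committeeBudget (f : ℕ) (adv : (multivaluedBA d V BBA).Adversary)
    (b : Committees n) (ω : BBA.Outcome) (t : ℕ) :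
    ownTotal ((multivaluedBA d V BBA).run f adv (joinOutcome d V b ω) t) ≤
      committeeBudget d b := by
  refine (ownTotal_run_le f adv _ t).trans (Finset.sum_le_sum fun i _ => ?_)
  have hl := (inv_run f adv (joinOutcome d V b ω) t).localInv i
  unfold wordBudget
  gcongr
  · rw [← sampled_run f adv b ω t i .init]
    exact Bool.toNat_le_toNat (Bool.le_iff_imp.2 fun h => (hl.initSent.1 h).1)
  · rw [← sampled_run f adv b ω t i .converge]
    exact Bool.toNat_le_toNat (Bool.le_iff_imp.2 fun h => (hl.convergeSent.1 h).1)

/-- The words of the multivalued algorithm are those of its own messages and those of the embedded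
run of the binary protocol. -/
theorem words_eq (c : (multivaluedBA d V BBA).Config) :
    (c.log.map fun p => (multivaluedBA d V BBA).words p.msg).sum =
      ownTotal c + binaryTotal (proj c) := by
  change (c.log.map fun p => msgWords BBA.words (content p)).sum = (c.log.map _).sum +
    ((c.log.filterMap unwrap).map _).sum
  induction c.log with
  | nil => rfl
  | cons p l ih =>
    rw [List.map_cons, List.sum_cons, List.map_cons, List.sum_cons, ih, List.filterMap_cons]
    unfold unwrap
    cases content p with
    | init j v => simp [unwrapMsg, msgWords]; ring
    | converge j body => simp [unwrapMsg, msgWords]; ring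
    | binary m => simp [unwrapMsg, msgWords, ownWords]; ring

/-! ### The expected size of the committees -/

theorem lintegral_committeeLaw_apply (p : Fin n × Role) :
    ∫⁻ b, ((b p).toNat : ℝ≥0∞) ∂(committeeLaw n) = ENNReal.ofReal (sampleProb n) := by
  have h := (measurePreserving_eval (fun _ : Fin n × Role =>
    bernoulliMeasure true false (sampleProb n)) p).lintegral_comp
    (f := fun x : Bool => (x.toNat : ℝ≥0∞)) (measurable_of_countable _)
  refine h.trans ?_
  rw [lintegral_fintype]
  simp only [Fintype.univ_bool, Finset.mem_singleton, Bool.true_eq_false, not_false_eq_true,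
    Finset.sum_insert, Bool.toNat_true, Nat.cast_one, one_mul, Finset.sum_singleton,
    Bool.toNat_false, Nat.cast_zero, zero_mul, add_zero]
  rw [bernoulliMeasure_apply _ (MeasurableSet.singleton _)]
  simp [ENNReal.ofReal]
  rw [Real.toNNReal_of_nonneg (sampleProb n).2.1]
  rfl

theorem lintegral_committeeBudget :
    ∫⁻ b, (committeeBudget d b : ℝ≥0∞) ∂(committeeLaw n) =
      ENNReal.ofReal (n * (n * (sampleProb n * (7 + 2 * quorum d n)))) := by
  unfold committeeBudget
  push_cast
  rw [lintegral_finsetSum _ fun _ _ => measurable_of_countable _]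
  simp_rw [lintegral_const_mul _ (measurable_of_countable _),
    lintegral_add_left (measurable_of_countable _),
    lintegral_const_mul _ (measurable_of_countable _), lintegral_committeeLaw_apply]
  have h0 := (sampleProb n).2.1
  rw [Finset.sum_const, Finset.card_univ, Fintype.card_fin, nsmul_eq_mul,
    ENNReal.ofReal_mul (by positivity), ENNReal.ofReal_mul (by positivity),
    ENNReal.ofReal_mul h0, ENNReal.ofReal_natCast]
  have : ENNReal.ofReal (7 + 2 * (quorum d n : ℝ)) = 7 + 2 * (quorum d n : ℝ≥0∞) := by
    rw [ENNReal.ofReal_add (by positivity) (by positivity), ENNReal.ofReal_mul (by positivity)]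
    simp
  rw [this]
  ring

/-- The constant in the bound for the expected number of words. It comes from `λ = 8 ln n` and
`7 + 2W ≤ 9 + 16 (2/3 + 3d) ln n`, where `9 ≤ 14 ln n` since `ln 2 > 0.69`. -/
noncomputable def wordConstant (d : ℝ) : ℝ := 8 * (14 + 16 * (2 / 3 + 3 * d))

theorem lintegral_committeeBudget_le (hd : 0 < d) (hn : 2 ≤ n) :
    ∫⁻ b, (committeeBudget d b : ℝ≥0∞) ∂(committeeLaw n) ≤
      ENNReal.ofReal (wordConstant d * n * Real.log n ^ 2) := by
  rw [lintegral_committeeBudget]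
  refine ENNReal.ofReal_le_ofReal ?_
  have hn' : (2 : ℝ) ≤ n := by exact_mod_cast hn
  have hlog : 0.69 < Real.log n :=
    (by linarith [Real.log_two_gt_d9] : (0.69 : ℝ) < Real.log 2).trans_le
      (Real.log_le_log (by norm_num) hn')
  have hL : 0 ≤ committeeSize n := by unfold committeeSize; linarith
  have hq : n * (sampleProb n : ℝ) ≤ committeeSize n := by
    have : (sampleProb n : ℝ) ≤ committeeSize n / n := by
      unfold sampleProb
      rw [Set.coe_projIcc]
      exact max_le (by positivity) (min_le_right _ _)
    rwa [le_div_iff₀ (by linarith), mul_comm] at this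
  have hW : (quorum d n : ℝ) ≤ (2 / 3 + 3 * d) * committeeSize n + 1 :=
    (Nat.ceil_lt_add_one (by positivity)).le
  have h7 : 7 + 2 * (quorum d n : ℝ) ≤ (14 + 16 * (2 / 3 + 3 * d)) * Real.log n := by
    unfold committeeSize at hW
    linarith
  calc (n : ℝ) * (n * (sampleProb n * (7 + 2 * quorum d n)))
      = n * ((n * sampleProb n) * (7 + 2 * quorum d n)) := by ring
    _ ≤ n * (committeeSize n * ((14 + 16 * (2 / 3 + 3 * d)) * Real.log n)) := by gcongr
    _ = wordConstant d * n * Real.log n ^ 2 := by unfold committeeSize wordConstant; ring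

theorem expectedLength_ownWords_le (hd : 0 < d) (hn : 2 ≤ n) (f : ℕ) :
    (multivaluedBA d V BBA).expectedLength f ownWords ≤
      ENNReal.ofReal (wordConstant d * n * Real.log n ^ 2) := by
  refine iSup_le fun adv => ?_
  change ∫⁻ ω, ⨆ t, ((ownTotal ((multivaluedBA d V BBA).run f adv ω t) : ℕ) : ℝ≥0∞)
    ∂(multivaluedBA d V BBA).law ≤ _
  rw [lintegral_law_multivaluedBA
    (Measurable.iSup fun t => measurable_run_comp _ f adv t fun c => ((ownTotal c : ℕ) : ℝ≥0∞))]
  refine le_trans (lintegral_mono fun b => ?_) (lintegral_committeeBudget_le hd hn)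
  refine (lintegral_mono (g := fun _ => (committeeBudget d b : ℝ≥0∞)) fun ω => iSup_le fun t =>
    Nat.cast_le.2 (ownTotal_run_le_committeeBudget f adv b ω t)).trans ?_
  simp

/-- For fixed committees, the messages of the binary protocol are those of a run of that protocol
against the simulator. -/
theorem wordComplexity_multivaluedBA_le (hd : 0 < d) (hn : 2 ≤ n) (f : ℕ) :
    (multivaluedBA d V BBA).wordComplexity f ≤
      ENNReal.ofReal (wordConstant d * n * Real.log n ^ 2) + BBA.wordComplexity f := by
  refine iSup_le fun adv => ?_
  simp_rw [words_eq]
  rw [lintegral_law_multivaluedBA (Measurable.iSup fun t => measurable_run_comp _ f adv t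
    fun c => ((ownTotal c + binaryTotal (proj c) : ℕ) : ℝ≥0∞))]
  have key : ∀ b : Committees n,
      ∫⁻ ω, ⨆ t, ((ownTotal ((multivaluedBA d V BBA).run f adv (joinOutcome d V b ω) t) +
        binaryTotal (proj ((multivaluedBA d V BBA).run f adv (joinOutcome d V b ω) t)) : ℕ) :
          ℝ≥0∞) ∂BBA.law ≤ committeeBudget d b + BBA.wordComplexity f := by
    intro b
    calc _ ≤ ∫⁻ ω, (committeeBudget d b : ℝ≥0∞) +
          ⨆ t, ((binaryTotal (BBA.run f (simulator f adv b) ω t) : ℕ) : ℝ≥0∞) ∂BBA.law := by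
          refine lintegral_mono fun ω => iSup_le fun t => ?_
          rw [Nat.cast_add, ← run_simulator]
          exact add_le_add (Nat.cast_le.2 (ownTotal_run_le_committeeBudget f adv b ω t))
            (le_iSup (fun t => ((binaryTotal (BBA.run f (simulator f adv b) ω t) : ℕ) : ℝ≥0∞)) t)
      _ = committeeBudget d b + ∫⁻ ω,
          ⨆ t, ((binaryTotal (BBA.run f (simulator f adv b) ω t) : ℕ) : ℝ≥0∞) ∂BBA.law := by
          rw [lintegral_add_left measurable_const]
          simp
      _ ≤ _ := by
          gcongr
          exact le_iSup (fun adv : BBA.Adversary =>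
            ∫⁻ ω, ⨆ t, ((binaryTotal (BBA.run f adv ω t) : ℕ) : ℝ≥0∞) ∂BBA.law) _
  refine (lintegral_mono key).trans ?_
  rw [lintegral_add_right _ measurable_const]
  simpa using add_le_add_left (lintegral_committeeBudget_le hd hn) (BBA.wordComplexity f)

end Runs

end MultivaluedBA

theorem IsSoftLinear.of_le_add {g g' : ℕ → ℝ≥0∞} (hg : IsSoftLinear g) (C : ℝ)
    (h : ∀ n : ℕ, 2 ≤ n → g' n ≤ ENNReal.ofReal (C * n * Real.log n ^ 2) + g n) :
    IsSoftLinear g' := by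
  obtain ⟨k, C', hC'⟩ := hg
  refine ⟨k + 2, |C| + |C'|, ?_⟩
  filter_upwards [hC', eventually_ge_atTop 3] with n hn hn3
  have hn' : (3 : ℝ) ≤ n := by exact_mod_cast hn3
  have hlog : 1 ≤ Real.log n := by
    rw [Real.le_log_iff_exp_le (by linarith)]
    linarith [Real.exp_one_lt_d9]
  calc g' n ≤ ENNReal.ofReal (C * n * Real.log n ^ 2) + g n := h n (by omega)
    _ ≤ ENNReal.ofReal (|C| * n * Real.log n ^ (k + 2)) +
        ENNReal.ofReal (|C'| * n * Real.log n ^ (k + 2)) := by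
        refine add_le_add (ENNReal.ofReal_le_ofReal ?_) (hn.trans (ENNReal.ofReal_le_ofReal ?_))
        · gcongr
          · exact le_abs_self C
          · omega
        · gcongr
          · exact le_abs_self C'
          · omega
    _ = ENNReal.ofReal ((|C| + |C'|) * n * Real.log n ^ (k + 2)) := by
        rw [← ENNReal.ofReal_add (by positivity) (by positivity)]
        ring_nf

theorem theorem1 (ε d : ℝ) (hd : 0 < d) (hdε : d < ε / 3) (hε : ε < 1 / 3) :
    ∃ C : ℝ, ∀ (V : ℕ → Type) [∀ n, Finite (V n)] (BBA : ∀ n, Protocol n Bool Bool),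
      (SolvesBinaryStrongBA (maxCorrupt ε) BBA →
        SolvesMultivaluedWeakBA (maxCorrupt ε) fun n => multivaluedBA d (V n) (BBA n)) ∧
      (∀ n : ℕ, 2 ≤ n →
        (multivaluedBA d (V n) (BBA n)).expectedLength (maxCorrupt ε n) MultivaluedBA.ownWords ≤
          ENNReal.ofReal (C * n * Real.log n ^ 2)) ∧
      (∀ n : ℕ, 2 ≤ n →
        (multivaluedBA d (V n) (BBA n)).wordComplexity (maxCorrupt ε n) ≤
          ENNReal.ofReal (C * n * Real.log n ^ 2) + (BBA n).wordComplexity (maxCorrupt ε n)) ∧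
      (IsSoftLinear (fun n => (BBA n).wordComplexity (maxCorrupt ε n)) →
        IsSoftLinear fun n =>
          (multivaluedBA d (V n) (BBA n)).wordComplexity (maxCorrupt ε n)) :=
  ⟨wordConstant d, fun V _ BBA => ⟨solvesMultivaluedWeakBA hd hdε hε V BBA,
    fun _ hn => expectedLength_ownWords_le hd hn _,
    fun _ hn => wordComplexity_multivaluedBA_le hd hn _,
    fun h => h.of_le_add (wordConstant d) fun _ hn => wordComplexity_multivaluedBA_le hd hn _⟩⟩
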